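/- Let $(W(t))_{t\ge 0}$ be either the rate-$1$ Poisson process on $\mathbb{Z}_{\ge 0}^k$ (directed case) or the rate-$1$ continuous-time simple random walk on $\mathbb{Z}^k$ (undirected case), started from $0$; thus the coordinates $W_1,\dots,W_k$ are independent, each being a rate-$1/k$ Poisson process, respectively a rate-$1/k$ continuous-time simple random walk on $\mathbb{Z}$. Let $\mu_t$ be the law of $W(t)$ and $\nu_t$ the law of $W_1(t)$, and put $$Q_1(t) := -\log \nu_t(W_1(t)), \qquad Q(t) := -\log \mu_t(W(t)).$$ For $n\in\mathbb{N}$, the entropic time is a time $t_0 = t_0(k,n)\ge 0$ with $\mathbb{E}[Q_1(t_0)] = (\log n)/k$. Put $v := \mathrm{Var}(Q_1(t_0))$. For $\alpha\in\mathbb{R}$, the cutoff time is a time $t_\alpha = t_\alpha(k,n)\ge 0$ with $$\mathbb{E}[Q_1(t_\alpha)] = \bigl(\log n + \alpha\sqrt{vk}\bigr)/k .$$ Let $\Psi(\alpha) := \mathbb{P}(N(0,1)\ge \alpha)$. Proposition. Let $(k_N)_{N\in\mathbb{N}}$ and $(n_N)_{N\in\mathbb{N}}$ be sequences of natural numbers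 with $n_N\to\infty$, $k_N\to\infty$ and $\log k_N/\log n_N \to 0$ as $N\to\infty$ (that is, $1\ll \log k\ll \log n$). In both the directed and the undirected case, for each $\alpha\in\mathbb{R}$, the times $t_0 = t_0(k_N,n_N)$ and $t_\alpha = t_\alpha(k_N,n_N)$ exist for all sufficiently large $N$, and, for any such times, with $$\omega := \mathrm{Var}(Q(t_0))^{1/4} = (vk_N)^{1/4},$$ we have, as $N\to\infty$, $$\mathbb{P}\bigl(Q(t_\alpha)\le \log n_N + \omega\bigr)\to\Psi(\alpha) \qquad\text{and}\qquad \mathbb{P}\bigl(Q(t_\alpha)\le \log n_N - \omega\bigr)\to\Psi(\alpha).$$ -/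

import Mathlib

open Filter Topology MeasureTheory ProbabilityTheory
open scoped NNReal ENNReal

namespace EntropicTimes

/-- The two versions of the auxiliary walk: simple random walk (undirected Cayley graphs) and
Poisson process (directed Cayley graphs). -/
inductive WalkKind where
  | undirected
  | directed

/-- Law of one step of simple random walk on `ℤ`. -/
noncomputable def stepLaw : Measure ℤ :=
  (2⁻¹ : ℝ≥0∞) • Measure.dirac 1 + (2⁻¹ : ℝ≥0∞) • Measure.dirac (-1)

/-- Law of simple random walk on `ℤ`, started at `0`, after exactly `m` steps. -/
noncomputable def stepsLaw : ℕ → Measure ℤ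
  | 0 => Measure.dirac 0
  | m + 1 => Measure.conv (stepsLaw m) stepLaw

/-- Law at time `s` of the one-dimensional rate-`1` process started from `0`:
in the directed case a Poisson process; in the undirected case the continuous-time simple random
walk, which at time `s` has made a Poisson(`s`) number of steps. -/
noncomputable def unitRateLaw (w : WalkKind) (s : ℝ≥0) : Measure ℤ :=
  match w with
  | .directed => (poissonMeasure s).map (fun m : ℕ => (m : ℤ))
  | .undirected => (poissonMeasure s).bind stepsLaw

/-- `ν_t`: the law of the coordinate `W_1(t)`, a rate-`1/k` process on `ℤ`. -/
noncomputable def coordLaw (w : WalkKind) (k : ℕ) (t : ℝ≥0) : Measure ℤ :=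
  unitRateLaw w (t / k)

/-- `μ_t`: the law of `W(t) = (W_1(t), …, W_k(t))`, whose coordinates are independent with
law `ν_t`. -/
noncomputable def walkLaw (w : WalkKind) (k : ℕ) (t : ℝ≥0) : Measure (Fin k → ℤ) :=
  Measure.pi fun _ => coordLaw w k t

/-- `Q_1(t) = -log ν_t(W_1(t))`, as a function of the value `x` of `W_1(t)`. -/
noncomputable def coordQ (w : WalkKind) (k : ℕ) (t : ℝ≥0) (x : ℤ) : ℝ :=
  -Real.log ((coordLaw w k t).real {x})

/-- `Q(t) = -log μ_t(W(t))`, as a function of the value `x` of `W(t)`. -/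
noncomputable def walkQ (w : WalkKind) (k : ℕ) (t : ℝ≥0) (x : Fin k → ℤ) : ℝ :=
  -Real.log ((walkLaw w k t).real {x})

/-- `E[Q_1(t)]`, the entropy of `W_1(t)`. -/
noncomputable def meanQ₁ (w : WalkKind) (k : ℕ) (t : ℝ≥0) : ℝ :=
  ∫ x, coordQ w k t x ∂(coordLaw w k t)

/-- `Var[Q_1(t)]`. -/
noncomputable def varQ₁ (w : WalkKind) (k : ℕ) (t : ℝ≥0) : ℝ :=
  variance (coordQ w k t) (coordLaw w k t)

/-- `Var[Q(t)]`. -/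
noncomputable def varQ (w : WalkKind) (k : ℕ) (t : ℝ≥0) : ℝ :=
  variance (walkQ w k t) (walkLaw w k t)

/-- `P(Q(t) ≤ c)`. -/
noncomputable def probQLe (w : WalkKind) (k : ℕ) (t : ℝ≥0) (c : ℝ) : ℝ :=
  (walkLaw w k t).real {x | walkQ w k t x ≤ c}

/-- `t₀` is an entropic time for `(k, n)`: the entropy of `W_1(t₀)` is `log n / k`. -/
def IsEntropicTime (w : WalkKind) (k n : ℕ) (t₀ : ℝ≥0) : Prop :=
  meanQ₁ w k t₀ = Real.log n / k

/-- `t` is the cutoff time `t_α` for `(k, n)`, where `t₀` is the entropic time and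
`v = Var[Q_1(t₀)]`. -/
def IsCutoffTime (w : WalkKind) (k n : ℕ) (t₀ : ℝ≥0) (α : ℝ) (t : ℝ≥0) : Prop :=
  meanQ₁ w k t = (Real.log n + α * Real.sqrt (varQ₁ w k t₀ * k)) / k

/-- The tail `Ψ(α) = P(N(0,1) ≥ α)` of the standard normal distribution. -/
noncomputable def gaussianTail (α : ℝ) : ℝ :=
  (gaussianReal 0 1).real (Set.Ici α)

instance : IsProbabilityMeasure stepLaw where
  measure_univ := by simp [stepLaw, ENNReal.inv_two_add_inv_two]

instance isProbabilityMeasure_stepsLaw (m : ℕ) : IsProbabilityMeasure (stepsLaw m) := by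
  induction m with
  | zero => rw [stepsLaw]; infer_instance
  | succ m ih => rw [stepsLaw]; infer_instance

instance (w : WalkKind) (s : ℝ≥0) : IsProbabilityMeasure (unitRateLaw w s) := by
  cases w with
  | undirected =>
    constructor
    simp [unitRateLaw, Measure.bind_apply MeasurableSet.univ (Measurable.of_discrete).aemeasurable]
  | directed => exact Measure.isProbabilityMeasure_map (Measurable.of_discrete).aemeasurable

instance (w : WalkKind) (k : ℕ) (t : ℝ≥0) : IsProbabilityMeasure (coordLaw w k t) := by
  unfold coordLaw; infer_instance

instance (w : WalkKind) (k : ℕ) (t : ℝ≥0) : IsProbabilityMeasure (walkLaw w k t) := by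
  unfold walkLaw; infer_instance

end EntropicTimes

/-!
Write `s = t / k` for the time of a single coordinate. The information content `Q(t)` of the walk
is almost surely the sum of the information contents of its `k` coordinates (`walkQ_ae_eq`), which
are independent with mean `entropy w s`, variance `varentropy w s` and finite third moment. So the
statement is a central limit theorem for a triangular array: by `tendsto_pi_real_sum_le`, which is
proved with characteristic functions and Lévy's continuity theorem, it remains to check Lyapunov's
condition and to see that the variance at the cutoff time is asymptotic to the variance at the
entropic time. The shift `± ω` is invisible, as `ω` is the square root of the standard deviation
`√(v k)`, and `v k → ∞`.

These facts are needed along all sequences `(k, n)` with `log k ≪ log n`, for which `log n / k`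
may tend to `0`, stay bounded or tend to infinity; correspondingly the time `s` of a coordinate
is short, of constant order or long.

* Long times. The law of a coordinate is that of a difference of independent Poisson variables
  (`unitRateLaw_eq_conv`). The local limit theorem (`exists_local_limit`) says that, for the
  displacement `X` in units of the standard deviation, `Q` is close to `log √(2πs) + X² / 2` on
  bounded ranges of `X`. Gaussian lower bounds for the point masses (`exp_le_sqrt_mul_pmf`) control
  `Q` elsewhere. Hence the varentropy tends to `Var (Z² / 2) = 1 / 2`
  (`tendsto_varentropy_atTop`), and the third moment stays bounded.
* Times of constant order. The moments of `Q` are continuous in time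
  (`continuousOn_integral_unitQ_pow`), and the varentropy does not vanish (`varentropy_pos`).
* Short times. A coordinate hardly moves, and all moments of `Q` are carried by a single jump:
  `E[Q ^ j]` is asymptotic to `s * log (1 / s) ^ j` (`tendsto_integral_unitQ_pow_div`). So with
  `h` the entropy, the varentropy is asymptotic to `h * log (1 / h)`, and the squared Lyapunov ratio
  is at most of order `log (1 / h) / h`. As `h` is about `log n / k`, Lyapunov's condition becomes
  `log (1 / h) ≪ log n`, which is where `log k ≪ log n` enters (`tendsto_neg_log_entropy_div`).

The entropy is continuous, strictly increasing (`strictMono_entropy`, by Jensen's inequality) and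
unbounded. Thus entropic times and cutoff times exist, and closeness of entropies can be turned
into closeness of times. The three regimes are separated by passing to ultrafilters
(`tendsto_trichotomy`).
-/

namespace EntropicTimes

/-! ### Characteristic functions of the one-dimensional laws -/

/-- The rate of the jumps by `+1`. -/
noncomputable def WalkKind.up : WalkKind → ℝ≥0
  | .undirected => 2⁻¹
  | .directed => 1

/-- The rate of the jumps by `-1`. -/
noncomputable def WalkKind.down : WalkKind → ℝ≥0
  | .undirected => 2⁻¹
  | .directed => 0

lemma up_add_down (w : WalkKind) : (w.up : ℝ) + w.down = 1 := by
  cases w <;> norm_num [WalkKind.up, WalkKind.down]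

lemma charFun_stepsLaw (m : ℕ) (θ : ℝ) :
    charFun ((stepsLaw m).map (Int.cast : ℤ → ℝ)) θ = (Complex.cos θ) ^ m := by
  induction m with
  | zero =>
    rw [stepsLaw, Measure.map_dirac]
    simp
  | succ m ih =>
    have h := Measure.map_conv_addMonoidHom (μ := stepsLaw m) (ν := stepLaw)
      (L := Int.castAddHom ℝ) (by fun_prop)
    simp only [Int.coe_castAddHom] at h
    rw [stepsLaw, h, charFun_conv, ih, pow_succ]
    congr 1
    rw [charFun_apply_real, integral_map (by fun_prop) (by fun_prop), stepLaw,
      integral_add_measure (Integrable.smul_measure (by simp [integrable_dirac]) (by simp))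
        (Integrable.smul_measure (by simp [integrable_dirac]) (by simp)),
      integral_smul_measure, integral_smul_measure]
    simp only [integral_dirac, Complex.cos]
    simp [Complex.real_smul]
    ring

lemma charFun_unitRateLaw_undirected (s : ℝ≥0) (θ : ℝ) :
    charFun ((unitRateLaw .undirected s).map (Int.cast : ℤ → ℝ)) θ =
      Complex.exp (s * (Complex.cos θ - 1)) := by
  let κ : Kernel ℕ ℤ := Kernel.ofFunOfCountable stepsLaw
  have hb : unitRateLaw .undirected s = (κ ∘ₖ Kernel.const Unit (poissonMeasure s)) () := by
    rw [Kernel.comp_apply]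
    rfl
  have hint : ∀ μ : Measure ℤ, IsProbabilityMeasure μ →
      Integrable (fun x : ℤ => Complex.exp (θ * (x : ℝ) * Complex.I)) μ := by
    intro μ hμ
    refine Integrable.of_bound (by fun_prop) 1 (ae_of_all _ fun x => ?_)
    rw [← Complex.ofReal_mul, Complex.norm_exp_ofReal_mul_I]
  rw [charFun_apply_real, integral_map (by fun_prop) (by fun_prop), hb,
    Kernel.integral_comp (hb ▸ hint _ inferInstance)]
  simp only [Kernel.const_apply]
  have h2 : ∀ m, ∫ x : ℤ, Complex.exp (θ * (x : ℝ) * Complex.I) ∂(κ m) = (Complex.cos θ) ^ m := by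
    intro m
    rw [← charFun_stepsLaw m θ, charFun_apply_real, integral_map (by fun_prop) (by fun_prop)]
    rfl
  simp_rw [h2]
  rw [integral_poissonMeasure]
  calc ∑' n : ℕ, (Real.exp (-s) * (s : ℝ) ^ n / n.factorial) • Complex.cos θ ^ n
      = ∑' n : ℕ, (Real.exp (-s) : ℂ) * ((s * Complex.cos θ) ^ n / n.factorial) := by
        congr with n
        rw [Complex.real_smul, mul_pow]
        push_cast
        ring
    _ = Complex.exp (s * (Complex.cos θ - 1)) := by
        rw [tsum_mul_left, (NormedSpace.expSeries_div_hasSum_exp (s * Complex.cos θ)).tsum_eq,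
          ← Complex.exp_eq_exp_ℂ, Complex.ofReal_exp, ← Complex.exp_add]
        push_cast
        ring_nf

lemma poissonMeasure_zero : poissonMeasure 0 = Measure.dirac 0 := by
  refine Measure.ext_of_singleton fun n => ?_
  rw [poissonMeasure_singleton]
  rcases n with _ | n <;> simp

/-- The law of the unit-rate walk is that of the difference of two independent Poisson variables,
the numbers of up- and of down-jumps. -/
theorem unitRateLaw_eq_conv (w : WalkKind) (s : ℝ≥0) :
    unitRateLaw w s = Measure.conv ((poissonMeasure (w.up * s)).map (fun n : ℕ => (n : ℤ)))
      ((poissonMeasure (w.down * s)).map (fun n : ℕ => -(n : ℤ))) := by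
  have hcast : ∀ r : ℝ≥0, ((poissonMeasure r).map (fun n : ℕ => (n : ℤ))).map
      (Int.cast : ℤ → ℝ) = (poissonMeasure r).map (Nat.cast : ℕ → ℝ) := fun r => by
    rw [Measure.map_map (by fun_prop) (by fun_prop)]; rfl
  cases w with
  | directed =>
    simp [WalkKind.up, WalkKind.down, unitRateLaw, poissonMeasure_zero, Measure.map_dirac]
  | undirected =>
    have hemb : MeasurableEmbedding (Int.cast : ℤ → ℝ) :=
      Int.isClosedEmbedding_coe_real.measurableEmbedding
    apply hemb.map_injective
    apply Measure.ext_of_charFun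
    ext θ
    have h := Measure.map_conv_addMonoidHom
      (μ := (poissonMeasure (WalkKind.undirected.up * s)).map (fun n : ℕ => (n : ℤ)))
      (ν := (poissonMeasure (WalkKind.undirected.down * s)).map (fun n : ℕ => -(n : ℤ)))
      (L := Int.castAddHom ℝ) (by fun_prop)
    simp only [Int.coe_castAddHom] at h
    have hneg : ((poissonMeasure (WalkKind.undirected.down * s)).map (fun n : ℕ => -(n : ℤ))).map
        (Int.cast : ℤ → ℝ) =
        ((poissonMeasure (WalkKind.undirected.down * s)).map (Nat.cast : ℕ → ℝ)).map
          ((-1 : ℝ) * ·) := by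
      rw [Measure.map_map (by fun_prop) (by fun_prop), Measure.map_map (by fun_prop) (by fun_prop)]
      congr 1
      ext n
      simp
    rw [charFun_unitRateLaw_undirected, h, charFun_conv, hcast, hneg, charFun_map_mul,
      charFun_map_cast_poissonMeasure, charFun_map_cast_poissonMeasure, ← Complex.exp_add,
      Complex.cos]
    congr 1
    simp only [WalkKind.up, WalkKind.down]
    push_cast
    ring_nf

/-! ### Point masses, moments and exponential tails -/

/-- The mass that the unit-rate walk at time `s` gives to `x`. -/
noncomputable def pmf (w : WalkKind) (s : ℝ≥0) (x : ℤ) : ℝ := (unitRateLaw w s).real {x}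

/-- The mean displacement of the unit-rate walk per unit of time. -/
noncomputable def WalkKind.drift (w : WalkKind) : ℝ := w.up - w.down

lemma pmf_nonneg (w : WalkKind) (s : ℝ≥0) (x : ℤ) : 0 ≤ pmf w s x := measureReal_nonneg

lemma charFun_unitRateLaw (w : WalkKind) (s : ℝ≥0) (θ : ℝ) :
    charFun ((unitRateLaw w s).map (Int.cast : ℤ → ℝ)) θ =
      Complex.exp (s * (w.up * Complex.exp (θ * Complex.I) +
        w.down * Complex.exp (-(θ * Complex.I)) - 1)) := by
  cases w with
  | directed =>
    rw [unitRateLaw, Measure.map_map (by fun_prop) (by fun_prop)]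
    have := charFun_map_cast_poissonMeasure s θ
    simp only [WalkKind.up, WalkKind.down]
    convert this using 2
    · rfl
    · simp
  | undirected =>
    rw [charFun_unitRateLaw_undirected]
    congr 1
    simp only [WalkKind.up, WalkKind.down, Complex.cos]
    push_cast
    ring_nf

/-- The increments of the walk are stationary and independent. -/
lemma unitRateLaw_add (w : WalkKind) (s u : ℝ≥0) :
    unitRateLaw w (s + u) = Measure.conv (unitRateLaw w s) (unitRateLaw w u) := by
  have hemb : MeasurableEmbedding (Int.cast : ℤ → ℝ) :=
    Int.isClosedEmbedding_coe_real.measurableEmbedding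
  apply hemb.map_injective
  apply Measure.ext_of_charFun
  ext θ
  have h := Measure.map_conv_addMonoidHom (μ := unitRateLaw w s) (ν := unitRateLaw w u)
    (L := Int.castAddHom ℝ) (by fun_prop)
  simp only [Int.coe_castAddHom] at h
  rw [h, charFun_conv, charFun_unitRateLaw, charFun_unitRateLaw, charFun_unitRateLaw,
    ← Complex.exp_add]
  push_cast
  ring_nf

lemma conv_real_singleton (μ ν : Measure ℤ) [IsProbabilityMeasure μ] [IsProbabilityMeasure ν]
    (x : ℤ) : (Measure.conv μ ν).real {x} = ∫ y, μ.real {x - y} ∂ν := by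
  have h1 : (Measure.conv μ ν) {x} = ∫⁻ y, μ {x - y} ∂ν := by
    rw [Measure.conv, Measure.map_apply (by fun_prop) (by simp),
      Measure.prod_apply_symm (MeasurableSet.of_discrete)]
    refine lintegral_congr fun y => congrArg μ ?_
    ext z
    simp [eq_sub_iff_add_eq]
  rw [measureReal_def, h1, integral_eq_lintegral_of_nonneg_ae
    (ae_of_all _ fun _ => measureReal_nonneg) (by fun_prop)]
  congr 1
  refine lintegral_congr fun y => ?_
  rw [ofReal_measureReal]

lemma sum_le_conv_real_singleton (μ ν : Measure ℤ) [IsProbabilityMeasure μ]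
    [IsProbabilityMeasure ν] (x : ℤ) (J : Finset ℤ) :
    ∑ y ∈ J, μ.real {x - y} * ν.real {y} ≤ (Measure.conv μ ν).real {x} := by
  have hint : Integrable (fun y => μ.real {x - y}) ν :=
    Integrable.of_bound (by fun_prop) 1 (ae_of_all _ fun y => by
      rw [Real.norm_of_nonneg measureReal_nonneg]; exact measureReal_le_one)
  rw [conv_real_singleton]
  calc ∑ y ∈ J, μ.real {x - y} * ν.real {y} = ∫ y in (J : Set ℤ), μ.real {x - y} ∂ν := by
        rw [setIntegral_finset (hf := hint.integrableOn)]
        simp [mul_comm]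
    _ ≤ _ := setIntegral_le_integral hint (ae_of_all _ fun _ => measureReal_nonneg)

lemma pmf_add (w : WalkKind) (s u : ℝ≥0) (x : ℤ) :
    pmf w (s + u) x = ∫ y, pmf w s (x - y) ∂(unitRateLaw w u) := by
  rw [pmf, unitRateLaw_add, conv_real_singleton]; rfl

lemma integral_unitRateLaw (w : WalkKind) (s : ℝ≥0) (f : ℤ → ℝ) :
    ∫ x, f x ∂(unitRateLaw w s) = ∑' x, pmf w s x * f x := by
  conv_lhs => rw [← Measure.sum_smul_dirac (unitRateLaw w s)]
  rw [integral_sum_dirac (fun _ => measure_ne_top _ _)]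
  rfl

lemma integrable_unitRateLaw_iff {w : WalkKind} {s : ℝ≥0} {f : ℤ → ℝ} :
    Integrable f (unitRateLaw w s) ↔ Summable fun x => pmf w s x * |f x| := by
  conv_lhs => rw [← Measure.sum_smul_dirac (unitRateLaw w s)]
  rw [integrable_sum_dirac_iff (fun _ => measure_ne_top _ _)]
  rfl

lemma integrable_exp_poissonMeasure (r : ℝ≥0) (θ : ℝ) :
    Integrable (fun n : ℕ => Real.exp (θ * n)) (poissonMeasure r) ∧
    ∫ n : ℕ, Real.exp (θ * n) ∂(poissonMeasure r) = Real.exp (r * (Real.exp θ - 1)) := by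
  have h : HasSum (fun n : ℕ => (Real.exp (-r) * (r : ℝ) ^ n / n.factorial) * Real.exp (θ * n))
      (Real.exp (r * (Real.exp θ - 1))) := by
    convert! (NormedSpace.expSeries_div_hasSum_exp ((r : ℝ) * Real.exp θ)).mul_left
      (Real.exp (-r)) using 1
    · ext n
      rw [mul_comm θ, Real.exp_nat_mul, mul_pow]
      ring
    · rw [← Real.exp_eq_exp_ℝ, ← Real.exp_add]
      ring_nf
  have hi : Integrable (fun n : ℕ => Real.exp (θ * n)) (poissonMeasure r) := by
    rw [integrable_poissonMeasure_iff]
    simpa [abs_of_pos (Real.exp_pos _)] using h.summable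
  refine ⟨hi, ?_⟩
  rw [integral_poissonMeasure' hi]
  exact h.tsum_eq

lemma integrable_exp_unitRateLaw (w : WalkKind) (s : ℝ≥0) (θ : ℝ) :
    Integrable (fun x : ℤ => Real.exp (θ * x)) (unitRateLaw w s) ∧
    ∫ x : ℤ, Real.exp (θ * x) ∂(unitRateLaw w s) =
      Real.exp (s * (w.up * Real.exp θ + w.down * Real.exp (-θ) - 1)) := by
  obtain ⟨i1, e1⟩ := integrable_exp_poissonMeasure (w.up * s) θ
  obtain ⟨i2, e2⟩ := integrable_exp_poissonMeasure (w.down * s) (-θ)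
  have j1 : Integrable (fun x : ℤ => Real.exp (θ * x))
      ((poissonMeasure (w.up * s)).map (fun n : ℕ => (n : ℤ))) := by
    rw [integrable_map_measure (by fun_prop) (by fun_prop)]
    simpa [Function.comp_def] using i1
  have j2 : Integrable (fun x : ℤ => Real.exp (θ * x))
      ((poissonMeasure (w.down * s)).map (fun n : ℕ => -(n : ℤ))) := by
    rw [integrable_map_measure (by fun_prop) (by fun_prop)]
    simpa [Function.comp_def] using i2
  have hfun : ((fun x : ℤ => Real.exp (θ * x)) ∘ fun p : ℤ × ℤ => p.1 + p.2) =
      fun p => Real.exp (θ * p.1) * Real.exp (θ * p.2) := by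
    ext p
    simp [← Real.exp_add, mul_add]
  rw [unitRateLaw_eq_conv, Measure.conv, integrable_map_measure (by fun_prop) (by fun_prop),
    integral_map (by fun_prop) (by fun_prop)]
  refine ⟨?_, ?_⟩
  · rw [hfun]
    have : ∀ r, IsProbabilityMeasure ((poissonMeasure r).map (fun n : ℕ => -(n : ℤ))) := fun r =>
      Measure.isProbabilityMeasure_map (by fun_prop)
    exact j1.mul_prod j2
  · have h2 := congrFun hfun
    simp only [Function.comp_apply] at h2
    simp_rw [h2]
    have : ∀ r, IsProbabilityMeasure ((poissonMeasure r).map (fun n : ℕ => -(n : ℤ))) := fun r =>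
      Measure.isProbabilityMeasure_map (by fun_prop)
    rw [integral_prod_mul (f := fun x : ℤ => Real.exp (θ * x))
      (g := fun x : ℤ => Real.exp (θ * x)), integral_map (by fun_prop) (by fun_prop),
      integral_map (by fun_prop) (by fun_prop)]
    have e2' : ∫ x : ℕ, Real.exp (θ * ((-(x : ℤ) : ℤ) : ℝ)) ∂(poissonMeasure (w.down * s)) =
        Real.exp ((w.down * s : ℝ≥0) * (Real.exp (-θ) - 1)) := by
      rw [← e2]; simp
    rw [e2']
    simp only [Int.cast_natCast]
    rw [e1, ← Real.exp_add]
    congr 1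
    have := up_add_down w
    push_cast
    linear_combination (-(s : ℝ)) * this

lemma integrable_exp_abs_unitRateLaw (w : WalkKind) (s : ℝ≥0) {c : ℝ} (hc : 0 ≤ c) :
    Integrable (fun x : ℤ => Real.exp (c * |(x : ℝ)|)) (unitRateLaw w s) ∧
    ∫ x : ℤ, Real.exp (c * |(x : ℝ)|) ∂(unitRateLaw w s) ≤
      2 * Real.exp (s * (Real.exp c - 1)) := by
  obtain ⟨i1, e1⟩ := integrable_exp_unitRateLaw w s c
  obtain ⟨i2, e2⟩ := integrable_exp_unitRateLaw w s (-c)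
  have hle : ∀ x : ℤ, Real.exp (c * |(x : ℝ)|) ≤ Real.exp (c * x) + Real.exp (-c * x) := by
    intro x
    rcases abs_cases (x : ℝ) with ⟨h, -⟩ | ⟨h, -⟩ <;> rw [h]
    · linarith [Real.exp_pos (-c * (x : ℝ))]
    · rw [mul_neg, ← neg_mul]; linarith [Real.exp_pos (c * (x : ℝ))]
  have hi : Integrable (fun x : ℤ => Real.exp (c * |(x : ℝ)|)) (unitRateLaw w s) :=
    (i1.add i2).mono' (by fun_prop) (ae_of_all _ fun x => by
      rw [Real.norm_of_nonneg (Real.exp_pos _).le]; exact hle x)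
  refine ⟨hi, ?_⟩
  have hcc : Real.exp (-c) ≤ Real.exp c := Real.exp_le_exp.2 (by linarith)
  have hud := up_add_down w
  have hu : (0 : ℝ) ≤ w.up := NNReal.coe_nonneg _
  have hd : (0 : ℝ) ≤ w.down := NNReal.coe_nonneg _
  have hud' : (w.up : ℝ) * Real.exp c + w.down * Real.exp c = Real.exp c := by
    rw [← add_mul, hud, one_mul]
  calc _ ≤ ∫ x : ℤ, (Real.exp (c * x) + Real.exp (-c * x)) ∂(unitRateLaw w s) :=
        integral_mono hi (i1.add i2) hle
    _ ≤ _ := by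
        rw [integral_add i1 i2, e1, e2, neg_neg, two_mul]
        gcongr
        · linarith [mul_le_mul_of_nonneg_left hcc hd, hud']
        · linarith [mul_le_mul_of_nonneg_left hcc hu, hud']

/-- The exponential Chebyshev bound for the point masses of the walk. -/
lemma pmf_le_exp (w : WalkKind) (s : ℝ≥0) {c : ℝ} (hc : 0 ≤ c) (x : ℤ) :
    pmf w s x ≤ 2 * Real.exp (s * (Real.exp c - 1)) * Real.exp (-(c * |(x : ℝ)|)) := by
  obtain ⟨hi, hle⟩ := integrable_exp_abs_unitRateLaw w s hc
  have h1 : pmf w s x * Real.exp (c * |(x : ℝ)|) ≤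
      ∫ x : ℤ, Real.exp (c * |(x : ℝ)|) ∂(unitRateLaw w s) := by
    calc _ = ∫ y in {x}, Real.exp (c * |(y : ℝ)|) ∂(unitRateLaw w s) := by
          rw [integral_singleton]; rfl
      _ ≤ _ := setIntegral_le_integral hi (ae_of_all _ fun _ => (Real.exp_pos _).le)
  rw [Real.exp_neg, ← div_eq_mul_inv, le_div_iff₀ (Real.exp_pos _)]
  exact h1.trans hle

lemma poissonMeasure_real_zero (r : ℝ≥0) : (poissonMeasure r).real {0} = Real.exp (-r) := by
  simp [poissonMeasure_real_singleton]

lemma map_natCast_real_singleton (r : ℝ≥0) (n : ℕ) :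
    ((poissonMeasure r).map (fun n : ℕ => (n : ℤ))).real {(n : ℤ)} =
      (poissonMeasure r).real {n} := by
  rw [map_measureReal_apply (by fun_prop) (by simp)]
  congr 1
  ext m
  simp

lemma map_neg_natCast_real_singleton (r : ℝ≥0) (n : ℕ) :
    ((poissonMeasure r).map (fun n : ℕ => -(n : ℤ))).real {-(n : ℤ)} =
      (poissonMeasure r).real {n} := by
  rw [map_measureReal_apply (by fun_prop) (by simp)]
  congr 1
  ext m
  simp

lemma isProbabilityMeasure_map_neg_natCast (r : ℝ≥0) :
    IsProbabilityMeasure ((poissonMeasure r).map (fun n : ℕ => -(n : ℤ))) :=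
  Measure.isProbabilityMeasure_map (by fun_prop)

/-- Different pairs of jump counts `(i, j)` with `i - j = x` contribute separately to the mass
of `x`. -/
lemma sum_poisson_mul_le_pmf (w : WalkKind) (s : ℝ≥0) (m : ℕ) (J : Finset ℕ) :
    ∑ j ∈ J, (poissonMeasure (w.up * s)).real {m + j} * (poissonMeasure (w.down * s)).real {j} ≤
      pmf w s m := by
  have := isProbabilityMeasure_map_neg_natCast (w.down * s)
  have h := sum_le_conv_real_singleton ((poissonMeasure (w.up * s)).map (fun n : ℕ => (n : ℤ)))
    ((poissonMeasure (w.down * s)).map (fun n : ℕ => -(n : ℤ))) m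
    (J.map ⟨fun n : ℕ => -(n : ℤ), fun a b h => by simpa using h⟩)
  rw [← unitRateLaw_eq_conv, Finset.sum_map] at h
  refine le_trans (le_of_eq ?_) h
  refine Finset.sum_congr rfl fun j _ => ?_
  change _ = (Measure.map _ _).real {(m : ℤ) - -(j : ℤ)} * (Measure.map _ _).real {-(j : ℤ)}
  rw [map_neg_natCast_real_singleton, sub_neg_eq_add, ← Nat.cast_add, map_natCast_real_singleton]

lemma sum_poisson_mul_le_pmf_neg (w : WalkKind) (s : ℝ≥0) (m : ℕ) (J : Finset ℕ) :
    ∑ j ∈ J, (poissonMeasure (w.up * s)).real {j} * (poissonMeasure (w.down * s)).real {m + j} ≤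
      pmf w s (-m) := by
  have := isProbabilityMeasure_map_neg_natCast (w.down * s)
  have h := sum_le_conv_real_singleton ((poissonMeasure (w.up * s)).map (fun n : ℕ => (n : ℤ)))
    ((poissonMeasure (w.down * s)).map (fun n : ℕ => -(n : ℤ))) (-m)
    (J.map ⟨fun n : ℕ => -((m + n : ℕ) : ℤ), fun a b h => by
      simp only [Nat.cast_add, neg_inj, add_right_inj, Nat.cast_inj] at h; exact h⟩)
  rw [← unitRateLaw_eq_conv, Finset.sum_map] at h
  refine le_trans (le_of_eq ?_) h
  refine Finset.sum_congr rfl fun j _ => ?_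
  change _ = (Measure.map _ _).real {(-(m : ℤ) - -((m + j : ℕ) : ℤ))} *
    (Measure.map _ _).real {-((m + j : ℕ) : ℤ)}
  rw [map_neg_natCast_real_singleton, show (-(m : ℤ) - -((m + j : ℕ) : ℤ)) = (j : ℤ) by
    push_cast; ring, map_natCast_real_singleton]

lemma pmf_directed_neg (s : ℝ≥0) {x : ℤ} (hx : x < 0) : pmf .directed s x = 0 := by
  rw [pmf, unitRateLaw, map_measureReal_apply (by fun_prop) (by simp),
    show ((fun m : ℕ => (m : ℤ)) ⁻¹' {x}) = ∅ by
      ext m; simp only [Set.mem_preimage, Set.mem_singleton_iff, Set.mem_empty_iff_false]; lia]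
  simp

/-- The mass of `x` is at least that of making `|x|` jumps, all in the direction of `x`. -/
lemma le_pmf (w : WalkKind) (s : ℝ≥0) {x : ℤ} (hx : w = .undirected ∨ 0 ≤ x) :
    Real.exp (-s) * ((s : ℝ) / 2) ^ x.natAbs / (x.natAbs).factorial ≤ pmf w s x := by
  have hud := up_add_down w
  have hs : (0 : ℝ) ≤ s := s.2
  have key : ∀ (a b : ℝ≥0) (n : ℕ), (a : ℝ) + b = 1 → (2⁻¹ : ℝ) ≤ a →
      Real.exp (-s) * ((s : ℝ) / 2) ^ n / n.factorial ≤
        (poissonMeasure (a * s)).real {n} * (poissonMeasure (b * s)).real {0} := by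
    intro a b n hab ha
    rw [poissonMeasure_real_zero, poissonMeasure_real_singleton]
    calc Real.exp (-s) * ((s : ℝ) / 2) ^ n / n.factorial
        ≤ Real.exp (-s) * (((a * s : ℝ≥0) : ℝ)) ^ n / n.factorial := by
          push_cast; gcongr; nlinarith
      _ = _ := by
          have : Real.exp (-(s : ℝ)) =
              Real.exp (-((a * s : ℝ≥0) : ℝ)) * Real.exp (-((b * s : ℝ≥0) : ℝ)) := by
            rw [← Real.exp_add]; congr 1; push_cast; linear_combination (s : ℝ) * hab
          rw [this]; ring
  rcases le_or_gt 0 x with h0 | h0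
  · obtain ⟨m, rfl⟩ := Int.eq_ofNat_of_zero_le h0
    have h := sum_poisson_mul_le_pmf w s m {0}
    simp only [Finset.sum_singleton, add_zero] at h
    rw [Int.natAbs_natCast]
    exact (key _ _ m hud (by cases w <;> norm_num [WalkKind.up])).trans h
  · have hw : w = .undirected := hx.resolve_right (by lia)
    obtain ⟨m, hm⟩ := Int.eq_ofNat_of_zero_le (a := -x) (by lia)
    obtain rfl : x = -m := by lia
    have h := sum_poisson_mul_le_pmf_neg w s m {0}
    simp only [Finset.sum_singleton, add_zero] at h
    rw [Int.natAbs_neg, Int.natAbs_natCast]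
    refine (key _ _ m ((add_comm _ _).trans hud) ?_).trans ((mul_comm _ _).trans_le h)
    rw [hw]; norm_num [WalkKind.down]

lemma pmf_pos {w : WalkKind} {s : ℝ≥0} (hs : 0 < s) {x : ℤ} (hx : w = .undirected ∨ 0 ≤ x) :
    0 < pmf w s x := by
  refine lt_of_lt_of_le ?_ (le_pmf w s hx)
  have : (0 : ℝ) < s := hs
  positivity

lemma pmf_eq_zero {w : WalkKind} {s : ℝ≥0} {x : ℤ} (hx : ¬ (w = .undirected ∨ 0 ≤ x)) :
    pmf w s x = 0 := by
  push Not at hx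
  cases w with
  | undirected => exact absurd rfl hx.1
  | directed => exact pmf_directed_neg s hx.2

lemma exp_neg_le_pmf_zero (w : WalkKind) (s : ℝ≥0) : Real.exp (-s) ≤ pmf w s 0 := by
  simpa using le_pmf w s (x := 0) (Or.inr le_rfl)

lemma pmf_le_one (w : WalkKind) (s : ℝ≥0) (x : ℤ) : pmf w s x ≤ 1 := measureReal_le_one

lemma hasSum_pmf (w : WalkKind) (s : ℝ≥0) : HasSum (pmf w s) 1 := by
  have h1 : Summable fun x => pmf w s x * |(fun _ => (1 : ℝ)) x| :=
    integrable_unitRateLaw_iff.1 (integrable_const _)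
  have h2 := integral_unitRateLaw w s fun _ => 1
  simp only [abs_one, mul_one] at h1
  simp only [integral_const, probReal_univ, smul_eq_mul, mul_one] at h2
  rw [h2]
  exact h1.hasSum

/-! ### Centred moments of the walk -/

/-- The displacement of a site from the mean of the walk at time `s`. -/
noncomputable def dev (w : WalkKind) (s : ℝ≥0) (x : ℤ) : ℝ := x - s * w.drift

lemma integrable_exp_dev (w : WalkKind) (s : ℝ≥0) (θ : ℝ) :
    Integrable (fun x => Real.exp (θ * dev w s x)) (unitRateLaw w s) ∧
    ∫ x, Real.exp (θ * dev w s x) ∂(unitRateLaw w s) =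
      Real.exp (s * (w.up * (Real.exp θ - 1 - θ) + w.down * (Real.exp (-θ) - 1 + θ))) := by
  obtain ⟨hi, he⟩ := integrable_exp_unitRateLaw w s θ
  have h : ∀ x, Real.exp (θ * dev w s x) =
      Real.exp (-(θ * s * w.drift)) * Real.exp (θ * x) := fun x => by
    rw [← Real.exp_add, dev]; ring_nf
  simp_rw [h]
  refine ⟨hi.const_mul _, ?_⟩
  rw [integral_const_mul, he, ← Real.exp_add, WalkKind.drift]
  congr 1
  linear_combination (s : ℝ) * up_add_down w

lemma interior_integrableExpSet_dev (w : WalkKind) (s : ℝ≥0) :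
    interior (integrableExpSet (dev w s) (unitRateLaw w s)) = Set.univ := by
  have : integrableExpSet (dev w s) (unitRateLaw w s) = Set.univ :=
    Set.eq_univ_of_forall fun θ => (integrable_exp_dev w s θ).1
  rw [this, interior_univ]

lemma integrable_pow_dev (w : WalkKind) (s : ℝ≥0) (j : ℕ) :
    Integrable (fun x => dev w s x ^ j) (unitRateLaw w s) :=
  integrable_pow_of_mem_interior_integrableExpSet
    (by rw [interior_integrableExpSet_dev]; trivial) j

/-- The centred second and fourth moments of the walk, read off from the derivatives at `0` of the
moment generating function `exp K`. -/
lemma moments_dev (w : WalkKind) (s : ℝ≥0) :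
    ∫ x, dev w s x ^ 2 ∂(unitRateLaw w s) = s ∧
    ∫ x, dev w s x ^ 4 ∂(unitRateLaw w s) = 3 * s ^ 2 + s := by
  have h0 : (0 : ℝ) ∈ interior (integrableExpSet (dev w s) (unitRateLaw w s)) := by
    rw [interior_integrableExpSet_dev]; trivial
  set a : ℝ := (w.up : ℝ)
  set b : ℝ := (w.down : ℝ)
  have hab : a + b = 1 := up_add_down w
  set K : ℝ → ℝ := fun θ => s * (a * (Real.exp θ - 1 - θ) + b * (Real.exp (-θ) - 1 + θ))
  set K₁ : ℝ → ℝ := fun θ => s * (a * (Real.exp θ - 1) + b * (-Real.exp (-θ) + 1))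
  set K₂ : ℝ → ℝ := fun θ => s * (a * Real.exp θ + b * Real.exp (-θ))
  set K₃ : ℝ → ℝ := fun θ => s * (a * Real.exp θ - b * Real.exp (-θ))
  have e1 : ∀ θ : ℝ, HasDerivAt (fun θ => Real.exp θ) (Real.exp θ) θ := Real.hasDerivAt_exp
  have e2 : ∀ θ : ℝ, HasDerivAt (fun θ => Real.exp (-θ)) (-Real.exp (-θ)) θ := fun θ => by
    simpa using (hasDerivAt_neg θ).exp
  have d0 : ∀ θ, HasDerivAt K (K₁ θ) θ := fun θ =>
    (((((e1 θ).sub_const 1).sub (hasDerivAt_id θ)).const_mul a).add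
      ((((e2 θ).sub_const 1).add (hasDerivAt_id θ)).const_mul b)).const_mul (s : ℝ)
  have d1 : ∀ θ, HasDerivAt K₁ (K₂ θ) θ := fun θ => by
    simpa [K₂] using ((((e1 θ).sub_const 1).const_mul a).add
      (((e2 θ).neg.add_const 1).const_mul b)).const_mul (s : ℝ)
  have d2 : ∀ θ, HasDerivAt K₂ (K₃ θ) θ := fun θ => by
    simpa [K₃, sub_eq_add_neg] using
      (((e1 θ).const_mul a).add ((e2 θ).const_mul b)).const_mul (s : ℝ)
  have d3 : ∀ θ, HasDerivAt K₃ (K₂ θ) θ := fun θ => by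
    simpa [K₂] using (((e1 θ).const_mul a).sub ((e2 θ).const_mul b)).const_mul (s : ℝ)
  set G : ℝ → ℝ := fun θ => Real.exp (K θ)
  have g0 : ∀ θ, HasDerivAt G (K₁ θ * G θ) θ := fun θ => by
    simpa [G, mul_comm] using (d0 θ).exp
  have g1 : ∀ θ, HasDerivAt (fun θ => K₁ θ * G θ) ((K₂ θ + K₁ θ ^ 2) * G θ) θ := fun θ => by
    convert! (d1 θ).mul (g0 θ) using 1; ring
  have g2 : ∀ θ, HasDerivAt (fun θ => (K₂ θ + K₁ θ ^ 2) * G θ)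
      ((K₃ θ + 3 * K₁ θ * K₂ θ + K₁ θ ^ 3) * G θ) θ := fun θ => by
    convert! ((d2 θ).add ((d1 θ).pow 2)).mul (g0 θ) using 1
    simp; ring
  have g3 : ∀ θ, HasDerivAt (fun θ => (K₃ θ + 3 * K₁ θ * K₂ θ + K₁ θ ^ 3) * G θ)
      ((K₂ θ + 4 * K₁ θ * K₃ θ + 3 * K₂ θ ^ 2 + 6 * K₁ θ ^ 2 * K₂ θ + K₁ θ ^ 4) * G θ) θ :=
    fun θ => by
      convert! (((d3 θ).add (((d1 θ).const_mul 3).mul (d2 θ))).add ((d1 θ).pow 3)).mul (g0 θ)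
        using 1
      simp; ring
  have hmgf : mgf (dev w s) (unitRateLaw w s) = G := funext fun θ => (integrable_exp_dev w s θ).2
  have hd1 : deriv G = fun θ => K₁ θ * G θ := funext fun θ => (g0 θ).deriv
  have hd2 : deriv (fun θ => K₁ θ * G θ) = fun θ => (K₂ θ + K₁ θ ^ 2) * G θ :=
    funext fun θ => (g1 θ).deriv
  have hd3 : deriv (fun θ => (K₂ θ + K₁ θ ^ 2) * G θ) =
      fun θ => (K₃ θ + 3 * K₁ θ * K₂ θ + K₁ θ ^ 3) * G θ := funext fun θ => (g2 θ).deriv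
  have i2 : iteratedDeriv 2 G = fun θ => (K₂ θ + K₁ θ ^ 2) * G θ := by
    rw [iteratedDeriv_succ, iteratedDeriv_one, hd1, hd2]
  have i4 : iteratedDeriv 4 G = fun θ =>
      (K₂ θ + 4 * K₁ θ * K₃ θ + 3 * K₂ θ ^ 2 + 6 * K₁ θ ^ 2 * K₂ θ + K₁ θ ^ 4) * G θ := by
    rw [iteratedDeriv_succ, iteratedDeriv_succ, i2, hd3]
    exact funext fun θ => (g3 θ).deriv
  have z0 : G 0 = 1 := by simp [G, K]
  have z1 : K₁ 0 = 0 := by simp [K₁]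
  have z2 : K₂ 0 = s := by simp [K₂, hab]
  constructor
  · have := iteratedDeriv_mgf_zero h0 2
    rw [hmgf, i2] at this
    simp only [z0, z1, z2] at this
    simpa using this.symm
  · have := iteratedDeriv_mgf_zero h0 4
    rw [hmgf, i4] at this
    simp only [z0, z1, z2] at this
    rw [show (3 * (s : ℝ) ^ 2 + s) = (unitRateLaw w s)[dev w s ^ 4] by rw [← this]; ring]
    rfl

/-- The displacement in units of the standard deviation. -/
noncomputable def stdDev (w : WalkKind) (s : ℝ≥0) (x : ℤ) : ℝ := dev w s x / √s

lemma integrable_pow_stdDev (w : WalkKind) (s : ℝ≥0) (j : ℕ) :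
    Integrable (fun x => stdDev w s x ^ j) (unitRateLaw w s) := by
  simp_rw [stdDev, div_pow]
  exact (integrable_pow_dev w s j).div_const _

lemma moments_stdDev (w : WalkKind) {s : ℝ≥0} (hs : 0 < s) :
    ∫ x, stdDev w s x ^ 2 ∂(unitRateLaw w s) = 1 ∧
    ∫ x, stdDev w s x ^ 4 ∂(unitRateLaw w s) = 3 + 1 / s := by
  have hs' : (0 : ℝ) < s := hs
  simp_rw [stdDev, div_pow, integral_div, moments_dev]
  rw [show √(s : ℝ) ^ 4 = (√(s : ℝ) ^ 2) ^ 2 by ring, Real.sq_sqrt hs'.le]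
  constructor <;> field_simp

lemma exp_sub_one_sub_le {θ : ℝ} (h : |θ| ≤ 1) : Real.exp θ - 1 - θ ≤ θ ^ 2 :=
  (le_abs_self _).trans (Real.abs_exp_sub_one_sub_id_le h)

/-- Uniformly in `s ≥ 1`, the standardised displacement has an exponential moment. -/
lemma integrable_exp_abs_stdDev (w : WalkKind) {s : ℝ≥0} (hs : 1 ≤ s) :
    Integrable (fun x => Real.exp |stdDev w s x|) (unitRateLaw w s) ∧
    ∫ x, Real.exp |stdDev w s x| ∂(unitRateLaw w s) ≤ 2 * Real.exp 1 := by
  have hs' : (1 : ℝ) ≤ s := hs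
  have hsq : 1 ≤ √(s : ℝ) := Real.one_le_sqrt.2 hs'
  set c : ℝ := (√(s : ℝ))⁻¹ with hc
  have hc0 : 0 < c := by positivity
  have hc1 : |c| ≤ 1 := by rw [abs_of_pos hc0]; exact inv_le_one_of_one_le₀ hsq
  have hcs : (s : ℝ) * c ^ 2 = 1 := by
    rw [hc, inv_pow, Real.sq_sqrt (by linarith), mul_inv_cancel₀ (by linarith)]
  have hud := up_add_down w
  have hu : (0 : ℝ) ≤ w.up := NNReal.coe_nonneg _
  have hd : (0 : ℝ) ≤ w.down := NNReal.coe_nonneg _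
  have hb : ∀ θ : ℝ, |θ| ≤ 1 → (s : ℝ) * θ ^ 2 = 1 →
      ∫ x, Real.exp (θ * dev w s x) ∂(unitRateLaw w s) ≤ Real.exp 1 := by
    intro θ h1 h2
    rw [(integrable_exp_dev w s θ).2, Real.exp_le_exp]
    have e1 := exp_sub_one_sub_le h1
    have e2 := exp_sub_one_sub_le (θ := -θ) (by rwa [abs_neg])
    rw [sub_neg_eq_add, neg_sq] at e2
    calc (s : ℝ) * (w.up * (Real.exp θ - 1 - θ) + w.down * (Real.exp (-θ) - 1 + θ))
        ≤ s * (w.up * θ ^ 2 + w.down * θ ^ 2) := by gcongr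
      _ = 1 := by rw [← add_mul, hud, one_mul, h2]
  have hi := (integrable_exp_dev w s c).1.add (integrable_exp_dev w s (-c)).1
  have hle : ∀ x, Real.exp |stdDev w s x| ≤
      Real.exp (c * dev w s x) + Real.exp (-c * dev w s x) := by
    intro x
    rw [stdDev, div_eq_inv_mul, ← hc]
    rcases abs_cases (c * dev w s x) with ⟨h, -⟩ | ⟨h, -⟩ <;> rw [h]
    · linarith [Real.exp_pos (-c * dev w s x)]
    · rw [← neg_mul]; linarith [Real.exp_pos (c * dev w s x)]
  have hi' : Integrable (fun x => Real.exp |stdDev w s x|) (unitRateLaw w s) :=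
    hi.mono' (by fun_prop) (ae_of_all _ fun x => by
      rw [Real.norm_of_nonneg (Real.exp_pos _).le]; exact hle x)
  refine ⟨hi', (integral_mono hi' hi hle).trans ?_⟩
  simp only [Pi.add_apply]
  rw [integral_add (integrable_exp_dev w s c).1 (integrable_exp_dev w s (-c)).1]
  have := hb c hc1 hcs
  have := hb (-c) (by rwa [abs_neg]) (by rwa [neg_sq])
  linarith

/-- Uniformly in `s ≥ 1`, the absolute moments of the standardised displacement are bounded. -/
lemma integral_abs_stdDev_pow_le (w : WalkKind) {s : ℝ≥0} (hs : 1 ≤ s) (j : ℕ) :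
    ∫ x, |stdDev w s x| ^ j ∂(unitRateLaw w s) ≤ j.factorial * (2 * Real.exp 1) := by
  obtain ⟨hi, hle⟩ := integrable_exp_abs_stdDev w hs
  calc _ ≤ ∫ x, j.factorial * Real.exp |stdDev w s x| ∂(unitRateLaw w s) := by
        refine integral_mono ?_ (hi.const_mul _) fun x => ?_
        · simpa [abs_pow] using (integrable_pow_stdDev w s j).abs
        · have := Real.pow_div_factorial_le_exp (x := |stdDev w s x|) (abs_nonneg _) j
          rwa [div_le_iff₀' (by positivity)] at this
    _ ≤ _ := by rw [integral_const_mul]; gcongr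

/-! ### The local limit theorem -/

lemma integral_exp_int_mul_I (m : ℤ) :
    ∫ θ in (-Real.pi)..Real.pi, Complex.exp (θ * (m : ℝ) * Complex.I) =
      if m = 0 then (2 * Real.pi : ℂ) else 0 := by
  split_ifs with h
  · simp [h]; ring
  · have hc : ((m : ℝ) * Complex.I : ℂ) ≠ 0 := by simp [h]
    have h1 : ∀ θ : ℝ, (θ * (m : ℝ) * Complex.I : ℂ) = ((m : ℝ) * Complex.I) * θ := fun θ => by ring
    simp_rw [h1]
    rw [integral_exp_mul_complex hc, div_eq_zero_iff]
    left
    have h2 : ((m : ℝ) * Complex.I) * (Real.pi : ℂ) =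
        ((m : ℝ) * Complex.I) * ((-Real.pi : ℝ) : ℂ) + m * (2 * Real.pi * Complex.I) := by
      push_cast; ring
    rw [h2, Complex.exp_periodic.int_mul m, sub_self]

/-- Fourier inversion for probability measures on `ℤ`. -/
lemma real_singleton_eq_integral_charFun (μ : Measure ℤ) [IsProbabilityMeasure μ] (x : ℤ) :
    (μ.real {x} : ℂ) = (2 * Real.pi)⁻¹ * ∫ θ in (-Real.pi)..Real.pi,
      charFun (μ.map (Int.cast : ℤ → ℝ)) θ * Complex.exp (-(θ * (x : ℝ) * Complex.I)) := by
  have hpi : -Real.pi ≤ Real.pi := by linarith [Real.pi_pos]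
  have h1 : ∀ θ : ℝ, charFun (μ.map (Int.cast : ℤ → ℝ)) θ *
      Complex.exp (-(θ * (x : ℝ) * Complex.I)) =
      ∫ y : ℤ, Complex.exp (θ * ((y - x : ℤ) : ℝ) * Complex.I) ∂μ := by
    intro θ
    rw [charFun_apply_real, integral_map (by fun_prop) (by fun_prop), ← integral_mul_const]
    congr with y
    rw [← Complex.exp_add]
    push_cast
    ring_nf
  simp_rw [h1]
  rw [intervalIntegral.integral_of_le hpi, integral_integral_swap]
  · simp_rw [← intervalIntegral.integral_of_le hpi, integral_exp_int_mul_I]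
    have h2 : ∀ y : ℤ, (if y - x = 0 then (2 * Real.pi : ℂ) else 0) =
        ({x} : Set ℤ).indicator (fun _ => (2 * Real.pi : ℂ)) y := by
      intro y
      by_cases h : y = x <;> simp [h, sub_eq_zero]
    simp_rw [h2]
    rw [integral_indicator (by simp), integral_const]
    simp only [measureReal_restrict_apply, Set.univ_inter,
      Complex.real_smul, MeasurableSet.univ]
    have : (Real.pi : ℂ) ≠ 0 := by simp [Real.pi_ne_zero]
    push_cast
    field_simp
  · refine Integrable.of_bound ?_ 1 (ae_of_all _ fun p => ?_)
    · have : Measurable fun p : ℝ × ℤ =>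
          Complex.exp (p.1 * ((p.2 - x : ℤ) : ℝ) * Complex.I) := by
        fun_prop
      exact this.aestronglyMeasurable
    · simp only [Function.uncurry]
      rw [← Complex.ofReal_mul, Complex.norm_exp_ofReal_mul_I]

lemma pmf_eq_integral (w : WalkKind) (s : ℝ≥0) (x : ℤ) :
    (pmf w s x : ℂ) = (2 * Real.pi)⁻¹ * ∫ θ in (-Real.pi)..Real.pi,
      Complex.exp (s * (w.up * Complex.exp (θ * Complex.I) +
        w.down * Complex.exp (-(θ * Complex.I)) - 1)) *
          Complex.exp (-(θ * (x : ℝ) * Complex.I)) := by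
  rw [pmf, real_singleton_eq_integral_charFun]
  simp_rw [charFun_unitRateLaw]

lemma continuous_pmf (w : WalkKind) (x : ℤ) : Continuous fun s => pmf w s x := by
  have h : (fun s => pmf w s x) = fun s : ℝ≥0 => (((2 * Real.pi : ℝ)⁻¹ : ℝ) *
      ∫ θ in (-Real.pi)..Real.pi, Complex.exp (s * (w.up * Complex.exp (θ * Complex.I) +
        w.down * Complex.exp (-(θ * Complex.I)) - 1)) *
          Complex.exp (-(θ * (x : ℝ) * Complex.I))).re := by
    ext s
    rw [← pmf_eq_integral, Complex.ofReal_re]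
  rw [h]
  refine Complex.continuous_re.comp (continuous_const.mul ?_)
  apply intervalIntegral.continuous_parametric_intervalIntegral_of_continuous'
  rw [Function.uncurry_def]
  fun_prop

/-- The exponent of the characteristic function of the centred walk. -/
noncomputable def cumulant (w : WalkKind) (θ : ℝ) : ℂ :=
  w.up * (Complex.exp (θ * Complex.I) - 1 - θ * Complex.I) +
    w.down * (Complex.exp (-(θ * Complex.I)) - 1 + θ * Complex.I)

@[fun_prop]
lemma continuous_cumulant (w : WalkKind) : Continuous (cumulant w) := by
  unfold cumulant; fun_prop

lemma re_cumulant (w : WalkKind) (θ : ℝ) : (cumulant w θ).re = Real.cos θ - 1 := by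
  have h2 : -((θ : ℂ) * Complex.I) = ((-θ : ℝ) : ℂ) * Complex.I := by push_cast; ring
  have h3 := Complex.exp_ofReal_mul_I_re θ
  have h4 := Complex.exp_ofReal_mul_I_re (-θ)
  rw [← h2, Real.cos_neg] at h4
  simp only [cumulant, Complex.add_re, Complex.re_ofReal_mul, Complex.sub_re, h3, h4, Complex.one_re,
    Complex.I_re]
  linear_combination (Real.cos θ - 1) * up_add_down w

lemma norm_cumulant_add_le (w : WalkKind) {θ : ℝ} (h : |θ| ≤ 1) :
    ‖cumulant w θ + θ ^ 2 / 2‖ ≤ |θ| ^ 3 := by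
  have key : ∀ z : ℂ, ‖z‖ ≤ 1 → ‖Complex.exp z - 1 - z - z ^ 2 / 2‖ ≤ ‖z‖ ^ 3 := by
    intro z hz
    have := Complex.exp_bound hz (n := 3) (by norm_num)
    simp only [Finset.sum_range_succ, Finset.sum_range_zero] at this
    norm_num [Nat.factorial] at this
    rw [show Complex.exp z - 1 - z - z ^ 2 / 2 = Complex.exp z - (1 + z + z ^ 2 / 2) by ring]
    refine this.trans ?_
    nlinarith [pow_nonneg (norm_nonneg z) 3]
  have hn : ‖(θ : ℂ) * Complex.I‖ = |θ| := by simp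
  have h1 := key (θ * Complex.I) (hn.trans_le h)
  have h2 := key (-(θ * Complex.I)) (by rw [norm_neg]; exact hn.trans_le h)
  rw [norm_neg] at h2
  rw [hn] at h1 h2
  have hc : (w.up : ℂ) + w.down = 1 := by exact_mod_cast congrArg (Complex.ofReal) (up_add_down w)
  have e : cumulant w θ + θ ^ 2 / 2 =
      w.up * (Complex.exp (θ * Complex.I) - 1 - θ * Complex.I - (θ * Complex.I) ^ 2 / 2) +
      w.down * (Complex.exp (-(θ * Complex.I)) - 1 - -(θ * Complex.I) -
        (-(θ * Complex.I)) ^ 2 / 2) := by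
    rw [cumulant]
    simp only [neg_sq, mul_pow, Complex.I_sq]
    linear_combination (-(θ : ℂ) ^ 2 / 2) * hc
  have hu : ‖(w.up : ℂ)‖ = w.up := by simp
  have hd : ‖(w.down : ℂ)‖ = w.down := by simp
  rw [e]
  refine (norm_add_le _ _).trans ?_
  rw [norm_mul, norm_mul, hu, hd]
  calc _ ≤ (w.up : ℝ) * |θ| ^ 3 + w.down * |θ| ^ 3 := by gcongr
    _ = |θ| ^ 3 := by rw [← add_mul, up_add_down, one_mul]

/-- The characteristic function of the standardised walk, cut off to the frequencies of one
period. -/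
noncomputable def stdCharFun (w : WalkKind) (s : ℝ≥0) : ℝ → ℂ :=
  (Set.Ioc (-(Real.pi * √s)) (Real.pi * √s)).indicator
    fun θ => Complex.exp (s * cumulant w (θ / √s))

/-- Fourier inversion at the scale of the standard deviation. -/
lemma sqrt_mul_pmf (w : WalkKind) {s : ℝ≥0} (hs : 0 < s) (x : ℤ) :
    ((√s * pmf w s x : ℝ) : ℂ) = (2 * Real.pi)⁻¹ *
      ∫ θ, stdCharFun w s θ * Complex.exp (-(θ * stdDev w s x * Complex.I)) := by
  have hs' : (0 : ℝ) < √s := Real.sqrt_pos.2 hs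
  have hss : (s : ℂ) = (√s : ℝ) * (√s : ℝ) := by
    rw [← Complex.ofReal_mul, Real.mul_self_sqrt s.coe_nonneg]
  have hle : -(Real.pi * √s) ≤ Real.pi * √s := by nlinarith [Real.pi_pos]
  have hud : (w.up : ℂ) + w.down = 1 := by exact_mod_cast congrArg (Complex.ofReal) (up_add_down w)
  have h1 : ∀ θ : ℝ, stdCharFun w s θ * Complex.exp (-(θ * stdDev w s x * Complex.I)) =
      (Set.Ioc (-(Real.pi * √s)) (Real.pi * √s)).indicator
        (fun θ : ℝ => (fun θ : ℝ => Complex.exp (s * (w.up * Complex.exp (θ * Complex.I) +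
        w.down * Complex.exp (-(θ * Complex.I)) - 1)) *
          Complex.exp (-(θ * (x : ℝ) * Complex.I))) (θ / √s)) θ := by
    intro θ
    by_cases h : θ ∈ Set.Ioc (-(Real.pi * √s)) (Real.pi * √s)
    · rw [stdCharFun, Set.indicator_of_mem h, Set.indicator_of_mem h, ← Complex.exp_add]
      beta_reduce
      rw [← Complex.exp_add]
      congr 1
      rw [cumulant, stdDev, dev, WalkKind.drift]
      have : (√s : ℂ) ≠ 0 := by exact_mod_cast hs'.ne'
      generalize Complex.exp (((θ / √s : ℝ) : ℂ) * Complex.I) = A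
      generalize Complex.exp (-(((θ / √s : ℝ) : ℂ) * Complex.I)) = B
      push_cast
      rw [hss]
      field_simp
      linear_combination (-(√(s : ℝ) : ℂ) ^ 3) * hud
    · rw [stdCharFun, Set.indicator_of_notMem h, Set.indicator_of_notMem h, zero_mul]
  simp_rw [h1]
  rw [integral_indicator measurableSet_Ioc, ← intervalIntegral.integral_of_le hle,
    intervalIntegral.integral_comp_div (fun θ : ℝ => Complex.exp (s * (w.up *
        Complex.exp (θ * Complex.I) + w.down * Complex.exp (-(θ * Complex.I)) - 1)) *
          Complex.exp (-(θ * (x : ℝ) * Complex.I))) hs'.ne', Complex.ofReal_mul, pmf_eq_integral,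
    neg_div, mul_div_cancel_right₀ _ hs'.ne', Complex.real_smul]
  ring

/-- A bound by an integrable function that does not depend on the time, from
`cos θ ≤ 1 - 2 θ² / π²` for `|θ| ≤ π`. -/
lemma norm_stdCharFun_le (w : WalkKind) (s : ℝ≥0) (θ : ℝ) :
    ‖stdCharFun w s θ‖ ≤ Real.exp (-(2 / Real.pi ^ 2) * θ ^ 2) := by
  by_cases h : θ ∈ Set.Ioc (-(Real.pi * √s)) (Real.pi * √s)
  · have hs' : (0 : ℝ) < √s := by
      by_contra h0
      have : √(s : ℝ) = 0 := le_antisymm (not_lt.1 h0) (Real.sqrt_nonneg _)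
      rw [this] at h; simp at h
    rw [stdCharFun, Set.indicator_of_mem h, Complex.norm_exp, Real.exp_le_exp]
    have h2 : |θ / √s| ≤ Real.pi := by
      rw [abs_div, abs_of_pos hs', div_le_iff₀ hs', abs_le]
      exact ⟨h.1.le, h.2⟩
    have h3 := Real.cos_le_one_sub_mul_cos_sq h2
    rw [show ((s : ℂ) * cumulant w (θ / √s)) = ((s : ℝ) : ℂ) * cumulant w (θ / √s) from rfl,
      Complex.re_ofReal_mul, re_cumulant]
    have h4 : (s : ℝ) * (θ / √s) ^ 2 = θ ^ 2 := by
      rw [div_pow, Real.sq_sqrt s.coe_nonneg, mul_div_cancel₀]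
      exact (Real.sqrt_pos.1 hs').ne'
    calc (s : ℝ) * (Real.cos (θ / √s) - 1) ≤ s * (-(2 / Real.pi ^ 2 * (θ / √s) ^ 2)) := by
          gcongr; linarith
      _ = -(2 / Real.pi ^ 2) * ((s : ℝ) * (θ / √s) ^ 2) := by ring
      _ = _ := by rw [h4]
  · rw [stdCharFun, Set.indicator_of_notMem h, norm_zero]
    exact (Real.exp_pos _).le

lemma tendsto_stdCharFun (w : WalkKind) (θ : ℝ) :
    Tendsto (fun s => stdCharFun w s θ) atTop (𝓝 (Complex.exp (-(1 / 2) * θ ^ 2))) := by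
  have hsq : Tendsto (fun s : ℝ≥0 => √(s : ℝ)) atTop atTop :=
    Real.tendsto_sqrt_atTop.comp (NNReal.tendsto_coe_atTop.2 tendsto_id)
  have h1 : Tendsto (fun s : ℝ≥0 => (s : ℂ) * cumulant w (θ / √s)) atTop
      (𝓝 (-(1 / 2) * θ ^ 2)) := by
    rw [tendsto_iff_norm_sub_tendsto_zero]
    have hb : Tendsto (fun s : ℝ≥0 => |θ| ^ 3 / √s) atTop (𝓝 0) :=
      tendsto_const_nhds.div_atTop hsq
    refine squeeze_zero' (Eventually.of_forall fun _ => norm_nonneg _) ?_ hb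
    filter_upwards [hsq.eventually_ge_atTop (max 1 |θ|)] with s hs
    have hs1 : 1 ≤ √(s : ℝ) := (le_max_left _ _).trans hs
    have hs0 : 0 < √(s : ℝ) := by linarith
    have hsθ : |θ| ≤ √(s : ℝ) := (le_max_right _ _).trans hs
    have hle : |θ / √s| ≤ 1 := by
      rw [abs_div, abs_of_pos hs0, div_le_one hs0]; exact hsθ
    have hss : (s : ℝ) = √s * √s := (Real.mul_self_sqrt s.coe_nonneg).symm
    have hcc : (s : ℂ) = (√s : ℝ) * (√s : ℝ) := by
      rw [← Complex.ofReal_mul, Real.mul_self_sqrt s.coe_nonneg]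
    have hne : (√s : ℂ) ≠ 0 := by exact_mod_cast hs0.ne'
    have e : (s : ℂ) * cumulant w (θ / √s) - -(1 / 2) * θ ^ 2 =
        s * (cumulant w (θ / √s) + ((θ / √s : ℝ) : ℂ) ^ 2 / 2) := by
      rw [hcc]
      push_cast
      field_simp
      ring
    rw [e, norm_mul]
    calc ‖(s : ℂ)‖ * _ ≤ (s : ℝ) * |θ / √s| ^ 3 := by
          gcongr
          · simp
          · exact norm_cumulant_add_le w hle
      _ = |θ| ^ 3 / √s := by
          rw [abs_div, abs_of_pos hs0]
          generalize √(s : ℝ) = r at hss hs0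
          rw [hss]
          field_simp
  refine (((Complex.continuous_exp.tendsto _).comp h1)).congr' ?_
  filter_upwards [hsq.eventually_gt_atTop (|θ|)] with s hs
  have hmem : θ ∈ Set.Ioc (-(Real.pi * √s)) (Real.pi * √s) := by
    have hp := Real.pi_gt_three
    have : √(s : ℝ) ≤ Real.pi * √s := by nlinarith [Real.sqrt_nonneg (s : ℝ)]
    exact ⟨by linarith [neg_abs_le θ], by linarith [le_abs_self θ]⟩
  rw [stdCharFun, Set.indicator_of_mem hmem]
  rfl

lemma integral_gaussian_mul_exp (X : ℝ) :
    (((√(2 * Real.pi))⁻¹ * Real.exp (-X ^ 2 / 2) : ℝ) : ℂ) = (2 * Real.pi)⁻¹ *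
      ∫ θ : ℝ, Complex.exp (-(1 / 2) * θ ^ 2) * Complex.exp (-(θ * X * Complex.I)) := by
  have h := fourierIntegral_gaussian (b := 1 / 2) (by norm_num) (-X : ℂ)
  have h2 : ∀ θ : ℝ, Complex.exp (-(1 / 2) * θ ^ 2) * Complex.exp (-(θ * X * Complex.I)) =
      Complex.exp (Complex.I * (-X) * θ) * Complex.exp (-(1 / 2) * θ ^ 2) := fun θ => by
    rw [mul_comm]; ring_nf
  simp_rw [h2]
  rw [h]
  have h3 : ((Real.pi : ℂ) / (1 / 2)) ^ (1 / 2 : ℂ) = (√(2 * Real.pi) : ℝ) := by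
    rw [Real.sqrt_eq_rpow, Complex.ofReal_cpow (by positivity)]
    push_cast
    congr 1
    ring
  have h4 : ((2 * Real.pi : ℝ) : ℂ) = (√(2 * Real.pi) : ℝ) * (√(2 * Real.pi) : ℝ) := by
    rw [← Complex.ofReal_mul, Real.mul_self_sqrt (by positivity)]
  have h5 : ((√(2 * Real.pi) : ℝ) : ℂ) ≠ 0 := by
    exact_mod_cast (Real.sqrt_pos.2 (by positivity : (0 : ℝ) < 2 * Real.pi)).ne'
  rw [h3, Complex.ofReal_inv, h4]
  generalize ((√(2 * Real.pi) : ℝ)) = r at h5 ⊢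
  push_cast
  rw [mul_inv, mul_assoc, inv_mul_cancel_left₀ h5]
  ring_nf

/-- The local central limit theorem, uniformly over the sites. -/
theorem exists_local_limit (w : WalkKind) : ∃ δ : ℝ≥0 → ℝ, Tendsto δ atTop (𝓝 0) ∧
    ∀ s : ℝ≥0, 0 < s → ∀ x, |√s * pmf w s x -
      (√(2 * Real.pi))⁻¹ * Real.exp (-stdDev w s x ^ 2 / 2)| ≤ δ s := by
  set g : ℝ → ℂ := fun θ => Complex.exp (-(1 / 2) * θ ^ 2) with hg
  have hgi : Integrable g := by
    have := integrable_cexp_neg_mul_sq (b := 1 / 2) (by norm_num)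
    simpa [hg] using this
  have hm : ∀ s, AEStronglyMeasurable (stdCharFun w s) := fun s => by
    unfold stdCharFun
    exact Continuous.aestronglyMeasurable (by fun_prop) |>.indicator measurableSet_Ioc
  have hbi : Integrable fun θ : ℝ => Real.exp (-(2 / Real.pi ^ 2) * θ ^ 2) :=
    integrable_exp_neg_mul_sq (by positivity)
  have hsi : ∀ s, Integrable (stdCharFun w s) := fun s =>
    hbi.mono' (hm s) (ae_of_all _ (norm_stdCharFun_le w s))
  -- By Fourier inversion, the distance of the characteristic functions in `L¹` bounds the error.
  refine ⟨fun s => (2 * Real.pi)⁻¹ * ∫ θ, ‖stdCharFun w s θ - g θ‖, ?_, ?_⟩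
  · have : Tendsto (fun s => ∫ θ, ‖stdCharFun w s θ - g θ‖) atTop (𝓝 (∫ _ : ℝ, (0 : ℝ))) := by
      refine tendsto_integral_filter_of_dominated_convergence
        (fun θ => Real.exp (-(2 / Real.pi ^ 2) * θ ^ 2) + ‖g θ‖)
        (Eventually.of_forall fun s => ((hm s).sub hgi.aestronglyMeasurable).norm)
        (Eventually.of_forall fun s => ae_of_all _ fun θ => ?_) (hbi.add hgi.norm)
        (ae_of_all _ fun θ => ?_)
      · rw [norm_norm]
        exact (norm_sub_le _ _).trans (by gcongr; exact norm_stdCharFun_le w s θ)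
      · have := ((tendsto_stdCharFun w θ).sub_const (g θ)).norm
        simpa [hg] using this
    simpa using this.const_mul (2 * Real.pi)⁻¹
  · intro s hs x
    have hE : ∀ X : ℝ, ∀ f : ℝ → ℂ, Integrable f →
        Integrable fun θ : ℝ => f θ * Complex.exp (-(θ * X * Complex.I)) := by
      intro X f hf
      refine hf.mul_bdd (c := 1) (by fun_prop) (ae_of_all _ fun θ => ?_)
      rw [← Complex.ofReal_mul, ← neg_mul, ← Complex.ofReal_neg, Complex.norm_exp_ofReal_mul_I]
    have h1 := sqrt_mul_pmf w hs x
    have h2 := integral_gaussian_mul_exp (stdDev w s x)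
    have h3 : (((√s * pmf w s x - (√(2 * Real.pi))⁻¹ * Real.exp (-stdDev w s x ^ 2 / 2) : ℝ)) : ℂ)
        = (2 * Real.pi)⁻¹ * ∫ θ : ℝ, (stdCharFun w s θ - g θ) *
          Complex.exp (-(θ * stdDev w s x * Complex.I)) := by
      rw [Complex.ofReal_sub, h1, h2, ← mul_sub, ← integral_sub (hE _ _ (hsi s)) (hE _ _ hgi)]
      simp_rw [sub_mul]
    rw [← Real.norm_eq_abs, ← Complex.norm_real, h3, norm_mul]
    rw [Complex.norm_real, Real.norm_of_nonneg (by positivity)]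
    refine mul_le_mul_of_nonneg_left ?_ (by positivity)
    refine (norm_integral_le_integral_norm _).trans (le_of_eq ?_)
    congr with θ
    rw [norm_mul, ← Complex.ofReal_mul, ← neg_mul, ← Complex.ofReal_neg,
      Complex.norm_exp_ofReal_mul_I, mul_one]

/-! ### Entropy, varentropy and moments of the information content -/

/-- The sites that the walk can reach at positive times. -/
def WalkKind.Reaches (w : WalkKind) (x : ℤ) : Prop := w = .undirected ∨ 0 ≤ x

/-- The information content `-log p_s(x)` of a site under the unit-rate law at time `s`.
It has the junk value `0` at the sites that carry no mass. -/
noncomputable def unitQ (w : WalkKind) (s : ℝ≥0) (x : ℤ) : ℝ := -Real.log (pmf w s x)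

/-- The entropy of the unit-rate law at time `s`. -/
noncomputable def entropy (w : WalkKind) (s : ℝ≥0) : ℝ := ∫ x, unitQ w s x ∂(unitRateLaw w s)

/-- The varentropy: the variance of the information content. -/
noncomputable def varentropy (w : WalkKind) (s : ℝ≥0) : ℝ :=
  variance (unitQ w s) (unitRateLaw w s)

/-- The absolute third central moment of the information content. -/
noncomputable def thirdMoment (w : WalkKind) (s : ℝ≥0) : ℝ :=
  ∫ x, |unitQ w s x - entropy w s| ^ 3 ∂(unitRateLaw w s)

lemma unitQ_nonneg (w : WalkKind) (s : ℝ≥0) (x : ℤ) : 0 ≤ unitQ w s x :=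
  neg_nonneg.2 (Real.log_nonpos (pmf_nonneg w s x) (pmf_le_one w s x))

lemma unitRateLaw_zero (w : WalkKind) : unitRateLaw w 0 = Measure.dirac 0 := by
  rw [unitRateLaw_eq_conv]
  simp [poissonMeasure_zero, Measure.map_dirac]

@[simp]
lemma unitQ_zero (w : WalkKind) (x : ℤ) : unitQ w 0 x = 0 := by
  rw [unitQ, pmf, unitRateLaw_zero, measureReal_def, Measure.dirac_apply]
  by_cases h : (0 : ℤ) ∈ ({x} : Set ℤ) <;> simp [h]

@[simp]
lemma entropy_zero (w : WalkKind) : entropy w 0 = 0 := by simp [entropy]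

lemma ae_reaches (w : WalkKind) (s : ℝ≥0) : ∀ᵐ x ∂(unitRateLaw w s), w.Reaches x := by
  rw [ae_iff_of_countable]
  intro x hx
  by_contra h
  have := pmf_eq_zero (s := s) h
  rw [pmf, measureReal_eq_zero_iff] at this
  exact hx this

lemma one_add_sq_le_exp (x : ℝ) : 1 + x ^ 2 ≤ Real.exp (2 * |x|) := by
  have h := Real.add_one_le_exp |x|
  have h0 := abs_nonneg x
  rw [two_mul, Real.exp_add, ← sq_abs x]
  nlinarith

lemma integrable_one_add_sq_pow (w : WalkKind) (s : ℝ≥0) (j : ℕ) :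
    Integrable (fun x : ℤ => (1 + (x : ℝ) ^ 2) ^ j) (unitRateLaw w s) := by
  refine (integrable_exp_abs_unitRateLaw w s (c := j * 2) (by positivity)).1.mono'
    (by fun_prop) (ae_of_all _ fun x => ?_)
  rw [Real.norm_of_nonneg (by positivity), mul_assoc, Real.exp_nat_mul]
  gcongr
  exact one_add_sq_le_exp x

lemma log_factorial_le_sq (n : ℕ) : Real.log n.factorial ≤ (n : ℝ) ^ 2 := by
  rcases n.eq_zero_or_pos with rfl | hn
  · simp
  have h1 : (n.factorial : ℝ) ≤ (n : ℝ) ^ n := by exact_mod_cast Nat.factorial_le_pow n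
  have h2 : Real.log n ≤ n := (Real.log_le_sub_one_of_pos (by positivity)).trans (by linarith)
  calc Real.log n.factorial ≤ Real.log ((n : ℝ) ^ n) := Real.log_le_log (by positivity) h1
    _ = n * Real.log n := Real.log_pow _ _
    _ ≤ (n : ℝ) ^ 2 := by rw [sq]; gcongr

/-- The constant in the quadratic upper bound for the information content, for times in
`[a, b]`. -/
noncomputable def quadConst (a b : ℝ) : ℝ := b + |Real.log (2 / a)| + 1

lemma unitQ_le (w : WalkKind) {s : ℝ≥0} (hs : 0 < s) {x : ℤ} (hx : w.Reaches x) :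
    unitQ w s x ≤ s + |(x : ℝ)| * Real.log (2 / s) + (x : ℝ) ^ 2 := by
  have hs' : (0 : ℝ) < s := hs
  have h := Real.log_le_log (by positivity) (le_pmf w s hx)
  rw [Real.log_div (by positivity) (by positivity), Real.log_mul (by positivity) (by positivity),
    Real.log_exp, Real.log_pow] at h
  have h1 := log_factorial_le_sq x.natAbs
  have h2 : ((x.natAbs : ℕ) : ℝ) = |(x : ℝ)| := by rw [Nat.cast_natAbs, Int.cast_abs]
  rw [h2] at h h1
  rw [sq_abs] at h1
  have h3 : Real.log (2 / s) = -Real.log (s / 2) := by rw [← Real.log_inv, inv_div]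
  rw [unitQ, h3]
  linarith

lemma unitQ_le_quadConst (w : WalkKind) {a b : ℝ} (ha : 0 < a) {s : ℝ≥0} (has : a ≤ s)
    (hsb : s ≤ b) {x : ℤ} (hx : w.Reaches x) :
    unitQ w s x ≤ quadConst a b * (1 + (x : ℝ) ^ 2) := by
  have hs : (0 : ℝ) < s := ha.trans_le has
  have h := unitQ_le w (s := s) hs hx
  have h1 : Real.log (2 / s) ≤ |Real.log (2 / a)| :=
    (Real.log_le_log (by positivity) (by gcongr)).trans (le_abs_self _)
  have h2 : |(x : ℝ)| ≤ 1 + (x : ℝ) ^ 2 := by rw [← sq_abs]; nlinarith [sq_nonneg (|(x : ℝ)| - 1)]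
  have h3 : |(x : ℝ)| * Real.log (2 / s) ≤ (1 + (x : ℝ) ^ 2) * |Real.log (2 / a)| := by
    refine (mul_le_mul_of_nonneg_left h1 (abs_nonneg _)).trans ?_
    gcongr
  rw [quadConst]
  nlinarith [sq_nonneg (x : ℝ)]

lemma integrable_unitQ_pow (w : WalkKind) (s : ℝ≥0) (j : ℕ) :
    Integrable (fun x => unitQ w s x ^ j) (unitRateLaw w s) := by
  rcases eq_or_ne s 0 with rfl | hs
  · simp
  have hs' : (0 : ℝ) < s := NNReal.coe_pos.2 (pos_iff_ne_zero.2 hs)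
  refine ((integrable_one_add_sq_pow w s j).const_mul (quadConst s s ^ j)).mono'
    (by fun_prop) ?_
  filter_upwards [ae_reaches w s] with x hx
  rw [Real.norm_of_nonneg (pow_nonneg (unitQ_nonneg _ _ _) _), ← mul_pow]
  exact pow_le_pow_left₀ (unitQ_nonneg _ _ _) (unitQ_le_quadConst w hs' le_rfl le_rfl hx) j

lemma integrable_unitQ (w : WalkKind) (s : ℝ≥0) : Integrable (unitQ w s) (unitRateLaw w s) := by
  simpa using integrable_unitQ_pow w s 1

lemma memLp_two_unitQ (w : WalkKind) (s : ℝ≥0) : MemLp (unitQ w s) 2 (unitRateLaw w s) :=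
  (memLp_two_iff_integrable_sq (by fun_prop)).2 (integrable_unitQ_pow w s 2)

lemma entropy_nonneg (w : WalkKind) (s : ℝ≥0) : 0 ≤ entropy w s :=
  integral_nonneg (unitQ_nonneg w s)

lemma varentropy_nonneg (w : WalkKind) (s : ℝ≥0) : 0 ≤ varentropy w s := variance_nonneg _ _

lemma thirdMoment_nonneg (w : WalkKind) (s : ℝ≥0) : 0 ≤ thirdMoment w s :=
  integral_nonneg fun _ => by positivity

lemma varentropy_eq (w : WalkKind) (s : ℝ≥0) :
    varentropy w s = ∫ x, unitQ w s x ^ 2 ∂(unitRateLaw w s) - entropy w s ^ 2 :=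
  variance_eq_sub (memLp_two_unitQ w s)

lemma abs_sub_pow_three_le {a b : ℝ} (ha : 0 ≤ a) (hb : 0 ≤ b) : |a - b| ^ 3 ≤ a ^ 3 + b ^ 3 := by
  have h : |a - b| ≤ max a b := by
    rw [abs_le]
    constructor
    · linarith [le_max_right a b]
    · linarith [le_max_left a b]
  have h2 : |a - b| ^ 3 ≤ max a b ^ 3 := pow_le_pow_left₀ (abs_nonneg _) h 3
  rcases max_cases a b with ⟨e, -⟩ | ⟨e, -⟩ <;> rw [e] at h2 <;>
    nlinarith [pow_nonneg ha 3, pow_nonneg hb 3]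

lemma integrable_abs_sub_pow_three (w : WalkKind) (s : ℝ≥0) (c : ℝ) :
    Integrable (fun x => |unitQ w s x - c| ^ 3) (unitRateLaw w s) := by
  have h : Integrable (fun x => (unitQ w s x - c) ^ 3) (unitRateLaw w s) := by
    have : ∀ x, (unitQ w s x - c) ^ 3 =
        unitQ w s x ^ 3 - 3 * c * unitQ w s x ^ 2 + 3 * c ^ 2 * unitQ w s x - c ^ 3 :=
      fun x => by ring
    simp_rw [this]
    exact (((integrable_unitQ_pow w s 3).sub ((integrable_unitQ_pow w s 2).const_mul _)).add
      ((integrable_unitQ w s).const_mul _)).sub (integrable_const _)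
  simpa [abs_pow] using h.abs

/-- If the information content is at least `c` almost surely, its third central moment is bounded
by the moments of its excess over `c`. -/
lemma thirdMoment_le (w : WalkKind) (s : ℝ≥0) (c : ℝ)
    (hc : ∀ᵐ x ∂(unitRateLaw w s), c ≤ unitQ w s x) :
    thirdMoment w s ≤ ∫ x, (unitQ w s x - c) ^ 3 ∂(unitRateLaw w s) + (entropy w s - c) ^ 3 := by
  have hcE : c ≤ entropy w s := by
    have := integral_mono_ae (integrable_const c) (integrable_unitQ w s) hc
    rw [entropy]
    simpa using this
  have hi : Integrable (fun x => (unitQ w s x - c) ^ 3) (unitRateLaw w s) :=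
    (integrable_abs_sub_pow_three w s c).congr (by
      filter_upwards [hc] with x hx
      rw [abs_of_nonneg (sub_nonneg.2 hx)])
  calc thirdMoment w s
      ≤ ∫ x, ((unitQ w s x - c) ^ 3 + (entropy w s - c) ^ 3) ∂(unitRateLaw w s) := by
        refine integral_mono_ae (integrable_abs_sub_pow_three w s _)
          (hi.add (integrable_const _)) ?_
        filter_upwards [hc] with x hx
        have := abs_sub_pow_three_le (sub_nonneg.2 hx) (sub_nonneg.2 hcE)
        rwa [sub_sub_sub_cancel_right] at this
    _ = _ := by rw [integral_add hi (integrable_const _)]; simp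

/-! ### Sharp lower bounds for the point masses -/

lemma log_factorial_le_stirling {m : ℕ} (hm : m ≠ 0) :
    Real.log m.factorial ≤ (m + 1 / 2) * Real.log m - m + 1 := by
  obtain ⟨n, rfl⟩ := Nat.exists_eq_succ_of_ne_zero hm
  have h := Stirling.log_stirlingSeq'_antitone (Nat.zero_le n)
  simp only [Function.comp_apply, Nat.succ_eq_add_one, zero_add] at h
  have h1 := Stirling.log_stirlingSeq_formula (n + 1)
  have hn : (0 : ℝ) < ((n + 1 : ℕ) : ℝ) := by positivity
  rw [Stirling.stirlingSeq_one, h1, Real.log_div (Real.exp_pos 1).ne' (by positivity),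
    Real.log_exp, Real.log_sqrt (by norm_num), Real.log_mul (by norm_num) hn.ne',
    Real.log_div hn.ne' (Real.exp_pos 1).ne', Real.log_exp] at h
  simp only [Nat.succ_eq_add_one]
  linarith

/-- A Gaussian lower bound for the Poisson distribution, valid at every `m`. -/
lemma exp_le_sqrt_mul_poisson {r : ℝ≥0} (hr : 1 ≤ r) (m : ℕ) :
    Real.exp (-(2 + 2 * ((m : ℝ) - r) ^ 2 / r)) ≤ √r * (poissonMeasure r).real {m} := by
  have hr' : (1 : ℝ) ≤ r := hr
  have hr0 : (0 : ℝ) < r := by linarith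
  have hsq : (1 : ℝ) ≤ √(r : ℝ) := Real.one_le_sqrt.2 hr'
  rw [poissonMeasure_real_singleton]
  rcases eq_or_ne m 0 with rfl | hm
  · simp only [Nat.cast_zero, zero_sub, neg_sq, pow_zero, mul_one, Nat.factorial_zero,
      Nat.cast_one, div_one]
    calc Real.exp (-(2 + 2 * (r : ℝ) ^ 2 / r)) ≤ Real.exp (-r) := by
          rw [Real.exp_le_exp, show 2 * (r : ℝ) ^ 2 / r = 2 * r by field_simp]; linarith
      _ ≤ √(r : ℝ) * Real.exp (-r) := le_mul_of_one_le_left (Real.exp_pos _).le hsq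
  have hm0 : (0 : ℝ) < m := by positivity
  rw [← Real.le_log_iff_exp_le (by positivity), Real.log_mul (by positivity) (by positivity),
    Real.log_div (by positivity) (by positivity), Real.log_mul (by positivity) (by positivity),
    Real.log_exp, Real.log_pow, Real.log_sqrt hr0.le]
  have h1 := log_factorial_le_stirling hm
  have h2 : Real.log m - Real.log r ≤ m / r - 1 := by
    rw [← Real.log_div hm0.ne' hr0.ne']
    exact Real.log_le_sub_one_of_pos (by positivity)
  have h3 : ((m : ℝ) + 1 / 2) * (Real.log m - Real.log r) ≤ (m + 1 / 2) * (m / r - 1) := by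
    gcongr
  set y : ℝ := ((m : ℝ) - r) / r with hy
  have hmr : (m : ℝ) = r * y + r := by rw [hy]; field_simp; ring
  have h4 : (m : ℝ) / r - 1 = y := by rw [hy]; field_simp
  have h5 : 2 * ((m : ℝ) - r) ^ 2 / r = 2 * (r * y ^ 2) := by rw [hy]; field_simp
  rw [h4] at h3
  rw [h5]
  have h6 : y ^ 2 ≤ r * y ^ 2 := le_mul_of_one_le_left (sq_nonneg _) hr'
  have h7 : ((m : ℝ) + 1 / 2) * y = r * y ^ 2 + r * y + y / 2 := by rw [hmr]; ring
  have h8 : (m : ℝ) - r = r * y := by rw [hmr]; ring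
  nlinarith [sq_nonneg (y - 1)]

/-- A Gaussian lower bound for the point masses of the walk, valid at every site it can reach. -/
lemma exp_le_sqrt_mul_pmf (w : WalkKind) {s : ℝ≥0} (hs : 2 ≤ s) {x : ℤ} (hx : w.Reaches x) :
    Real.exp (-(58 + 8 * stdDev w s x ^ 2)) ≤ √s * pmf w s x := by
  have hs' : (2 : ℝ) ≤ s := hs
  cases w with
  | directed =>
    obtain ⟨m, rfl⟩ := Int.eq_ofNat_of_zero_le (hx.resolve_left (by simp))
    have h := exp_le_sqrt_mul_poisson (r := s) (le_trans (by norm_num) hs) m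
    have h1 : pmf .directed s m = (poissonMeasure s).real {m} := map_natCast_real_singleton s m
    rw [h1]
    refine le_trans (Real.exp_le_exp.2 ?_) h
    have h2 : stdDev .directed s m ^ 2 = ((m : ℝ) - s) ^ 2 / s := by
      rw [stdDev, dev, div_pow, Real.sq_sqrt s.coe_nonneg]
      simp [WalkKind.drift, WalkKind.up, WalkKind.down]
    rw [h2]
    have : 0 ≤ ((m : ℝ) - s) ^ 2 / s := by positivity
    rw [mul_div_assoc]
    linarith
  | undirected =>
    -- Sum over the `≈ √r` ways to make `m + j` and `j` jumps in the two directions, `j ≈ r`.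
    set r : ℝ≥0 := 2⁻¹ * s with hr
    have hrs : (s : ℝ) = 2 * r := by rw [hr]; push_cast; ring
    have hr1 : (1 : ℝ) ≤ r := by linarith
    have hr0 : (0 : ℝ) < r := by linarith
    have hsr0 : 0 < √(r : ℝ) := Real.sqrt_pos.2 hr0
    have hsr1 : 1 ≤ √(r : ℝ) := Real.one_le_sqrt.2 hr1
    have hsrr : √(r : ℝ) * √(r : ℝ) = r := Real.mul_self_sqrt hr0.le
    set J : Finset ℕ := Finset.Ico ⌈(r : ℝ)⌉₊ (⌈(r : ℝ)⌉₊ + ⌈√(r : ℝ)⌉₊) with hJ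
    have hcard : √(r : ℝ) ≤ (J.card : ℝ) := by
      rw [hJ, Nat.card_Ico, Nat.add_sub_cancel_left]
      exact Nat.le_ceil _
    have hj : ∀ j ∈ J, 0 ≤ (j : ℝ) - r ∧ (j : ℝ) - r ≤ 3 * √(r : ℝ) := by
      intro j hj
      rw [hJ, Finset.mem_Ico] at hj
      have h1 : (⌈(r : ℝ)⌉₊ : ℝ) ≤ j := by exact_mod_cast hj.1
      have h2 : (j : ℝ) < ⌈(r : ℝ)⌉₊ + ⌈√(r : ℝ)⌉₊ := by exact_mod_cast hj.2
      have h3 := Nat.le_ceil (r : ℝ)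
      have h4 := Nat.ceil_lt_add_one hr0.le
      have h5 := Nat.ceil_lt_add_one hsr0.le
      constructor <;> linarith
    -- With `j ≤ r + 3 √r`, the bound of `exp_le_sqrt_mul_poisson` costs at most `2 + 2 * 9` for `j`
    -- and `2 + 2 * 18 + 4 m² / r` for `m + j`, which together make `58 + 4 m² / r`.
    have key : ∀ m : ℕ, Real.exp (-(58 + 4 * (m : ℝ) ^ 2 / r)) ≤ √(s : ℝ) *
        ∑ j ∈ J, (poissonMeasure r).real {m + j} * (poissonMeasure r).real {j} := by
      intro m
      have hterm : ∀ j ∈ J, Real.exp (-(58 + 4 * (m : ℝ) ^ 2 / r)) / r ≤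
          (poissonMeasure r).real {m + j} * (poissonMeasure r).real {j} := by
        intro j hjJ
        obtain ⟨h1, h2⟩ := hj j hjJ
        have e1 := exp_le_sqrt_mul_poisson (r := r) hr1 (m + j)
        have e2 := exp_le_sqrt_mul_poisson (r := r) hr1 j
        have h3 : ((j : ℝ) - r) ^ 2 / r ≤ 9 := by
          rw [div_le_iff₀ hr0]
          nlinarith
        have h4 : (((m + j : ℕ) : ℝ) - r) ^ 2 / r ≤ 2 * ((m : ℝ) ^ 2 / r) + 18 := by
          have : (((m + j : ℕ) : ℝ) - r) ^ 2 ≤ 2 * (m : ℝ) ^ 2 + 2 * ((j : ℝ) - r) ^ 2 := by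
            push_cast
            nlinarith [sq_nonneg ((m : ℝ) - (j - r))]
          calc _ ≤ (2 * (m : ℝ) ^ 2 + 2 * ((j : ℝ) - r) ^ 2) / r := by gcongr
            _ = 2 * ((m : ℝ) ^ 2 / r) + 2 * (((j : ℝ) - r) ^ 2 / r) := by ring
            _ ≤ _ := by linarith
        rw [div_le_iff₀ hr0]
        calc Real.exp (-(58 + 4 * (m : ℝ) ^ 2 / r))
            ≤ Real.exp (-(2 + 2 * (((m + j : ℕ) : ℝ) - r) ^ 2 / r)) *
              Real.exp (-(2 + 2 * ((j : ℝ) - r) ^ 2 / r)) := by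
              rw [← Real.exp_add, Real.exp_le_exp]
              simp only [mul_div_assoc] at h3 h4 ⊢
              linarith
          _ ≤ (√r * (poissonMeasure r).real {m + j}) * (√r * (poissonMeasure r).real {j}) := by
              gcongr
          _ = (√r * √r) * ((poissonMeasure r).real {m + j} * (poissonMeasure r).real {j}) := by
              ring
          _ = _ := by rw [hsrr, mul_comm]
      calc Real.exp (-(58 + 4 * (m : ℝ) ^ 2 / r))
          = √r * (√r * (Real.exp (-(58 + 4 * (m : ℝ) ^ 2 / r)) / r)) := by
            rw [← mul_assoc, hsrr]; field_simp
        _ ≤ √s * (J.card * (Real.exp (-(58 + 4 * (m : ℝ) ^ 2 / r)) / r)) := by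
            gcongr
            linarith
        _ ≤ _ := by
            gcongr
            rw [← nsmul_eq_mul]
            exact Finset.card_nsmul_le_sum _ _ _ hterm
    have hX : stdDev .undirected s x ^ 2 = (x : ℝ) ^ 2 / (2 * r) := by
      rw [stdDev, dev, div_pow, Real.sq_sqrt s.coe_nonneg, ← hrs]
      simp [WalkKind.drift, WalkKind.up, WalkKind.down]
    rcases le_or_gt 0 x with h0 | h0
    · obtain ⟨m, rfl⟩ := Int.eq_ofNat_of_zero_le h0
      have h := sum_poisson_mul_le_pmf .undirected s m J
      have hk := key m
      rw [hX]
      calc _ = Real.exp (-(58 + 4 * (m : ℝ) ^ 2 / r)) := by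
            congr 3
            push_cast
            field_simp
            ring
        _ ≤ _ := hk.trans (by gcongr; exact h)
    · obtain ⟨m, hm⟩ := Int.eq_ofNat_of_zero_le (a := -x) (by lia)
      obtain rfl : x = -m := by lia
      have h := sum_poisson_mul_le_pmf_neg .undirected s m J
      have hk := key m
      simp_rw [mul_comm ((poissonMeasure r).real {m + _})] at hk
      rw [hX]
      calc _ = Real.exp (-(58 + 4 * (m : ℝ) ^ 2 / r)) := by
            congr 3
            push_cast
            field_simp
            ring
        _ ≤ _ := hk.trans (by gcongr; exact h)

/-! ### Long times -/

/-- The constant `log √(2π)`. -/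
noncomputable def gaussConst : ℝ := Real.log √(2 * Real.pi)

lemma gaussConst_nonneg : 0 ≤ gaussConst :=
  Real.log_nonneg (Real.one_le_sqrt.2 (by linarith [Real.pi_gt_three]))

lemma gaussConst_le : gaussConst ≤ 2 := by
  have h : √(2 * Real.pi) ≤ 3 := by
    rw [Real.sqrt_le_left (by norm_num)]; linarith [Real.pi_lt_d2]
  have h2 := Real.log_le_sub_one_of_pos
    (x := √(2 * Real.pi)) (Real.sqrt_pos.2 (by positivity))
  rw [gaussConst]
  linarith

/-- The error of the Gaussian approximation `log √(2πs) + X² / 2` of the information content, where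
`X` is the standardised displacement. -/
noncomputable def gaussErr (w : WalkKind) (s : ℝ≥0) (x : ℤ) : ℝ :=
  unitQ w s x - Real.log √s - gaussConst - stdDev w s x ^ 2 / 2

lemma neg_log_sqrt_mul_pmf {w : WalkKind} {s : ℝ≥0} (hs : 0 < s) {x : ℤ} (hx : w.Reaches x) :
    -Real.log (√s * pmf w s x) = unitQ w s x - Real.log √s := by
  have : (0 : ℝ) < √(s : ℝ) := Real.sqrt_pos.2 hs
  rw [Real.log_mul this.ne' (pmf_pos hs hx).ne', unitQ]
  ring

lemma unitQ_sub_log_sqrt_le {w : WalkKind} {s : ℝ≥0} (hs : 2 ≤ s) {x : ℤ} (hx : w.Reaches x) :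
    unitQ w s x - Real.log √s ≤ 58 + 8 * stdDev w s x ^ 2 := by
  have hs0 : 0 < s := lt_of_lt_of_le (by norm_num) hs
  rw [← neg_log_sqrt_mul_pmf hs0 hx, neg_le]
  have : (0 : ℝ) < √(s : ℝ) := Real.sqrt_pos.2 hs0
  rw [Real.le_log_iff_exp_le (mul_pos this (pmf_pos hs0 hx))]
  exact exp_le_sqrt_mul_pmf w hs hx

lemma eventually_log_sqrt_le_unitQ (w : WalkKind) :
    ∀ᶠ s : ℝ≥0 in atTop, ∀ x, w.Reaches x → Real.log √s ≤ unitQ w s x := by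
  obtain ⟨δ, hδ, hb⟩ := exists_local_limit w
  filter_upwards [hδ.eventually_lt_const (show (0 : ℝ) < 1 / 2 by norm_num),
    eventually_ge_atTop 2] with s h1 h2 x hx
  have hs0 : 0 < s := lt_of_lt_of_le (by norm_num) h2
  have h3 := (abs_le.1 (hb s hs0 x)).2
  have h4 : (√(2 * Real.pi))⁻¹ ≤ 1 / 2 := by
    rw [inv_le_comm₀ (Real.sqrt_pos.2 (by positivity)) (by norm_num)]
    rw [Real.le_sqrt (by norm_num)]
    · nlinarith [Real.pi_gt_three]
    · positivity
  have h5 : Real.exp (-stdDev w s x ^ 2 / 2) ≤ 1 :=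
    Real.exp_le_one_iff.2 (by nlinarith [sq_nonneg (stdDev w s x)])
  have h6 : (√(2 * Real.pi))⁻¹ * Real.exp (-stdDev w s x ^ 2 / 2) ≤ 1 / 2 * 1 := by gcongr
  have h7 : √s * pmf w s x ≤ 1 := by linarith
  have h8 : 0 ≤ √(s : ℝ) * pmf w s x := mul_nonneg (Real.sqrt_nonneg _) (pmf_nonneg _ _ _)
  have h9 := Real.log_nonpos h8 h7
  have := neg_log_sqrt_mul_pmf hs0 hx
  linarith

lemma eventually_abs_gaussErr_le (w : WalkKind) :
    ∀ᶠ s : ℝ≥0 in atTop, ∀ x, w.Reaches x → |gaussErr w s x| ≤ 60 * (1 + stdDev w s x ^ 2) := by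
  filter_upwards [eventually_log_sqrt_le_unitQ w, eventually_ge_atTop 2] with s h1 h2 x hx
  have h3 := h1 x hx
  have h4 := unitQ_sub_log_sqrt_le h2 hx
  have := gaussConst_nonneg
  have := gaussConst_le
  rw [gaussErr, abs_le]
  constructor <;> nlinarith [sq_nonneg (stdDev w s x)]

/-- On bounded ranges of the standardised displacement, the local limit theorem makes the Gaussian
approximation of the information content uniformly accurate. -/
lemma eventually_abs_gaussErr_le_of_abs_le (w : WalkKind) (A : ℝ) {ε : ℝ} (hε : 0 < ε) :
    ∀ᶠ s : ℝ≥0 in atTop, ∀ x, w.Reaches x → |stdDev w s x| ≤ A → |gaussErr w s x| ≤ ε := by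
  obtain ⟨δ, hδ, hb⟩ := exists_local_limit w
  set η : ℝ := (√(2 * Real.pi))⁻¹ * Real.exp (-A ^ 2 / 2) with hη
  have hsp : 0 < √(2 * Real.pi) := Real.sqrt_pos.2 (by positivity)
  have hη0 : 0 < η := by positivity
  set c : ℝ := min (1 / 2) (ε / 2) with hc
  have hc0 : 0 < c := by positivity
  filter_upwards [hδ.eventually_lt_const (mul_pos hc0 hη0), eventually_gt_atTop 0]
    with s h1 hs0 x hx hA
  set φ : ℝ := (√(2 * Real.pi))⁻¹ * Real.exp (-stdDev w s x ^ 2 / 2) with hφ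
  have hηφ : η ≤ φ := by
    rw [hη, hφ]
    have : stdDev w s x ^ 2 ≤ A ^ 2 := by
      rw [← sq_abs (stdDev w s x)]
      gcongr
    gcongr
  have hφ0 : 0 < φ := hη0.trans_le hηφ
  have hs0' : (0 : ℝ) < √(s : ℝ) := Real.sqrt_pos.2 hs0
  have hP : 0 < √(s : ℝ) * pmf w s x := mul_pos hs0' (pmf_pos hs0 hx)
  have h2 : |√s * pmf w s x - φ| ≤ c * φ :=
    (hb s hs0 x).trans (h1.le.trans (by gcongr))
  obtain ⟨h3, h4⟩ := abs_le.1 h2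
  have hlogφ : Real.log φ = -gaussConst - stdDev w s x ^ 2 / 2 := by
    rw [hφ, Real.log_mul (by positivity) (Real.exp_pos _).ne', Real.log_inv, Real.log_exp,
      gaussConst]
    ring
  have hD : gaussErr w s x = -(Real.log (√s * pmf w s x / φ)) := by
    rw [Real.log_div hP.ne' hφ0.ne', hlogφ, gaussErr, ← neg_log_sqrt_mul_pmf hs0 hx]
    ring
  have hc1 : c ≤ 1 / 2 := min_le_left _ _
  have hc2 : c ≤ ε / 2 := min_le_right _ _
  have hr1 : 1 - c ≤ √s * pmf w s x / φ := by rw [le_div_iff₀ hφ0]; linarith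
  have hr2 : √s * pmf w s x / φ ≤ 1 + c := by rw [div_le_iff₀ hφ0]; linarith
  have hr0 : 0 < √s * pmf w s x / φ := by positivity
  have hl1 := Real.log_le_sub_one_of_pos hr0
  have hl2 := Real.one_sub_inv_le_log_of_pos hr0
  have hinv : (√s * pmf w s x / φ)⁻¹ ≤ 1 + 2 * c := by
    rw [inv_le_comm₀ hr0 (by linarith)]
    refine le_trans ?_ hr1
    rw [inv_le_iff_one_le_mul₀ (by linarith)]
    nlinarith
  rw [hD, abs_neg, abs_le]
  constructor <;> linarith

/-- The Gaussian approximation of the information content holds in `L¹`, with a quadratic weight: it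
is uniform for `|X| ≤ A`, and the contribution of `|X| > A` is of order `A⁻²` by the sixth moment
of the standardised displacement `X`. -/
lemma tendsto_integral_abs_gaussErr (w : WalkKind) :
    Tendsto (fun s => ∫ x, (1 + stdDev w s x ^ 2) * |gaussErr w s x| ∂(unitRateLaw w s))
      atTop (𝓝 0) := by
  have hexp := Real.exp_pos 1
  set K : ℝ := 2000 * (2 * Real.exp 1) with hK
  have hK0 : 0 < K := by positivity
  rw [Metric.tendsto_nhds]
  intro ε hε
  obtain ⟨A, hA⟩ : ∃ A : ℝ, 0 < A ∧ 60 * K / A ^ 2 < ε / 2 := by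
    have h : Tendsto (fun A : ℝ => 60 * K / A ^ 2) atTop (𝓝 0) :=
      tendsto_const_nhds.div_atTop (tendsto_pow_atTop (by norm_num))
    exact ((eventually_gt_atTop 0).and (h.eventually_lt_const (by positivity))).exists
  obtain ⟨hA0, hA⟩ := hA
  filter_upwards [eventually_abs_gaussErr_le w, eventually_ge_atTop 1,
    eventually_abs_gaussErr_le_of_abs_le w A (ε := ε / 8) (by positivity)] with s h1 hs1 h2
  have hs0 : 0 < s := lt_of_lt_of_le (by norm_num) hs1
  set μ := unitRateLaw w s
  set X := stdDev w s
  have hbound : ∀ᵐ x ∂μ, (1 + X x ^ 2) * |gaussErr w s x| ≤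
      ε / 8 * (1 + X x ^ 2) + 60 / A ^ 2 * (X x ^ 2 + 2 * X x ^ 4 + X x ^ 6) := by
    filter_upwards [ae_reaches w s] with x hx
    rcases le_or_gt |X x| A with h | h
    · have h3 := h2 x hx h
      have h4 : (1 + X x ^ 2) * |gaussErr w s x| ≤ (1 + X x ^ 2) * (ε / 8) := by gcongr
      have h5 : 0 ≤ 60 / A ^ 2 * (X x ^ 2 + 2 * X x ^ 4 + X x ^ 6) := by positivity
      linarith
    · have h3 := h1 x hx
      have h4 : A ^ 2 ≤ X x ^ 2 := by
        rw [← sq_abs (X x)]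
        gcongr
      have h5 : 1 ≤ X x ^ 2 / A ^ 2 := (one_le_div (by positivity)).2 h4
      have h6 : (1 + X x ^ 2) * |gaussErr w s x| ≤ (1 + X x ^ 2) * (60 * (1 + X x ^ 2)) := by
        gcongr
      have h7 : (1 + X x ^ 2) * (60 * (1 + X x ^ 2)) ≤
          (1 + X x ^ 2) * (60 * (1 + X x ^ 2)) * (X x ^ 2 / A ^ 2) :=
        le_mul_of_one_le_right (by positivity) h5
      have h8 : (1 + X x ^ 2) * (60 * (1 + X x ^ 2)) * (X x ^ 2 / A ^ 2) =
          60 / A ^ 2 * (X x ^ 2 + 2 * X x ^ 4 + X x ^ 6) := by ring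
      have h9 : 0 ≤ ε / 8 * (1 + X x ^ 2) := by positivity
      linarith
  have hp := integrable_pow_stdDev w s
  have m2 := (moments_stdDev w hs0).1
  have habs : ∀ j, Even j → ∫ x, X x ^ j ∂μ ≤ j.factorial * (2 * Real.exp 1) := by
    intro j hj
    have := integral_abs_stdDev_pow_le w hs1 j
    simpa only [hj.pow_abs] using this
  have m2' := habs 2 (by decide)
  have m4 := habs 4 (by decide)
  have m6 := habs 6 (by decide)
  have hI1 : Integrable (fun x => ε / 8 * (1 + X x ^ 2)) μ :=
    ((integrable_const _).add (hp 2)).const_mul _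
  have hI2 : Integrable (fun x => 60 / A ^ 2 * (X x ^ 2 + 2 * X x ^ 4 + X x ^ 6)) μ :=
    (((hp 2).add ((hp 4).const_mul 2)).add (hp 6)).const_mul _
  have h0 : 0 ≤ ∫ x, (1 + X x ^ 2) * |gaussErr w s x| ∂μ :=
    integral_nonneg fun x => by positivity
  have hI3 : Integrable (fun x => (1 + X x ^ 2) * |gaussErr w s x|) μ :=
    (hI1.add hI2).mono' (by fun_prop) (hbound.mono fun x hx => by
      rw [Real.norm_of_nonneg (by positivity)]; exact hx)
  have hfin := integral_mono_ae hI3 (hI1.add hI2) hbound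
  simp only [Pi.add_apply] at hfin
  rw [integral_add hI1 hI2, integral_const_mul, integral_const_mul,
    integral_add (integrable_const _) (hp 2),
    integral_add ((hp 2).fun_add ((hp 4).const_mul 2)) (hp 6),
    integral_add (hp 2) ((hp 4).const_mul 2), integral_const_mul, m2] at hfin
  simp only [integral_const, probReal_univ, smul_eq_mul, mul_one] at hfin
  rw [dist_zero_right, Real.norm_of_nonneg h0]
  norm_num [Nat.factorial] at m4 m6
  have hmom : 1 + 2 * ∫ x, X x ^ 4 ∂μ + ∫ x, X x ^ 6 ∂μ ≤ K := by
    have : 1 ≤ Real.exp 1 := Real.one_le_exp (by norm_num)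
    rw [hK]
    linarith
  calc _ ≤ _ := hfin
    _ ≤ ε / 8 * 2 + 60 / A ^ 2 * K := by gcongr; norm_num
    _ = ε / 4 + 60 * K / A ^ 2 := by ring
    _ < ε := by linarith

/-- As time tends to infinity, the varentropy tends to the variance of `Z² / 2` for a standard
normal variable `Z`. -/
theorem tendsto_varentropy_atTop (w : WalkKind) : Tendsto (varentropy w) atTop (𝓝 (1 / 2)) := by
  have hT := tendsto_integral_abs_gaussErr w
  set T := fun s => ∫ x, (1 + stdDev w s x ^ 2) * |gaussErr w s x| ∂(unitRateLaw w s)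
  set D1 := fun s => ∫ x, gaussErr w s x ∂(unitRateLaw w s)
  set D2 := fun s => ∫ x, stdDev w s x ^ 2 * gaussErr w s x ∂(unitRateLaw w s)
  set D3 := fun s => ∫ x, gaussErr w s x ^ 2 ∂(unitRateLaw w s)
  have hint : ∀ᶠ s : ℝ≥0 in atTop,
      Integrable (fun x => (1 + stdDev w s x ^ 2) * |gaussErr w s x|) (unitRateLaw w s) := by
    filter_upwards [eventually_abs_gaussErr_le w] with s h1
    have hp := integrable_pow_stdDev w s
    refine ((((integrable_const (1 : ℝ)).add ((hp 2).const_mul 2)).add (hp 4)).const_mul 60).mono'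
      (by fun_prop) ?_
    filter_upwards [ae_reaches w s] with x hx
    rw [Real.norm_of_nonneg (by positivity)]
    calc _ ≤ (1 + stdDev w s x ^ 2) * (60 * (1 + stdDev w s x ^ 2)) := by gcongr; exact h1 x hx
      _ = _ := by simp only [Pi.add_apply]; ring
  have hb : ∀ (F : ℝ≥0 → ℤ → ℝ) (C : ℝ), 0 ≤ C → (∀ᶠ s : ℝ≥0 in atTop, ∀ x, w.Reaches x → |F s x| ≤
      C * ((1 + stdDev w s x ^ 2) * |gaussErr w s x|)) →
      (∀ᶠ s in atTop, Integrable (F s) (unitRateLaw w s)) ∧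
      Tendsto (fun s => ∫ x, F s x ∂(unitRateLaw w s)) atTop (𝓝 0) := by
    intro F C hC hF
    constructor
    · filter_upwards [hF, hint] with s h1 h2
      refine (h2.const_mul C).mono' (by fun_prop) ?_
      filter_upwards [ae_reaches w s] with x hx using h1 x hx
    · refine squeeze_zero_norm' ?_ (by simpa using hT.const_mul C)
      filter_upwards [hF, hint] with s h1 h2
      rw [← integral_const_mul]
      refine norm_integral_le_of_norm_le (h2.const_mul C) ?_
      filter_upwards [ae_reaches w s] with x hx using h1 x hx
  obtain ⟨i1, t1⟩ := hb (gaussErr w) 1 (by norm_num) (Eventually.of_forall fun s x _ => by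
    rw [one_mul]; exact le_mul_of_one_le_left (abs_nonneg _) (by nlinarith [sq_nonneg (stdDev w s x)]))
  obtain ⟨i2, t2⟩ := hb (fun s x => stdDev w s x ^ 2 * gaussErr w s x) 1 (by norm_num)
    (Eventually.of_forall fun s x _ => by
      rw [one_mul, abs_mul, abs_of_nonneg (sq_nonneg _)]; gcongr; linarith)
  obtain ⟨i3, t3⟩ := hb (fun s x => gaussErr w s x ^ 2) 60 (by norm_num) (by
    filter_upwards [eventually_abs_gaussErr_le w] with s h1 x hx
    rw [abs_of_nonneg (sq_nonneg _), ← sq_abs, sq, ← mul_assoc]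
    gcongr
    exact h1 x hx)
  have hinv : Tendsto (fun s : ℝ≥0 => 1 / (s : ℝ)) atTop (𝓝 0) := by
    simpa [Function.comp_def] using
      tendsto_inv_atTop_zero.comp (NNReal.tendsto_coe_atTop.2 tendsto_id)
  -- The second moment and the mean of `X² / 2 + gaussErr`, up to vanishing terms, are those of
  -- `Z² / 2`, namely `3 / 4` and `1 / 2`.
  have hlim : Tendsto (fun s : ℝ≥0 => ((3 + 1 / (s : ℝ)) / 4 + D2 s + D3 s) - (1 / 2 + D1 s) ^ 2)
      atTop (𝓝 (((3 + 0) / 4 + 0 + 0) - (1 / 2 + 0) ^ 2)) :=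
    ((((hinv.const_add 3).div_const 4).add t2).add t3).sub ((t1.const_add _).pow 2)
  rw [show (((3 + 0) / 4 + 0 + 0) - (1 / 2 + 0) ^ 2 : ℝ) = 1 / 2 by norm_num] at hlim
  refine hlim.congr' ?_
  filter_upwards [i1, i2, i3, eventually_gt_atTop 0] with s i1 i2 i3 hs0
  have hp := integrable_pow_stdDev w s
  obtain ⟨m2, m4⟩ := moments_stdDev w hs0
  have hQ : unitQ w s = fun x => (stdDev w s x ^ 2 / 2 + gaussErr w s x) +
      (Real.log √s + gaussConst) := by
    ext x; rw [gaussErr]; ring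
  have hm2 : MemLp (fun x => stdDev w s x ^ 2 / 2 + gaussErr w s x) 2 (unitRateLaw w s) := by
    have := (memLp_two_unitQ w s).sub (memLp_const (Real.log √s + gaussConst))
    convert this using 1
    ext x
    simp only [Pi.sub_apply, gaussErr]
    ring
  rw [varentropy, hQ, variance_add_const hm2.aestronglyMeasurable, variance_eq_sub hm2]
  congr 1
  · have : ∀ x, ((fun x => stdDev w s x ^ 2 / 2 + gaussErr w s x) ^ 2) x =
        stdDev w s x ^ 4 / 4 + stdDev w s x ^ 2 * gaussErr w s x + gaussErr w s x ^ 2 := by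
      intro x; simp only [Pi.pow_apply]; ring
    simp_rw [this]
    rw [integral_add (((hp 4).div_const 4).fun_add i2) i3, integral_add ((hp 4).div_const 4) i2,
      integral_div, m4]
  · rw [integral_add ((hp 2).div_const 2) i1, integral_div, m2]

/-- At long times, `Q - log √s` lies between `0` and a quadratic function of the standardised
displacement, whose moments are bounded. -/
lemma eventually_thirdMoment_le (w : WalkKind) :
    ∃ C : ℝ, ∀ᶠ s : ℝ≥0 in atTop, thirdMoment w s ≤ C := by
  set E : ℝ := 2 * Real.exp 1 with hE
  refine ⟨(58 ^ 3 + 3 * 58 ^ 2 * 8 * (2 * E) + 3 * 58 * 64 * (24 * E) + 512 * (720 * E)) +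
    (58 + 8 * (2 * E)) ^ 3, ?_⟩
  filter_upwards [eventually_log_sqrt_le_unitQ w, eventually_ge_atTop 2] with s h1 h2
  have hs1 : 1 ≤ s := le_trans (by norm_num) h2
  have hp := integrable_pow_stdDev w s
  set μ := unitRateLaw w s
  set X := stdDev w s
  have habs : ∀ j, Even j → ∫ x, X x ^ j ∂μ ≤ j.factorial * E := by
    intro j hj
    have := integral_abs_stdDev_pow_le w hs1 j
    simpa only [hj.pow_abs] using this
  have m2 := habs 2 (by decide)
  have m4 := habs 4 (by decide)
  have m6 := habs 6 (by decide)
  norm_num [Nat.factorial] at m2 m4 m6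
  have hlow : ∀ᵐ x ∂μ, Real.log √s ≤ unitQ w s x := (ae_reaches w s).mono fun x hx => h1 x hx
  have hup : ∀ᵐ x ∂μ, unitQ w s x - Real.log √s ≤ 58 + 8 * X x ^ 2 :=
    (ae_reaches w s).mono fun x hx => unitQ_sub_log_sqrt_le h2 hx
  have hI : Integrable (fun x => 58 + 8 * X x ^ 2) μ :=
    (integrable_const _).add ((hp 2).const_mul 8)
  have hmean0 : 0 ≤ entropy w s - Real.log √s := by
    have := integral_mono_ae (integrable_const (Real.log √s)) (integrable_unitQ w s) hlow
    rw [entropy, sub_nonneg]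
    simpa using this
  have hmean : entropy w s - Real.log √s ≤ 58 + 8 * (2 * E) := by
    have h3 := integral_mono_ae ((integrable_unitQ w s).sub (integrable_const (Real.log √s))) hI hup
    simp only [Pi.sub_apply] at h3
    rw [integral_sub (integrable_unitQ w s) (integrable_const _),
      integral_add (integrable_const _) ((hp 2).const_mul 8), integral_const_mul] at h3
    simp only [integral_const, probReal_univ, smul_eq_mul, one_mul] at h3
    rw [entropy]
    linarith
  refine (thirdMoment_le w s _ hlow).trans (add_le_add ?_ (pow_le_pow_left₀ hmean0 hmean 3))
  have hIi : Integrable (fun x => (58 ^ 3 + 3 * 58 ^ 2 * 8 * X x ^ 2 + 3 * 58 * 64 * X x ^ 4 +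
      512 * X x ^ 6 : ℝ)) μ :=
    (((integrable_const _).add ((hp 2).const_mul _)).add ((hp 4).const_mul _)).add
      ((hp 6).const_mul _)
  calc ∫ x, (unitQ w s x - Real.log √s) ^ 3 ∂μ
      ≤ ∫ x, (58 ^ 3 + 3 * 58 ^ 2 * 8 * X x ^ 2 + 3 * 58 * 64 * X x ^ 4 + 512 * X x ^ 6 : ℝ) ∂μ := by
        refine integral_mono_ae ?_ hIi ?_
        · exact (integrable_abs_sub_pow_three w s (Real.log √s)).congr (by
            filter_upwards [hlow] with x hx
            rw [abs_of_nonneg (sub_nonneg.2 hx)])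
        · filter_upwards [hlow, hup] with x hx1 hx2
          refine (pow_le_pow_left₀ (sub_nonneg.2 hx1) hx2 3).trans (le_of_eq (by ring))
    _ ≤ _ := by
        rw [integral_add (((integrable_const _).fun_add ((hp 2).const_mul _)).fun_add
            ((hp 4).const_mul _)) ((hp 6).const_mul _),
          integral_add ((integrable_const _).fun_add ((hp 2).const_mul _)) ((hp 4).const_mul _),
          integral_add (integrable_const _) ((hp 2).const_mul _), integral_const_mul,
          integral_const_mul, integral_const_mul]
        simp only [integral_const, probReal_univ, smul_eq_mul, one_mul]
        gcongr

theorem tendsto_entropy_atTop (w : WalkKind) : Tendsto (entropy w) atTop atTop := by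
  have hlog : Tendsto (fun s : ℝ≥0 => Real.log √s) atTop atTop :=
    Real.tendsto_log_atTop.comp (Real.tendsto_sqrt_atTop.comp
      (NNReal.tendsto_coe_atTop.2 tendsto_id))
  refine tendsto_atTop_mono' _ ?_ hlog
  filter_upwards [eventually_log_sqrt_le_unitQ w] with s h1
  have := integral_mono_ae (integrable_const (Real.log √s)) (integrable_unitQ w s)
    ((ae_reaches w s).mono fun x hx => h1 x hx)
  rw [entropy]
  simpa using this

/-! ### Continuity, positivity and monotonicity in time -/

lemma summable_exp_neg_abs : Summable fun x : ℤ => Real.exp (-|(x : ℝ)|) := by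
  have h : Summable fun n : ℕ => Real.exp (-(n : ℝ)) := Real.summable_exp_neg_nat
  refine Summable.of_nat_of_neg ?_ ?_ <;> simpa using h

lemma one_add_sq_pow_mul_exp_le (j : ℕ) (x : ℝ) :
    (1 + x ^ 2) ^ j * Real.exp (-((2 * j + 1 : ℝ) * |x|)) ≤ Real.exp (-|x|) := by
  have h : (1 + x ^ 2) ^ j ≤ Real.exp (2 * j * |x|) := by
    rw [show 2 * (j : ℝ) * |x| = j * (2 * |x|) by ring, Real.exp_nat_mul]
    gcongr
    exact one_add_sq_le_exp x
  calc _ ≤ Real.exp (2 * j * |x|) * Real.exp (-((2 * j + 1 : ℝ) * |x|)) := by gcongr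
    _ = _ := by rw [← Real.exp_add]; ring_nf

/-- The series for the moments of the information content converges uniformly on compact sets of
positive times, as the point masses decay faster than any exponential. -/
lemma continuousOn_integral_unitQ_pow (w : WalkKind) (j : ℕ) :
    ContinuousOn (fun s => ∫ x, unitQ w s x ^ j ∂(unitRateLaw w s)) (Set.Ioi 0) := by
  intro c hc
  have hc0 : (0 : ℝ≥0) < c := hc
  obtain ⟨a, ha0, hac⟩ := exists_between hc0
  have hcb : c < c + 1 := lt_add_one c
  refine ContinuousAt.continuousWithinAt ?_
  have key : ContinuousOn (fun s => ∑' x, pmf w s x * unitQ w s x ^ j) (Set.Icc a (c + 1)) := by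
    -- The exponential rate `2 j + 1` beats `(1 + x²) ^ j` and leaves a summable factor.
    refine continuousOn_tsum (u := fun x : ℤ => quadConst a (c + 1) ^ j *
      (2 * Real.exp ((c + 1) * (Real.exp (2 * j + 1) - 1))) * Real.exp (-|(x : ℝ)|)) ?_ ?_ ?_
    · intro x
      by_cases hx : w.Reaches x
      · have hp : ContinuousOn (fun s => pmf w s x) (Set.Icc a (c + 1)) :=
          (continuous_pmf w x).continuousOn
        refine hp.mul (ContinuousOn.pow (hp.log fun s hs => ?_).neg j)
        exact (pmf_pos (ha0.trans_le hs.1) hx).ne'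
      · have : ∀ s, pmf w s x = 0 := fun s => pmf_eq_zero hx
        simp only [this, zero_mul]
        exact continuousOn_const
    · exact summable_exp_neg_abs.mul_left _
    · intro x s hs
      have hs1 : (a : ℝ) ≤ s := hs.1
      have hs2 : (s : ℝ) ≤ c + 1 := by exact_mod_cast hs.2
      have hq : 0 ≤ quadConst a (c + 1) := by unfold quadConst; positivity
      rw [Real.norm_of_nonneg (mul_nonneg (pmf_nonneg _ _ _) (pow_nonneg (unitQ_nonneg _ _ _) _))]
      by_cases hx : w.Reaches x
      · have h1 := unitQ_le_quadConst w (a := a) (b := c + 1) ha0 hs1 hs2 hx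
        have h2 := pmf_le_exp w s (c := 2 * j + 1) (by positivity) x
        have h3 := pow_le_pow_left₀ (unitQ_nonneg w s x) h1 j
        have h4 : (0 : ℝ) ≤ Real.exp (2 * j + 1) - 1 := by
          rw [sub_nonneg]; exact Real.one_le_exp (by positivity)
        have h5 := one_add_sq_pow_mul_exp_le j (x : ℝ)
        calc pmf w s x * unitQ w s x ^ j
            ≤ (2 * Real.exp ((c + 1) * (Real.exp (2 * j + 1) - 1)) *
                Real.exp (-((2 * j + 1) * |(x : ℝ)|))) *
                (quadConst a (c + 1) * (1 + (x : ℝ) ^ 2)) ^ j := by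
              refine mul_le_mul (h2.trans ?_) h3 (pow_nonneg (unitQ_nonneg _ _ _) _)
                (by positivity)
              gcongr
          _ = quadConst a (c + 1) ^ j * (2 * Real.exp ((c + 1) * (Real.exp (2 * j + 1) - 1))) *
                ((1 + (x : ℝ) ^ 2) ^ j * Real.exp (-((2 * j + 1) * |(x : ℝ)|))) := by
              rw [mul_pow]; ring
          _ ≤ _ := by gcongr
      · have : pmf w s x = 0 := pmf_eq_zero hx
        rw [this, zero_mul]
        positivity
  simp_rw [integral_unitRateLaw]
  exact key.continuousAt (Icc_mem_nhds hac hcb)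

lemma continuousOn_entropy (w : WalkKind) : ContinuousOn (entropy w) (Set.Ioi 0) := by
  have h := continuousOn_integral_unitQ_pow w 1
  simp only [pow_one] at h
  exact h

lemma continuousOn_varentropy (w : WalkKind) : ContinuousOn (varentropy w) (Set.Ioi 0) := by
  have : varentropy w = fun s => ∫ x, unitQ w s x ^ 2 ∂(unitRateLaw w s) - entropy w s ^ 2 :=
    funext fun s => varentropy_eq w s
  rw [this]
  exact (continuousOn_integral_unitQ_pow w 2).sub ((continuousOn_entropy w).pow 2)

lemma thirdMoment_le_add (w : WalkKind) (s : ℝ≥0) :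
    thirdMoment w s ≤ ∫ x, unitQ w s x ^ 3 ∂(unitRateLaw w s) + entropy w s ^ 3 := by
  simpa using thirdMoment_le w s 0 (ae_of_all _ (unitQ_nonneg w s))

/-- The law of the walk at a positive time is not uniform on a finite set of sites, so its
information content is not constant. -/
lemma varentropy_pos (w : WalkKind) {s : ℝ≥0} (hs : 0 < s) : 0 < varentropy w s := by
  refine lt_of_le_of_ne (varentropy_nonneg w s) fun h0 => ?_
  have hm : AEMeasurable (unitQ w s) (unitRateLaw w s) := by fun_prop
  have hi : Integrable (fun x => (unitQ w s x - entropy w s) ^ 2) (unitRateLaw w s) :=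
    ((memLp_two_unitQ w s).sub (memLp_const _)).integrable_sq
  have h0' : ∫ x, (unitQ w s x - entropy w s) ^ 2 ∂(unitRateLaw w s) = 0 := by
    rw [h0, varentropy, variance_eq_integral hm]; rfl
  rw [integral_eq_zero_iff_of_nonneg (fun _ => sq_nonneg _) hi, Filter.EventuallyEq,
    ae_iff_of_countable] at h0'
  have h1 : ∀ m : ℕ, pmf w s m = Real.exp (-entropy w s) := by
    intro m
    have hp : 0 < pmf w s m := pmf_pos hs (Or.inr (by positivity))
    have h2 := h0' m (fun h => hp.ne' (by rw [pmf, measureReal_def, h]; rfl))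
    have h3 : unitQ w s m = entropy w s := by
      simpa [sub_eq_zero] using h2
    rw [← h3, unitQ, neg_neg, Real.exp_log hp]
  have h2 : Summable fun m : ℕ => pmf w s m :=
    (hasSum_pmf w s).summable.comp_injective Nat.cast_injective
  simp_rw [h1] at h2
  have := (summable_const_iff _).1 h2
  exact (Real.exp_pos _).ne' this

lemma hasSum_negMulLog_pmf (w : WalkKind) (s : ℝ≥0) :
    HasSum (fun x => Real.negMulLog (pmf w s x)) (entropy w s) := by
  have h : ∀ x, Real.negMulLog (pmf w s x) = pmf w s x * unitQ w s x := fun x => by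
    rw [Real.negMulLog, unitQ]; ring
  simp_rw [h]
  have h1 := integrable_unitRateLaw_iff.1 (integrable_unitQ w s)
  simp_rw [abs_of_nonneg (unitQ_nonneg w s _)] at h1
  rw [entropy, integral_unitRateLaw]
  exact h1.hasSum

/-- The entropy of the walk strictly increases: a further independent displacement mixes translates
of the law, and `x ↦ -x log x` is strictly concave. -/
theorem strictMono_entropy (w : WalkKind) : StrictMono (entropy w) := by
  intro s s' hss
  obtain ⟨u, hu, rfl⟩ : ∃ u, 0 < u ∧ s' = s + u :=
    ⟨s' - s, tsub_pos_of_lt hss, (add_tsub_cancel_of_le hss.le).symm⟩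
  set F : ℤ → ℝ := fun z => Real.negMulLog (pmf w s z) with hF
  have hF0 : ∀ z, 0 ≤ F z := fun z => Real.negMulLog_nonneg (pmf_nonneg _ _ _) (pmf_le_one _ _ _)
  have hFs := hasSum_negMulLog_pmf w s
  have hps := hasSum_pmf w u
  have hprod : Summable fun p : ℤ × ℤ => F p.1 * pmf w u p.2 :=
    hFs.summable.mul_of_nonneg hps.summable hF0 (pmf_nonneg w u)
  let e : ℤ × ℤ ≃ ℤ × ℤ :=
    { toFun := fun p => (p.1 - p.2, p.2)
      invFun := fun p => (p.1 + p.2, p.2)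
      left_inv := fun p => by simp
      right_inv := fun p => by simp }
  have hG : Summable fun p : ℤ × ℤ => F (p.1 - p.2) * pmf w u p.2 := e.summable_iff.2 hprod
  have hsum : ∑' x, ∑' y, F (x - y) * pmf w u y = entropy w s := by
    rw [← hG.tsum_prod]
    have h1 : ∑' p : ℤ × ℤ, F (p.1 - p.2) * pmf w u p.2 =
        ∑' p : ℤ × ℤ, F p.1 * pmf w u p.2 := e.tsum_eq fun p : ℤ × ℤ => F p.1 * pmf w u p.2
    rw [h1, ← hFs.summable.tsum_mul_tsum hps.summable hprod, hFs.tsum_eq, hps.tsum_eq, mul_one]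
  have hint : ∀ x, ∑' y, F (x - y) * pmf w u y = ∫ y, F (x - y) ∂(unitRateLaw w u) := fun x => by
    rw [integral_unitRateLaw]; simp_rw [mul_comm]
  have hjensen : ∀ x, (fun y => pmf w s (x - y)) =ᵐ[unitRateLaw w u]
        Function.const ℤ (pmf w (s + u) x) ∨
      ∫ y, F (x - y) ∂(unitRateLaw w u) < Real.negMulLog (pmf w (s + u) x) := by
    intro x
    have hi : Integrable (fun y => pmf w s (x - y)) (unitRateLaw w u) :=
      Integrable.of_bound (by fun_prop) 1 (ae_of_all _ fun y => by
        rw [Real.norm_of_nonneg (pmf_nonneg _ _ _)]; exact pmf_le_one _ _ _)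
    have hi2 : Integrable (fun y => F (x - y)) (unitRateLaw w u) := by
      rw [integrable_unitRateLaw_iff]
      have := hG.prod_factor x
      refine this.congr fun y => ?_
      rw [abs_of_nonneg (hF0 _), mul_comm]
    have := Real.strictConcaveOn_negMulLog.ae_eq_const_or_lt_map_average
      (μ := unitRateLaw w u) (f := fun y => pmf w s (x - y))
      Real.continuous_negMulLog.continuousOn isClosed_Ici
      (ae_of_all _ fun y => pmf_nonneg _ _ _) hi hi2
    rw [average_eq_integral, average_eq_integral, ← pmf_add] at this
    exact this
  have hle : ∀ x, ∑' y, F (x - y) * pmf w u y ≤ Real.negMulLog (pmf w (s + u) x) := by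
    intro x
    rw [hint]
    rcases hjensen x with h | h
    · have : (fun y => F (x - y)) =ᵐ[unitRateLaw w u]
          fun _ => Real.negMulLog (pmf w (s + u) x) := by
        filter_upwards [h] with y hy
        simp only [hF]
        rw [hy]; rfl
      rw [integral_congr_ae this]
      simp
    · exact h.le
  obtain ⟨x, hx⟩ : ∃ x, ∑' y, F (x - y) * pmf w u y < Real.negMulLog (pmf w (s + u) x) := by
    by_contra! hcon
    -- Equality in Jensen's inequality everywhere would make the law translation invariant.
    have hconst : ∀ x, pmf w s x = pmf w s (x - 1) := by
      intro x
      have h := (hjensen x).resolve_right (not_lt.2 (by rw [← hint]; exact hcon x))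
      rw [Filter.EventuallyEq, ae_iff_of_countable] at h
      have hat : ∀ y : ℤ, 0 ≤ y → pmf w s (x - y) = pmf w (s + u) x := fun y hy =>
        h y fun h0 => (pmf_pos (w := w) hu (Or.inr hy)).ne' (by rw [pmf, measureReal_def, h0]; rfl)
      have h0 := hat 0 le_rfl
      rw [sub_zero] at h0
      rw [h0, hat 1 (by norm_num)]
    have hall : ∀ m : ℕ, pmf w s m = pmf w s 0 := by
      intro m
      induction m with
      | zero => rfl
      | succ m ih => rw [hconst, ← ih]; push_cast; ring_nf
    have h2 : Summable fun m : ℕ => pmf w s m :=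
      (hasSum_pmf w s).summable.comp_injective Nat.cast_injective
    simp_rw [hall] at h2
    have h3 := (summable_const_iff _).1 h2
    have h4 := exp_neg_le_pmf_zero w s
    rw [h3] at h4
    exact absurd h4 (not_le.2 (Real.exp_pos _))
  rw [← hsum, ← (hasSum_negMulLog_pmf w (s + u)).tsum_eq]
  exact Summable.tsum_lt_tsum hle hx hG.prod (hasSum_negMulLog_pmf w (s + u)).summable

/-! ### Short times -/

lemma pmf_one_add_pmf_neg_one_le (w : WalkKind) (s : ℝ≥0) :
    pmf w s 1 + pmf w s (-1) ≤ s := by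
  have h := (hasSum_pmf w s).summable.sum_le_tsum {0, 1, -1} fun _ _ => pmf_nonneg _ _ _
  rw [(hasSum_pmf w s).tsum_eq, Finset.sum_insert (by decide), Finset.sum_pair (by decide)] at h
  have h1 := exp_neg_le_pmf_zero w s
  have h2 := Real.add_one_le_exp (-(s : ℝ))
  linarith

lemma mul_exp_neg_le_pmf_one_add (w : WalkKind) (s : ℝ≥0) :
    s * Real.exp (-s) ≤ pmf w s 1 + pmf w s (-1) := by
  cases w with
  | directed =>
    have h1 : pmf .directed s 1 = (poissonMeasure s).real {1} := map_natCast_real_singleton s 1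
    rw [poissonMeasure_real_singleton] at h1
    have h2 := pmf_nonneg .directed s (-1)
    rw [h1]
    simp only [pow_one, Nat.factorial_one, Nat.cast_one, div_one]
    linarith
  | undirected =>
    have h1 := le_pmf .undirected s (x := 1) (Or.inl rfl)
    have h2 := le_pmf .undirected s (x := -1) (Or.inl rfl)
    simp only [Int.natAbs_one, Int.natAbs_neg, pow_one, Nat.factorial_one, Nat.cast_one,
      div_one] at h1 h2
    linarith

/-- For short times, reaching a site at distance `n` costs a factor `s ^ n`. -/
lemma pmf_le_exp_neg_log (w : WalkKind) {s : ℝ≥0} (hs : 0 < s) (hs1 : s ≤ 1) (x : ℤ) :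
    pmf w s x ≤ 2 * Real.exp 1 * Real.exp (Real.log s * |(x : ℝ)|) := by
  have hs' : (0 : ℝ) < s := hs
  have hs1' : (s : ℝ) ≤ 1 := hs1
  have h := pmf_le_exp w s (c := -Real.log s) (neg_nonneg.2 (Real.log_nonpos hs'.le hs1')) x
  rw [Real.exp_neg (Real.log s), Real.exp_log hs'] at h
  refine h.trans ?_
  rw [neg_mul, neg_neg]
  gcongr
  rw [mul_sub, mul_inv_cancel₀ hs'.ne']
  linarith

/-- For short times the moments of the information content are carried by the two neighbours of the
starting point: the sites at distance two or more contribute an extra factor `s`. -/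
lemma exists_integral_unitQ_pow_bounds (w : WalkKind) (j : ℕ) :
    ∃ C : ℝ, ∀ᶠ s : ℝ≥0 in 𝓝[>] 0,
      s * Real.exp (-s) * (-Real.log s) ^ j ≤ ∫ x, unitQ w s x ^ j ∂(unitRateLaw w s) ∧
      ∫ x, unitQ w s x ^ j ∂(unitRateLaw w s) ≤
        s ^ j + s * (-Real.log s + 3) ^ j + C * s ^ 2 * (-Real.log s + 3) ^ j := by
  -- For `s ≤ exp (-d)` and `|x| ≥ 2`, `s ^ |x| ≤ exp (2 d) * s² * exp (-d |x|)`, and `exp (-d |x|)`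
  -- absorbs the factor `(1 + x²) ^ j` from `Q ^ j`.
  set d : ℝ := 2 * j + 1 with hd
  have hd0 : 0 < d := by positivity
  set S : ℝ := ∑' x : ℤ, Real.exp (-|(x : ℝ)|) with hS
  refine ⟨2 * Real.exp 1 * Real.exp (2 * d) * S, ?_⟩
  have hpos : ∀ᶠ s : ℝ≥0 in 𝓝[>] 0, 0 < s := eventually_mem_nhdsWithin
  have hcoe : Tendsto (fun s : ℝ≥0 => (s : ℝ)) (𝓝[>] 0) (𝓝 0) :=
    (NNReal.continuous_coe.tendsto' 0 0 rfl).mono_left nhdsWithin_le_nhds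
  filter_upwards [hpos, hcoe.eventually_lt_const (Real.exp_pos (-d))] with s hs0 hsd
  have hs' : (0 : ℝ) < s := hs0
  have hs1 : (s : ℝ) ≤ 1 := hsd.le.trans (Real.exp_le_one_iff.2 (by linarith))
  set L : ℝ := -Real.log s with hL
  have hLd : d ≤ L := by
    rw [hL, le_neg, Real.log_le_iff_le_exp hs']; exact hsd.le
  have hL0 : 0 ≤ L := hd0.le.trans hLd
  have hlog2 : Real.log (2 / s) = Real.log 2 + L := by
    rw [Real.log_div (by norm_num) hs'.ne', hL]; ring
  have hl2 : Real.log 2 ≤ 1 := by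
    have := Real.log_le_sub_one_of_pos (show (0 : ℝ) < 2 by norm_num); linarith
  have hl20 : 0 ≤ Real.log 2 := Real.log_nonneg (by norm_num)
  have hsum : HasSum (fun x => pmf w s x * unitQ w s x ^ j)
      (∫ x, unitQ w s x ^ j ∂(unitRateLaw w s)) := by
    have h1 := integrable_unitRateLaw_iff.1 (integrable_unitQ_pow w s j)
    simp_rw [abs_of_nonneg (pow_nonneg (unitQ_nonneg w s _) j)] at h1
    rw [integral_unitRateLaw]
    exact h1.hasSum
  have hp1 := pmf_one_add_pmf_neg_one_le w s
  constructor
  · have h := hsum.summable.sum_le_tsum {1, -1} fun x _ =>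
      mul_nonneg (pmf_nonneg w s x) (pow_nonneg (unitQ_nonneg w s x) j)
    rw [hsum.tsum_eq, Finset.sum_pair (by decide)] at h
    refine le_trans ?_ h
    have hq : ∀ x, pmf w s x ≤ s → pmf w s x * L ^ j ≤ pmf w s x * unitQ w s x ^ j := by
      intro x hx
      rcases (pmf_nonneg w s x).eq_or_lt with h0 | h0
      · rw [← h0]; simp
      · gcongr
        exact neg_le_neg (Real.log_le_log h0 hx)
    have h1 := hq 1 (by linarith [pmf_nonneg w s (-1)])
    have h2 := hq (-1) (by linarith [pmf_nonneg w s 1])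
    calc _ ≤ (pmf w s 1 + pmf w s (-1)) * L ^ j := by
          gcongr; exact mul_exp_neg_le_pmf_one_add w s
      _ ≤ _ := by linarith
  · set A : ℝ := (L + 3) ^ j with hA
    set B : ℝ := 2 * Real.exp 1 * Real.exp (2 * d) * s ^ 2 * A with hB
    have hbd : HasSum (fun x : ℤ => (if x = 0 then (s : ℝ) ^ j else 0) +
        (if x = 1 then pmf w s 1 * A else 0) + (if x = -1 then pmf w s (-1) * A else 0) +
        B * Real.exp (-|(x : ℝ)|)) (s ^ j + pmf w s 1 * A + pmf w s (-1) * A + B * S) :=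
      (((hasSum_ite_eq 0 _).add (hasSum_ite_eq 1 _)).add (hasSum_ite_eq (-1) _)).add
        (summable_exp_neg_abs.hasSum.mul_left B)
    have hA0 : 0 ≤ A := by positivity
    have hB0 : 0 ≤ B := by positivity
    have hle := hasSum_le (fun x => ?_) hsum hbd
    · calc _ ≤ _ := hle
        _ = s ^ j + (pmf w s 1 + pmf w s (-1)) * A + B * S := by ring
        _ ≤ s ^ j + s * A + B * S := by gcongr
        _ = _ := by rw [hB]; ring
    · have hBx : 0 ≤ B * Real.exp (-|(x : ℝ)|) := by positivity
      by_cases hx : w.Reaches x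
      swap
      · have h0 : pmf w s x = 0 := pmf_eq_zero hx
        rw [h0, zero_mul]
        have : ∀ (c : Prop) [Decidable c] (r : ℝ), 0 ≤ r → 0 ≤ if c then r else 0 := by
          intro c _ r hr; split_ifs <;> simp [hr]
        have h1 := this (x = 0) ((s : ℝ) ^ j) (by positivity)
        have h2 := this (x = 1) (pmf w s 1 * A) (mul_nonneg (pmf_nonneg _ _ _) hA0)
        have h3 := this (x = -1) (pmf w s (-1) * A) (mul_nonneg (pmf_nonneg _ _ _) hA0)
        linarith
      have hu := unitQ_le w hs0 hx
      rw [hlog2] at hu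
      rcases eq_or_ne x 0 with rfl | hx0
      · have hu0 : unitQ w s 0 ≤ s := by simpa using hu
        have h1 : pmf w s 0 * unitQ w s 0 ^ j ≤ 1 * (s : ℝ) ^ j :=
          mul_le_mul (pmf_le_one _ _ _) (pow_le_pow_left₀ (unitQ_nonneg _ _ _) hu0 j)
            (pow_nonneg (unitQ_nonneg _ _ _) _) zero_le_one
        norm_num at h1 hBx ⊢
        linarith
      rcases eq_or_ne x 1 with rfl | hx1
      · have hu1 : unitQ w s 1 ≤ L + 3 := by norm_num at hu; linarith
        have h1 : pmf w s 1 * unitQ w s 1 ^ j ≤ pmf w s 1 * A :=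
          mul_le_mul_of_nonneg_left (pow_le_pow_left₀ (unitQ_nonneg _ _ _) hu1 j) (pmf_nonneg _ _ _)
        norm_num at h1 hBx ⊢
        linarith
      rcases eq_or_ne x (-1) with rfl | hx2
      · have hu1 : unitQ w s (-1) ≤ L + 3 := by norm_num at hu; linarith
        have h1 : pmf w s (-1) * unitQ w s (-1) ^ j ≤ pmf w s (-1) * A :=
          mul_le_mul_of_nonneg_left (pow_le_pow_left₀ (unitQ_nonneg _ _ _) hu1 j) (pmf_nonneg _ _ _)
        norm_num at h1 hBx ⊢
        linarith
      rw [if_neg hx0, if_neg hx1, if_neg hx2, add_zero, add_zero, zero_add]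
      have hx2' : (2 : ℝ) ≤ |(x : ℝ)| := by
        have : (2 : ℤ) ≤ |x| := by
          rcases abs_cases x with ⟨h, _⟩ | ⟨h, _⟩ <;> rw [h] <;> lia
        exact_mod_cast this
      have hQ : unitQ w s x ≤ (L + 3) * (1 + (x : ℝ) ^ 2) := by
        have h2 : |(x : ℝ)| ≤ 1 + (x : ℝ) ^ 2 := by
          rw [← sq_abs]; nlinarith [sq_nonneg (|(x : ℝ)| - 1)]
        have h3 : |(x : ℝ)| * (Real.log 2 + L) ≤ (1 + (x : ℝ) ^ 2) * (1 + L) := by gcongr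
        nlinarith [sq_nonneg (x : ℝ)]
      have hP := pmf_le_exp_neg_log w hs0 (by exact_mod_cast hs1) x
      have hE : Real.exp (Real.log s * |(x : ℝ)|) ≤
          Real.exp (2 * d) * s ^ 2 * Real.exp (-(d * |(x : ℝ)|)) := by
        have : (s : ℝ) ^ 2 = Real.exp (2 * Real.log s) := by
          rw [two_mul, Real.exp_add, Real.exp_log hs', sq]
        rw [this, ← Real.exp_add, ← Real.exp_add, Real.exp_le_exp]
        have : Real.log s = -L := by rw [hL, neg_neg]
        rw [this]
        nlinarith
      calc pmf w s x * unitQ w s x ^ j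
          ≤ (2 * Real.exp 1 * (Real.exp (2 * d) * s ^ 2 * Real.exp (-(d * |(x : ℝ)|)))) *
            ((L + 3) * (1 + (x : ℝ) ^ 2)) ^ j := by
            refine mul_le_mul (hP.trans (by gcongr))
              (pow_le_pow_left₀ (unitQ_nonneg _ _ _) hQ j) (pow_nonneg (unitQ_nonneg _ _ _) _)
              (by positivity)
        _ = B * ((1 + (x : ℝ) ^ 2) ^ j * Real.exp (-(d * |(x : ℝ)|))) := by
            rw [hB, hA, mul_pow]; ring
        _ ≤ _ := by
            gcongr
            exact one_add_sq_pow_mul_exp_le j (x : ℝ)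

lemma tendsto_coe_nhdsGT_zero : Tendsto (fun s : ℝ≥0 => (s : ℝ)) (𝓝[>] 0) (𝓝[>] 0) := by
  refine tendsto_nhdsWithin_iff.2 ⟨(NNReal.continuous_coe.tendsto' 0 0 rfl).mono_left
    nhdsWithin_le_nhds, ?_⟩
  filter_upwards [eventually_mem_nhdsWithin] with s hs
  exact NNReal.coe_pos.2 hs

lemma tendsto_neg_log_nhdsGT_zero : Tendsto (fun s : ℝ≥0 => -Real.log s) (𝓝[>] 0) atTop :=
  tendsto_neg_atBot_atTop.comp (Real.tendsto_log_nhdsGT_zero.comp tendsto_coe_nhdsGT_zero)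

/-- For short times, the moments of the information content are those of a variable equal to
`log (1 / s)` with probability `s` and `0` otherwise, to leading order. -/
lemma tendsto_integral_unitQ_pow_div (w : WalkKind) {j : ℕ} (hj : j ≠ 0) :
    Tendsto (fun s : ℝ≥0 => (∫ x, unitQ w s x ^ j ∂(unitRateLaw w s)) /
      (s * (-Real.log s) ^ j)) (𝓝[>] 0) (𝓝 1) := by
  obtain ⟨C, hC⟩ := exists_integral_unitQ_pow_bounds w j
  have hL := tendsto_neg_log_nhdsGT_zero
  have hs : Tendsto (fun s : ℝ≥0 => (s : ℝ)) (𝓝[>] 0) (𝓝 0) :=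
    tendsto_coe_nhdsGT_zero.mono_right nhdsWithin_le_nhds
  have h3 : Tendsto (fun s : ℝ≥0 => (1 + 3 / (-Real.log s)) ^ j) (𝓝[>] 0) (𝓝 1) := by
    have := ((tendsto_const_nhds (x := (3 : ℝ)).div_atTop hL).const_add 1).pow j
    simpa using this
  have hlow : Tendsto (fun s : ℝ≥0 => Real.exp (-s)) (𝓝[>] 0) (𝓝 1) := by
    have := (Real.continuous_exp.tendsto _).comp hs.neg
    simpa [Function.comp_def] using this
  have hLj : Tendsto (fun s : ℝ≥0 => 1 / (-Real.log s) ^ j) (𝓝[>] 0) (𝓝 0) :=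
    tendsto_const_nhds.div_atTop ((tendsto_pow_atTop hj).comp hL)
  have hup : Tendsto (fun s : ℝ≥0 => 1 / (-Real.log s) ^ j + (1 + 3 / (-Real.log s)) ^ j +
      C * s * (1 + 3 / (-Real.log s)) ^ j) (𝓝[>] 0) (𝓝 1) := by
    simpa using (hLj.add h3).add ((hs.const_mul C).mul h3)
  have hev : ∀ᶠ s : ℝ≥0 in 𝓝[>] 0, 0 < s := eventually_mem_nhdsWithin
  refine tendsto_of_tendsto_of_tendsto_of_le_of_le' hlow hup ?_ ?_
  · filter_upwards [hC, hev, hL.eventually_gt_atTop 0] with s h hs0 hL0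
    have hs' : (0 : ℝ) < s := hs0
    rw [le_div_iff₀ (by positivity)]
    calc _ = s * Real.exp (-s) * (-Real.log s) ^ j := by ring
      _ ≤ _ := h.1
  · filter_upwards [hC, hev, hL.eventually_gt_atTop 0, hs.eventually_lt_const zero_lt_one]
      with s h hs0 hL0 hs1
    have hs' : (0 : ℝ) < s := hs0
    rw [div_le_iff₀ (by positivity)]
    have e : -Real.log s + 3 = (-Real.log s) * (1 + 3 / (-Real.log s)) := by
      rw [mul_add, mul_one, mul_div_cancel₀ _ hL0.ne']
    have h2 := h.2
    rw [e, mul_pow] at h2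
    have h4 : (s : ℝ) ^ j ≤ s := pow_le_of_le_one hs'.le hs1.le hj
    have h5 : (1 : ℝ) / (-Real.log s) ^ j * (s * (-Real.log s) ^ j) = s := by
      field_simp
    generalize -Real.log s = L at *
    calc _ ≤ _ := h2
      _ ≤ s + s * (L ^ j * (1 + 3 / L) ^ j) + C * s ^ 2 * (L ^ j * (1 + 3 / L) ^ j) := by gcongr
      _ = _ := by rw [add_mul, add_mul, h5]; ring

lemma tendsto_entropy_div (w : WalkKind) :
    Tendsto (fun s : ℝ≥0 => entropy w s / (s * (-Real.log s))) (𝓝[>] 0) (𝓝 1) := by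
  have := tendsto_integral_unitQ_pow_div w (j := 1) one_ne_zero
  simp only [pow_one] at this
  exact this

lemma tendsto_mul_neg_log : Tendsto (fun s : ℝ≥0 => (s : ℝ) * (-Real.log s)) (𝓝[>] 0) (𝓝 0) := by
  have h := (Real.continuous_negMulLog.tendsto 0).comp
    (tendsto_coe_nhdsGT_zero.mono_right nhdsWithin_le_nhds)
  rw [Real.negMulLog_zero] at h
  refine h.congr fun s => ?_
  simp [Real.negMulLog]

lemma tendsto_entropy_nhdsGT_zero (w : WalkKind) : Tendsto (entropy w) (𝓝[>] 0) (𝓝 0) := by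
  have h := (tendsto_entropy_div w).mul tendsto_mul_neg_log
  rw [mul_zero] at h
  refine h.congr' ?_
  filter_upwards [(tendsto_entropy_div w).eventually_const_lt zero_lt_one] with s hs
  refine div_mul_cancel₀ _ fun h0 => ?_
  rw [h0, div_zero] at hs
  exact lt_irrefl _ hs

lemma continuous_entropy (w : WalkKind) : Continuous (entropy w) := by
  rw [continuous_iff_continuousAt]
  intro s
  rcases eq_or_ne s 0 with rfl | hs
  · have h : ContinuousWithinAt (entropy w) (Set.Ioi 0) 0 := by
      rw [ContinuousWithinAt, entropy_zero]; exact tendsto_entropy_nhdsGT_zero w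
    rw [continuousWithinAt_Ioi_iff_Ici] at h
    have hu : Set.Ici (0 : ℝ≥0) = Set.univ := Set.eq_univ_of_forall fun x => zero_le (a := x)
    rwa [hu, continuousWithinAt_univ] at h
  · exact (continuousOn_entropy w).continuousAt (Ioi_mem_nhds (pos_iff_ne_zero.2 hs))

lemma tendsto_varentropy_div (w : WalkKind) :
    Tendsto (fun s : ℝ≥0 => varentropy w s / (s * (-Real.log s) ^ 2)) (𝓝[>] 0) (𝓝 1) := by
  have h2 := tendsto_integral_unitQ_pow_div w (j := 2) two_ne_zero
  have h1 := (tendsto_entropy_div w).pow 2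
  have hs : Tendsto (fun s : ℝ≥0 => (s : ℝ)) (𝓝[>] 0) (𝓝 0) :=
    tendsto_coe_nhdsGT_zero.mono_right nhdsWithin_le_nhds
  -- The square of the mean is smaller than the second moment by a factor `s`.
  have h := h2.sub (h1.mul hs)
  norm_num at h
  refine h.congr' ?_
  filter_upwards [eventually_mem_nhdsWithin, tendsto_neg_log_nhdsGT_zero.eventually_gt_atTop 0]
    with s hs0 hL0
  have hs' : (0 : ℝ) < s := NNReal.coe_pos.2 hs0
  rw [varentropy_eq]
  generalize hLL : -Real.log (s : ℝ) = L at *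
  have : Real.log (s : ℝ) = -L := by rw [← hLL, neg_neg]
  rw [this]
  field_simp

/-- For short times, the logarithm of the entropy is asymptotic to the logarithm of the time. -/
lemma tendsto_log_entropy_div_log (w : WalkKind) :
    Tendsto (fun s : ℝ≥0 => -Real.log (entropy w s) / (-Real.log s)) (𝓝[>] 0) (𝓝 1) := by
  have hL := tendsto_neg_log_nhdsGT_zero
  have h1 := tendsto_entropy_div w
  have h2 : Tendsto (fun s : ℝ≥0 => Real.log (entropy w s / (s * (-Real.log s))) / (-Real.log s))
      (𝓝[>] 0) (𝓝 0) := ((Real.continuousAt_log one_ne_zero).tendsto.comp h1).div_atTop hL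
  have h3 : Tendsto (fun s : ℝ≥0 => Real.log (-Real.log s) / (-Real.log s)) (𝓝[>] 0) (𝓝 0) :=
    (Real.isLittleO_log_id_atTop.tendsto_div_nhds_zero).comp hL
  have h := (h2.neg.add_const 1).sub h3
  rw [neg_zero, zero_add, sub_zero] at h
  refine h.congr' ?_
  filter_upwards [h1.eventually_const_lt zero_lt_one, eventually_mem_nhdsWithin,
    hL.eventually_gt_atTop 0] with s hr hs0 hL0
  have hs' : (0 : ℝ) < s := NNReal.coe_pos.2 hs0
  have he : 0 < entropy w s := by
    have := mul_pos hr (mul_pos hs' hL0)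
    rwa [div_mul_cancel₀ _ (mul_pos hs' hL0).ne'] at this
  rw [Real.log_div he.ne' (mul_pos hs' hL0).ne', Real.log_mul hs'.ne' hL0.ne']
  generalize hLL : -Real.log (s : ℝ) = L at *
  have : Real.log (s : ℝ) = -L := by rw [← hLL, neg_neg]
  rw [this]
  field_simp
  ring

/-- For short times, the varentropy is asymptotic to `-h log h`, where `h` is the entropy. -/
theorem tendsto_varentropy_div_entropy (w : WalkKind) :
    Tendsto (fun s : ℝ≥0 => varentropy w s / (entropy w s * (-Real.log (entropy w s))))
      (𝓝[>] 0) (𝓝 1) := by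
  have h := (tendsto_varentropy_div w).div
    ((tendsto_entropy_div w).mul (tendsto_log_entropy_div_log w)) (by norm_num)
  norm_num at h
  refine h.congr' ?_
  filter_upwards [eventually_mem_nhdsWithin, tendsto_neg_log_nhdsGT_zero.eventually_gt_atTop 0]
    with s hs0 hL0
  have hs' : (s : ℝ) ≠ 0 := (NNReal.coe_pos.2 hs0).ne'
  have : Real.log (s : ℝ) ≠ 0 := by linarith
  simp only [Pi.div_apply]
  field_simp

/-- The Lyapunov ratio of a single coordinate, squared: `(E|Q - h|³)² / V³`, where `h` and `V` are the
mean and the variance of the information content `Q`. -/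
noncomputable def lyapunovRatio (w : WalkKind) (s : ℝ≥0) : ℝ :=
  thirdMoment w s ^ 2 / varentropy w s ^ 3

/-- For short times the squared Lyapunov ratio is at most of order `1 / s`, which is that of
`log (1 / h) / h` for the entropy `h`. -/
lemma eventually_lyapunovRatio_le (w : WalkKind) :
    ∀ᶠ s : ℝ≥0 in 𝓝[>] 0,
      lyapunovRatio w s * (entropy w s / (-Real.log (entropy w s))) ≤ 1000 := by
  have h3 := tendsto_integral_unitQ_pow_div w (j := 3) three_ne_zero
  have hs : Tendsto (fun s : ℝ≥0 => (s : ℝ)) (𝓝[>] 0) (𝓝 0) :=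
    tendsto_coe_nhdsGT_zero.mono_right nhdsWithin_le_nhds
  filter_upwards [h3.eventually_lt_const one_lt_two,
    (tendsto_entropy_div w).eventually_lt_const one_lt_two,
    (tendsto_entropy_div w).eventually_const_lt zero_lt_one,
    (tendsto_varentropy_div w).eventually_const_lt one_half_lt_one,
    (tendsto_log_entropy_div_log w).eventually_const_lt one_half_lt_one,
    hs.eventually_lt_const one_half_pos,
    eventually_mem_nhdsWithin, tendsto_neg_log_nhdsGT_zero.eventually_gt_atTop 0]
    with s h1 h2 h2' h4 h5 h6 hs0 hL0
  have hs' : (0 : ℝ) < s := NNReal.coe_pos.2 hs0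
  have ht := thirdMoment_le_add w s
  have ht0 := thirdMoment_nonneg w s
  have he0 := entropy_nonneg w s
  rw [lyapunovRatio]
  generalize -Real.log (s : ℝ) = L at *
  generalize -Real.log (entropy w s) = M at *
  generalize entropy w s = h at *
  generalize varentropy w s = V at *
  generalize thirdMoment w s = T at *
  rw [div_lt_iff₀ (by positivity)] at h1 h2
  rw [lt_div_iff₀ (by positivity)] at h4 h5
  have hh : h ^ 3 ≤ (2 * (s * L)) ^ 3 := pow_le_pow_left₀ he0 h2.le 3
  have hT : T ≤ 4 * (s * L ^ 3) := by
    have : (2 * (s * L)) ^ 3 ≤ 2 * (s * L ^ 3) := by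
      have h7 : 4 * (s : ℝ) ^ 2 ≤ 1 := by nlinarith
      calc (2 * (s * L)) ^ 3 = (4 * (s : ℝ) ^ 2) * (2 * (s * L ^ 3)) := by ring
        _ ≤ 1 * (2 * (s * L ^ 3)) := by gcongr
        _ = _ := one_mul _
    linarith
  have hV0 : 0 < 1 / 2 * (s * L ^ 2) := by positivity
  have hM0 : 0 < 1 / 2 * L := by positivity
  calc T ^ 2 / V ^ 3 * (h / M) ≤
      (4 * (s * L ^ 3)) ^ 2 / (1 / 2 * (s * L ^ 2)) ^ 3 * ((2 * (s * L)) / (1 / 2 * L)) := by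
        have hM1 := hM0.trans h5
        have hV1 := hV0.trans h4
        gcongr
    _ = 512 := by field_simp; norm_num
    _ ≤ 1000 := by norm_num

/-! ### A central limit theorem for triangular arrays -/

lemma tendsto_one_add_pow_of_tendsto_mul {k : ℕ → ℕ} {g : ℕ → ℂ} {z : ℂ}
    (hk : Tendsto k atTop atTop) (hg : Tendsto (fun N => k N * g N) atTop (𝓝 z)) :
    Tendsto (fun N => (1 + g N) ^ k N) atTop (𝓝 (Complex.exp z)) := by
  have hkr : Tendsto (fun N => (k N : ℝ)) atTop atTop := tendsto_natCast_atTop_atTop.comp hk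
  have hg0 : Tendsto g atTop (𝓝 0) := by
    rw [tendsto_zero_iff_norm_tendsto_zero]
    have h := hg.norm.div_atTop hkr
    refine h.congr' ?_
    filter_upwards [hk.eventually_gt_atTop 0] with N hN
    have : (k N : ℝ) ≠ 0 := by exact_mod_cast hN.ne'
    rw [norm_mul, Complex.norm_natCast]
    field_simp
  have hlog : Tendsto (fun N => k N * Complex.log (1 + g N)) atTop (𝓝 z) := by
    have h : Tendsto (fun N => k N * (Complex.log (1 + g N) - g N)) atTop (𝓝 0) := by
      have hb : Tendsto (fun N => ‖(k N : ℂ) * g N‖ * ‖g N‖) atTop (𝓝 0) := by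
        simpa using hg.norm.mul hg0.norm
      refine squeeze_zero_norm' ?_ hb
      filter_upwards [hg0.norm.eventually_lt_const (show ‖(0 : ℂ)‖ < 1 / 2 by simp)] with N hN
      have h1 := Complex.norm_log_one_add_sub_self_le (z := g N) (by linarith)
      have h2 : (1 - ‖g N‖)⁻¹ ≤ 2 := by
        rw [inv_le_comm₀ (by linarith) (by norm_num)]; linarith
      rw [norm_mul, norm_mul, mul_assoc, ← sq]
      gcongr
      calc _ ≤ _ := h1
        _ ≤ ‖g N‖ ^ 2 * 2 / 2 := by gcongr
        _ = _ := by ring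
    have := h.add hg
    rw [zero_add] at this
    refine this.congr fun N => by ring
  refine ((Complex.continuous_exp.tendsto _).comp hlog).congr' ?_
  filter_upwards [hg0.norm.eventually_lt_const (show ‖(0 : ℂ)‖ < 1 by simp)] with N hN
  have hne : 1 + g N ≠ 0 := fun h => by
    have : g N = -1 := by linear_combination h
    rw [this] at hN; simp at hN
  rw [Function.comp_apply, Complex.exp_nat_mul, Complex.exp_log hne]

lemma norm_exp_mul_I_sub_le (x : ℝ) :
    ‖Complex.exp (x * Complex.I) - 1 - x * Complex.I + x ^ 2 / 2‖ ≤ 5 * |x| ^ 3 := by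
  have hn : ‖(x : ℂ) * Complex.I‖ = |x| := by simp
  have h0 := abs_nonneg x
  rcases le_or_gt |x| 1 with h | h
  · have := Complex.exp_bound (x := x * Complex.I) (by rwa [hn]) (n := 3) (by norm_num)
    simp only [Finset.sum_range_succ, Finset.sum_range_zero] at this
    norm_num [Nat.factorial] at this
    rw [show Complex.exp (x * Complex.I) - 1 - x * Complex.I + x ^ 2 / 2 =
      Complex.exp (x * Complex.I) - (1 + x * Complex.I + (x * Complex.I) ^ 2 / 2) by
        rw [mul_pow, Complex.I_sq]; ring]
    refine this.trans ?_
    nlinarith [pow_nonneg h0 3]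
  · have h1 : ‖(x : ℂ) ^ 2 / 2‖ = |x| ^ 2 / 2 := by
      rw [norm_div, norm_pow, Complex.norm_real, Real.norm_eq_abs]; norm_num
    have h2 : ‖Complex.exp (x * Complex.I) - 1 - x * Complex.I + x ^ 2 / 2‖ ≤
        1 + 1 + |x| + |x| ^ 2 / 2 := by
      calc _ ≤ ‖Complex.exp (x * Complex.I)‖ + ‖(1 : ℂ)‖ + ‖(x : ℂ) * Complex.I‖ +
            ‖(x : ℂ) ^ 2 / 2‖ :=
            (norm_add_le _ _).trans (add_le_add_left ((norm_sub_le _ _).trans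
              (add_le_add_left (norm_sub_le _ _) _)) _)
        _ = _ := by rw [Complex.norm_exp_ofReal_mul_I, hn, h1, norm_one]
    refine h2.trans ?_
    have h3 : |x| ≤ |x| ^ 3 := by nlinarith [mul_pos (zero_lt_one.trans h) (zero_lt_one.trans h)]
    have h4 : |x| ^ 2 ≤ |x| ^ 3 := by nlinarith [mul_pos (zero_lt_one.trans h) (zero_lt_one.trans h)]
    linarith

/-- Second-order expansion of the characteristic function of a standardised variable with an
absolute third moment. -/
lemma norm_integral_exp_sub_le {Ω : Type*} [MeasurableSpace Ω] {μ : Measure Ω} [IsProbabilityMeasure μ] {Y : Ω → ℝ}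
    (hY : MemLp Y 2 μ) (h1 : ∫ x, Y x ∂μ = 0) (h2 : ∫ x, Y x ^ 2 ∂μ = 1)
    (hi3 : Integrable (fun x => |Y x| ^ 3) μ) (u : ℝ) :
    ‖∫ x, Complex.exp ((u * Y x : ℝ) * Complex.I) ∂μ - 1 + u ^ 2 / 2‖ ≤
      5 * |u| ^ 3 * ∫ x, |Y x| ^ 3 ∂μ := by
  have hm : AEStronglyMeasurable Y μ := hY.aestronglyMeasurable
  have hi1 : Integrable Y μ := hY.integrable one_le_two
  have hi2 : Integrable (fun x => Y x ^ 2) μ := hY.integrable_sq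
  have hE : Integrable (fun x => Complex.exp ((u * Y x : ℝ) * Complex.I)) μ := by
    refine Integrable.of_bound ?_ 1 (ae_of_all _ fun x => ?_)
    · exact (by fun_prop : Continuous fun y : ℝ =>
        Complex.exp ((u * y : ℝ) * Complex.I)).comp_aestronglyMeasurable hm
    · rw [Complex.norm_exp_ofReal_mul_I]
  have hc1 : Integrable (fun x => ((u * Y x : ℝ) : ℂ) * Complex.I) μ :=
    ((hi1.const_mul u).ofReal).mul_const _
  have hc2 : Integrable (fun x => ((u * Y x : ℝ) : ℂ) ^ 2 / 2) μ := by
    have : Integrable (fun x => (((u ^ 2 * Y x ^ 2 : ℝ)) : ℂ)) μ := (hi2.const_mul (u ^ 2)).ofReal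
    refine (this.div_const 2).congr (ae_of_all _ fun x => ?_)
    push_cast; ring
  have hs1 : Integrable (fun x => Complex.exp ((u * Y x : ℝ) * Complex.I) - 1) μ :=
    hE.sub (integrable_const _)
  have hs2 : Integrable (fun x => Complex.exp ((u * Y x : ℝ) * Complex.I) - 1 -
      (u * Y x : ℝ) * Complex.I) μ := hs1.sub hc1
  have e : ∫ x, Complex.exp ((u * Y x : ℝ) * Complex.I) ∂μ - 1 + u ^ 2 / 2 =
      ∫ x, (Complex.exp ((u * Y x : ℝ) * Complex.I) - 1 - (u * Y x : ℝ) * Complex.I +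
        ((u * Y x : ℝ) : ℂ) ^ 2 / 2) ∂μ := by
    rw [integral_add hs2 hc2]
    have hs : ∫ x, (Complex.exp ((u * Y x : ℝ) * Complex.I) - 1 - (u * Y x : ℝ) * Complex.I) ∂μ =
        ∫ x, Complex.exp ((u * Y x : ℝ) * Complex.I) ∂μ - 1 := by
      have e1 : ∫ x, ((u * Y x : ℝ) : ℂ) * Complex.I ∂μ = 0 := by
        rw [integral_mul_const, integral_complex_ofReal, integral_const_mul, h1]; simp
      rw [integral_sub hs1 hc1, integral_sub hE (integrable_const _), e1]
      simp
    have e2 : ∫ x, ((u * Y x : ℝ) : ℂ) ^ 2 / 2 ∂μ = ((u ^ 2 / 2 : ℝ) : ℂ) := by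
      have : ∀ x, ((u * Y x : ℝ) : ℂ) ^ 2 / 2 = ((u ^ 2 / 2 * Y x ^ 2 : ℝ) : ℂ) := fun x => by
        push_cast; ring
      simp_rw [this]
      rw [integral_complex_ofReal, integral_const_mul, h2]
      push_cast; ring
    have e3 : (u : ℂ) ^ 2 / 2 = ((u ^ 2 / 2 : ℝ) : ℂ) := by push_cast; rfl
    rw [← hs, e3, ← e2]
  rw [e, ← integral_const_mul]
  refine norm_integral_le_of_norm_le (hi3.const_mul _) (ae_of_all _ fun x => ?_)
  calc _ ≤ 5 * |u * Y x| ^ 3 := norm_exp_mul_I_sub_le _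
    _ = _ := by rw [abs_mul, mul_pow]; ring

/-- A central limit theorem for triangular arrays whose rows consist of independent and identically
distributed variables of mean `0` and variance `1`, under Lyapunov's condition with third moments. -/
theorem tendsto_pi_real_sum_le {Ω : Type*} [MeasurableSpace Ω] {k : ℕ → ℕ} (hk : Tendsto k atTop atTop)
    {μ : ℕ → Measure Ω} [∀ N, IsProbabilityMeasure (μ N)] {Y : ℕ → Ω → ℝ}
    (hm : ∀ N, Measurable (Y N)) (hY : ∀ᶠ N in atTop, MemLp (Y N) 2 (μ N))
    (h1 : ∀ᶠ N in atTop, ∫ x, Y N x ∂(μ N) = 0) (h2 : ∀ᶠ N in atTop, ∫ x, Y N x ^ 2 ∂(μ N) = 1)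
    (hi3 : ∀ᶠ N in atTop, Integrable (fun x => |Y N x| ^ 3) (μ N))
    (h3 : Tendsto (fun N => (∫ x, |Y N x| ^ 3 ∂(μ N)) / √(k N)) atTop (𝓝 0))
    {c : ℕ → ℝ} {α : ℝ} (hc : Tendsto c atTop (𝓝 (-α))) :
    Tendsto (fun N => (Measure.pi fun _ : Fin (k N) => μ N).real
      {x | (√(k N))⁻¹ * ∑ i, Y N (x i) ≤ c N}) atTop (𝓝 (gaussianTail α)) := by
  -- The shifted sum converges in law to a normal variable with mean `α`, and the event becomes
  -- `S N ≤ 0`.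
  set S : ∀ N, (Fin (k N) → Ω) → ℝ := fun N x => (√(k N))⁻¹ * ∑ i, Y N (x i) - c N with hS
  have hSm : ∀ N, Measurable (S N) := fun N => by
    have := hm N
    simp only [hS]
    fun_prop
  have hprob : ∀ N, IsProbabilityMeasure ((Measure.pi fun _ : Fin (k N) => μ N).map (S N)) :=
    fun N => Measure.isProbabilityMeasure_map (hSm N).aemeasurable
  have hkr : Tendsto (fun N => √(k N : ℝ)) atTop atTop :=
    Real.tendsto_sqrt_atTop.comp (tendsto_natCast_atTop_atTop.comp hk)
  have hcf : ∀ (N : ℕ) (t : ℝ), charFun ((Measure.pi fun _ : Fin (k N) => μ N).map (S N)) t =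
      Complex.exp (-(t * c N : ℝ) * Complex.I) *
        (∫ x, Complex.exp (((t * (√(k N))⁻¹) * Y N x : ℝ) * Complex.I) ∂(μ N)) ^ k N := by
    intro N t
    rw [charFun_apply_real, integral_map (hSm N).aemeasurable (by fun_prop)]
    have hp := integral_fintype_prod_eq_pow (ι := Fin (k N)) (μ := μ N)
      (fun x => Complex.exp (((t * (√(k N))⁻¹) * Y N x : ℝ) * Complex.I))
    rw [Fintype.card_fin] at hp
    rw [← hp, ← integral_const_mul]
    congr with x
    rw [← Complex.exp_sum, ← Complex.exp_add]
    congr 1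
    rw [hS, ← Finset.sum_mul]
    push_cast
    rw [← Finset.mul_sum]
    ring
  have hlim : ∀ t : ℝ, Tendsto (fun N => charFun ((Measure.pi fun _ : Fin (k N) => μ N).map (S N)) t)
      atTop (𝓝 (charFun (gaussianReal α 1) t)) := by
    intro t
    have hg : charFun (gaussianReal α 1) t =
        Complex.exp (-(t * -α : ℝ) * Complex.I) * Complex.exp (-(t ^ 2 / 2)) := by
      rw [charFun_gaussianReal, ← Complex.exp_add]
      push_cast
      ring_nf
    rw [hg]
    simp_rw [hcf]
    refine Tendsto.mul ?_ ?_
    · refine (Complex.continuous_exp.tendsto _).comp ?_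
      refine Tendsto.mul_const _ (Tendsto.neg ?_)
      exact (Complex.continuous_ofReal.tendsto _).comp (hc.const_mul t)
    · have hpow := tendsto_one_add_pow_of_tendsto_mul (z := -((t : ℂ) ^ 2 / 2)) hk
        (g := fun N => ∫ x, Complex.exp (((t * (√(k N))⁻¹) * Y N x : ℝ) * Complex.I) ∂(μ N) - 1) ?_
      · simpa using hpow
      · rw [tendsto_iff_norm_sub_tendsto_zero]
        have hb : Tendsto (fun N => 5 * |t| ^ 3 * ((∫ x, |Y N x| ^ 3 ∂(μ N)) / √(k N)))
            atTop (𝓝 0) := by simpa using h3.const_mul (5 * |t| ^ 3)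
        refine squeeze_zero' (Eventually.of_forall fun _ => norm_nonneg _) ?_ hb
        filter_upwards [hY, h1, h2, hi3, hkr.eventually_gt_atTop 0] with N a1 a2 a3 a4 hk0
        have h := norm_integral_exp_sub_le a1 a2 a3 a4 (t * (√(k N))⁻¹)
        have hkk : (k N : ℝ) = √(k N : ℝ) * √(k N : ℝ) :=
          (Real.mul_self_sqrt (Nat.cast_nonneg _)).symm
        have hkc : (k N : ℂ) = ((√(k N : ℝ) : ℝ) : ℂ) * ((√(k N : ℝ) : ℝ) : ℂ) := by
          rw [← Complex.ofReal_mul, ← hkk, Complex.ofReal_natCast]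
        have hne : ((√(k N : ℝ) : ℝ) : ℂ) ≠ 0 := by exact_mod_cast hk0.ne'
        have e : (k N : ℂ) * (∫ x, Complex.exp (((t * (√(k N))⁻¹) * Y N x : ℝ) * Complex.I) ∂(μ N)
            - 1) - -((t : ℂ) ^ 2 / 2) = (k N : ℂ) *
            (∫ x, Complex.exp (((t * (√(k N))⁻¹) * Y N x : ℝ) * Complex.I) ∂(μ N)
            - 1 + ((t * (√(k N))⁻¹ : ℝ) : ℂ) ^ 2 / 2) := by
          have : (k N : ℂ) * (((t * (√(k N))⁻¹ : ℝ) : ℂ) ^ 2 / 2) = (t : ℂ) ^ 2 / 2 := by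
            rw [hkc]; push_cast; field_simp
          rw [mul_add, this]; ring
        rw [e, norm_mul, Complex.norm_natCast]
        calc _ ≤ (k N : ℝ) * (5 * |t * (√(k N))⁻¹| ^ 3 * ∫ x, |Y N x| ^ 3 ∂(μ N)) := by gcongr
          _ = _ := by
            rw [abs_mul, abs_of_pos (inv_pos.2 hk0)]
            generalize √(k N : ℝ) = r at *
            rw [hkk]
            field_simp
  have hweak := ProbabilityMeasure.tendsto_of_tendsto_charFun
    (μ := fun N => (⟨(Measure.pi fun _ : Fin (k N) => μ N).map (S N), hprob N⟩ :
      ProbabilityMeasure ℝ)) (μ₀ := ⟨gaussianReal α 1, inferInstance⟩) hlim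
  have hnull : (gaussianReal α 1) (frontier (Set.Iic (0 : ℝ))) = 0 := by
    have := nullSingletonClass_gaussianReal (μ := α) (v := 1) one_ne_zero
    rw [frontier_Iic, measure_singleton]
  have hfin : Tendsto (fun N => ((Measure.pi fun _ : Fin (k N) => μ N).map (S N)) (Set.Iic 0))
      atTop (𝓝 (gaussianReal α 1 (Set.Iic 0))) :=
    ProbabilityMeasure.tendsto_measure_of_null_frontier_of_tendsto' hweak
    (E := Set.Iic 0) hnull
  have htail : gaussianTail α = ((gaussianReal α 1) (Set.Iic (0 : ℝ))).toReal := by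
    have : (gaussianReal 0 1).map (fun x => α - x) = gaussianReal α 1 := by
      rw [gaussianReal_map_const_sub]; simp
    rw [← this, Measure.map_apply (by fun_prop) measurableSet_Iic, gaussianTail, measureReal_def]
    congr 2
    ext x
    simp
  rw [htail]
  refine ((ENNReal.tendsto_toReal (measure_ne_top (gaussianReal α 1) _)).comp hfin).congr fun N => ?_
  simp only [Function.comp_apply]
  rw [Measure.map_apply (hSm N) measurableSet_Iic, measureReal_def]
  congr 2
  ext x
  simp [hS]

/-! ### Asymptotics of the varentropy at entropic times -/

lemma exists_entropy_eq (w : WalkKind) {h : ℝ} (hh : 0 ≤ h) : ∃ s, entropy w s = h :=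
  mem_range_of_exists_le_of_exists_ge (continuous_entropy w) ⟨0, by rwa [entropy_zero]⟩
    ((tendsto_entropy_atTop w).eventually_ge_atTop h).exists

lemma tendsto_of_tendsto_entropy {ι : Type*} {w : WalkKind} {l : Filter ι} {s : ι → ℝ≥0} {c : ℝ≥0}
    (h : Tendsto (fun N => entropy w (s N)) l (𝓝 (entropy w c))) : Tendsto s l (𝓝 c) := by
  have hm := strictMono_entropy w
  refine tendsto_order.2 ⟨fun a ha => ?_, fun a ha => ?_⟩
  · filter_upwards [h.eventually_const_lt (hm ha)] with N hN using hm.lt_iff_lt.1 hN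
  · filter_upwards [h.eventually_lt_const (hm ha)] with N hN using hm.lt_iff_lt.1 hN

lemma tendsto_atTop_of_tendsto_entropy {ι : Type*} {w : WalkKind} {l : Filter ι} {s : ι → ℝ≥0}
    (h : Tendsto (fun N => entropy w (s N)) l atTop) : Tendsto s l atTop := by
  refine tendsto_atTop.2 fun b => ?_
  filter_upwards [h.eventually_ge_atTop (entropy w b)] with N hN using
    (strictMono_entropy w).le_iff_le.1 hN

lemma pos_of_entropy_pos {w : WalkKind} {s : ℝ≥0} (h : 0 < entropy w s) : 0 < s := by
  rcases eq_or_ne s 0 with rfl | hs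
  · simp at h
  · exact pos_iff_ne_zero.2 hs

/-- Along an ultrafilter, positive times are asymptotically long, of constant order or short. -/
lemma tendsto_trichotomy {ι : Type*} (l : Ultrafilter ι) {s : ι → ℝ≥0}
    (hs : ∀ᶠ N in (l : Filter ι), 0 < s N) :
    Tendsto s l atTop ∨ (∃ c, 0 < c ∧ Tendsto s l (𝓝 c)) ∨ Tendsto s l (𝓝[>] 0) := by
  by_cases h : Tendsto s l atTop
  · exact Or.inl h
  rw [tendsto_atTop] at h
  push Not at h
  obtain ⟨b, hb⟩ := h
  have hb' : ∀ᶠ N in (l : Filter ι), s N ∈ Set.Icc 0 b := by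
    filter_upwards [hb] with N hN
    exact ⟨zero_le, hN.le⟩
  obtain ⟨c, -, hc⟩ := isCompact_Icc.ultrafilter_le_nhds (l.map s)
    (le_principal_iff.2 hb')
  have hc' : Tendsto s l (𝓝 c) := hc
  rcases eq_or_ne c 0 with rfl | hc0
  · exact Or.inr (Or.inr (tendsto_nhdsWithin_iff.2 ⟨hc', hs⟩))
  · exact Or.inr (Or.inl ⟨c, pos_iff_ne_zero.2 hc0, hc'⟩)

/-- The regime of times of constant order or longer: the varentropy has a positive limit and the
Lyapunov ratio is bounded. -/
lemma tendsto_dichotomy (w : WalkKind) {ι : Type*} (l : Ultrafilter ι) {s : ι → ℝ≥0}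
    (hs : ∀ᶠ N in (l : Filter ι), 0 < s N) :
    (∃ v e C : ℝ, 0 < v ∧ Tendsto (fun N => varentropy w (s N)) l (𝓝 v) ∧
      Tendsto (fun N => (entropy w (s N))⁻¹) l (𝓝 e) ∧
      ∀ᶠ N in (l : Filter ι), lyapunovRatio w (s N) ≤ C) ∨ Tendsto s l (𝓝[>] 0) := by
  have key : ∀ v C : ℝ, 0 < v → Tendsto (fun N => varentropy w (s N)) l (𝓝 v) →
      (∀ᶠ N in (l : Filter ι), thirdMoment w (s N) ≤ C) →
      ∀ᶠ N in (l : Filter ι), lyapunovRatio w (s N) ≤ C ^ 2 / (v / 2) ^ 3 := by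
    intro v C hv hV hT
    filter_upwards [hV.eventually_const_lt (half_lt_self hv), hT] with N h1 h2
    have h0 := thirdMoment_nonneg w (s N)
    rw [lyapunovRatio]
    gcongr
  rcases tendsto_trichotomy l hs with h | ⟨c, hc, h⟩ | h
  · left
    obtain ⟨C, hC⟩ := eventually_thirdMoment_le w
    have hV := (tendsto_varentropy_atTop w).comp h
    exact ⟨1 / 2, 0, _, one_half_pos, hV,
      tendsto_inv_atTop_zero.comp ((tendsto_entropy_atTop w).comp h),
      key _ C one_half_pos hV (h.eventually hC)⟩
  · left
    have hV : Tendsto (fun N => varentropy w (s N)) l (𝓝 (varentropy w c)) :=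
      ((continuousOn_varentropy w).continuousAt (Ioi_mem_nhds hc)).tendsto.comp h
    have hE : Tendsto (fun N => entropy w (s N)) l (𝓝 (entropy w c)) :=
      ((continuous_entropy w).tendsto c).comp h
    have hE0 : 0 < entropy w c := by simpa using strictMono_entropy w hc
    have h3 : Tendsto (fun N => ∫ x, unitQ w (s N) x ^ 3 ∂(unitRateLaw w (s N))) l
        (𝓝 (∫ x, unitQ w c x ^ 3 ∂(unitRateLaw w c))) :=
      ((continuousOn_integral_unitQ_pow w 3).continuousAt (Ioi_mem_nhds hc)).tendsto.comp h
    refine ⟨_, _, _, varentropy_pos w hc, hV, hE.inv₀ hE0.ne',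
      key _ (∫ x, unitQ w c x ^ 3 ∂(unitRateLaw w c) + entropy w c ^ 3 + 1)
        (varentropy_pos w hc) hV ?_⟩
    filter_upwards [(h3.add (hE.pow 3)).eventually_lt_const (lt_add_one _)] with N hN
    exact (thirdMoment_le_add w (s N)).trans hN.le
  · exact Or.inr h

section Scales

variable {k n : ℕ → ℕ} {w : WalkKind} {l : Filter ℕ} {s s' : ℕ → ℝ≥0}

lemma tendsto_log_natCast (hn : Tendsto n l atTop) :
    Tendsto (fun N => Real.log (n N)) l atTop :=
  Real.tendsto_log_atTop.comp (tendsto_natCast_atTop_atTop.comp hn)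

lemma tendsto_entropy_mul (hn : Tendsto n l atTop)
    (hs : Tendsto (fun N => entropy w (s N) * k N / Real.log (n N)) l (𝓝 1)) :
    Tendsto (fun N => entropy w (s N) * k N) l atTop := by
  have hL := tendsto_log_natCast hn
  refine (hs.pos_mul_atTop one_pos hL).congr' ?_
  filter_upwards [hL.eventually_gt_atTop 0] with N hN
  field_simp

lemma eventually_pos_of_tendsto (hn : Tendsto n l atTop)
    (hs : Tendsto (fun N => entropy w (s N) * k N / Real.log (n N)) l (𝓝 1)) :
    ∀ᶠ N in l, 0 < s N ∧ 0 < entropy w (s N) ∧ (0 : ℝ) < k N := by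
  filter_upwards [(tendsto_entropy_mul hn hs).eventually_gt_atTop 0] with N hN
  have h1 : 0 < entropy w (s N) := pos_of_mul_pos_left hN (Nat.cast_nonneg _)
  exact ⟨pos_of_entropy_pos h1, h1, pos_of_mul_pos_right hN h1.le⟩

lemma tendsto_neg_log_entropy (hs0 : Tendsto s l (𝓝[>] 0)) :
    Tendsto (fun N => -Real.log (entropy w (s N))) l atTop := by
  have h : Tendsto (entropy w) (𝓝[>] 0) (𝓝[>] 0) := by
    refine tendsto_nhdsWithin_iff.2 ⟨tendsto_entropy_nhdsGT_zero w, ?_⟩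
    filter_upwards [eventually_mem_nhdsWithin] with s hs
    simpa using strictMono_entropy w hs
  exact tendsto_neg_atBot_atTop.comp (Real.tendsto_log_nhdsGT_zero.comp (h.comp hs0))

/-- This is where the assumption `log k ≪ log n` enters: at short times the entropy per coordinate
is at least `1 / k`, up to constants, so its logarithm is negligible against `log n`. -/
lemma tendsto_neg_log_entropy_div (hn : Tendsto n l atTop)
    (hkn : Tendsto (fun N => Real.log (k N) / Real.log (n N)) l (𝓝 0))
    (hs : Tendsto (fun N => entropy w (s N) * k N / Real.log (n N)) l (𝓝 1))
    (hs0 : Tendsto s l (𝓝[>] 0)) :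
    Tendsto (fun N => -Real.log (entropy w (s N)) / (entropy w (s N) * k N)) l (𝓝 0) := by
  have hb : Tendsto (fun N => 2 * (Real.log (k N) / Real.log (n N))) l (𝓝 0) := by
    simpa using hkn.const_mul 2
  refine squeeze_zero' ?_ ?_ hb
  · filter_upwards [(tendsto_neg_log_entropy (w := w) hs0).eventually_ge_atTop 0] with N hN
    have := entropy_nonneg w (s N)
    positivity
  · filter_upwards [eventually_pos_of_tendsto hn hs, hs.eventually_const_lt one_half_lt_one,
      (tendsto_log_natCast hn).eventually_ge_atTop 2,
      (tendsto_neg_log_entropy (w := w) hs0).eventually_ge_atTop 0] with N ⟨_, hE, hk⟩ h2 h3 h4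
    rw [lt_div_iff₀ (by linarith)] at h2
    have h5 : -Real.log (entropy w (s N)) ≤ Real.log (k N) := by
      have := Real.log_nonneg (show 1 ≤ entropy w (s N) * k N by linarith)
      rw [Real.log_mul hE.ne' hk.ne'] at this
      linarith
    calc -Real.log (entropy w (s N)) / (entropy w (s N) * k N)
        ≤ Real.log (k N) / (1 / 2 * Real.log (n N)) := by
          have : 0 ≤ Real.log (k N) := h4.trans h5
          gcongr
      _ = _ := by field_simp

/-- The standard deviation `√(V k)` of the information content of the walk is negligible against
its mean `h k`. -/
lemma tendsto_varentropy_div_sq (hn : Tendsto n l atTop)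
    (hkn : Tendsto (fun N => Real.log (k N) / Real.log (n N)) l (𝓝 0))
    (hs : Tendsto (fun N => entropy w (s N) * k N / Real.log (n N)) l (𝓝 1)) :
    Tendsto (fun N => varentropy w (s N) * k N / (entropy w (s N) * k N) ^ 2) l (𝓝 0) := by
  rw [tendsto_iff_ultrafilter]
  intro g hg
  replace hn := hn.mono_left hg
  replace hkn := hkn.mono_left hg
  replace hs := hs.mono_left hg
  have hpos := eventually_pos_of_tendsto hn hs
  have hEk := tendsto_entropy_mul hn hs
  rcases tendsto_dichotomy w g (hpos.mono fun N h => h.1) with ⟨v, e, C, hv, hV, he, -⟩ | h0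
  · have := (hV.mul he).mul (tendsto_inv_atTop_zero.comp hEk)
    rw [mul_zero] at this
    refine this.congr' ?_
    filter_upwards [hpos] with N ⟨_, h1, h2⟩
    simp only [Function.comp_apply]
    field_simp
  · have := ((tendsto_varentropy_div_entropy w).comp h0).mul
      (tendsto_neg_log_entropy_div hn hkn hs h0)
    rw [mul_zero] at this
    refine this.congr' ?_
    filter_upwards [hpos, (tendsto_neg_log_entropy (w := w) h0).eventually_gt_atTop 0]
      with N ⟨_, h1, h2⟩ h3
    simp only [Function.comp_apply]
    have : Real.log (entropy w (s N)) ≠ 0 := by linarith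
    field_simp

lemma tendsto_varentropy_mul (hn : Tendsto n l atTop) (hk : Tendsto k l atTop)
    (hs : Tendsto (fun N => entropy w (s N) * k N / Real.log (n N)) l (𝓝 1)) :
    Tendsto (fun N => varentropy w (s N) * k N) l atTop := by
  rw [tendsto_iff_ultrafilter]
  intro g hg
  replace hn := hn.mono_left hg
  replace hk := hk.mono_left hg
  replace hs := hs.mono_left hg
  have hpos := eventually_pos_of_tendsto hn hs
  rcases tendsto_dichotomy w g (hpos.mono fun N h => h.1) with ⟨v, e, C, hv, hV, -, -⟩ | h0
  · exact hV.pos_mul_atTop hv (tendsto_natCast_atTop_atTop.comp hk)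
  · refine (((tendsto_varentropy_div_entropy w).comp h0).pos_mul_atTop one_pos
      ((tendsto_entropy_mul hn hs).atTop_mul_atTop₀ (tendsto_neg_log_entropy (w := w) h0))).congr' ?_
    filter_upwards [hpos, (tendsto_neg_log_entropy (w := w) h0).eventually_gt_atTop 0]
      with N ⟨_, h1, h2⟩ h3
    simp only [Function.comp_apply]
    have : Real.log (entropy w (s N)) ≠ 0 := by linarith
    field_simp

/-- Lyapunov's condition for the information content of the walk. -/
lemma tendsto_lyapunovRatio_div (hn : Tendsto n l atTop) (hk : Tendsto k l atTop)
    (hkn : Tendsto (fun N => Real.log (k N) / Real.log (n N)) l (𝓝 0))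
    (hs : Tendsto (fun N => entropy w (s N) * k N / Real.log (n N)) l (𝓝 1)) :
    Tendsto (fun N => lyapunovRatio w (s N) / k N) l (𝓝 0) := by
  rw [tendsto_iff_ultrafilter]
  intro g hg
  replace hn := hn.mono_left hg
  replace hk := hk.mono_left hg
  replace hkn := hkn.mono_left hg
  replace hs := hs.mono_left hg
  have hpos := eventually_pos_of_tendsto hn hs
  have hR : ∀ N, 0 ≤ lyapunovRatio w (s N) := fun N => by
    have := varentropy_nonneg w (s N)
    unfold lyapunovRatio
    positivity
  have hkr : Tendsto (fun N => (k N : ℝ)) g atTop := tendsto_natCast_atTop_atTop.comp hk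
  have h0 : ∀ᶠ N in (g : Filter ℕ), 0 ≤ lyapunovRatio w (s N) / k N :=
    Eventually.of_forall fun N => div_nonneg (hR N) (Nat.cast_nonneg _)
  rcases tendsto_dichotomy w g (hpos.mono fun N h => h.1) with ⟨v, e, C, hv, -, -, hC⟩ | hs0
  · refine squeeze_zero' h0 ?_ ((tendsto_const_nhds (x := C)).div_atTop hkr)
    filter_upwards [hC] with N hN
    gcongr
  · have hb := (tendsto_neg_log_entropy_div hn hkn hs hs0).const_mul 1000
    rw [mul_zero] at hb
    refine squeeze_zero' h0 ?_ hb
    filter_upwards [hpos, (tendsto_neg_log_entropy (w := w) hs0).eventually_gt_atTop 0,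
      hs0.eventually (eventually_lyapunovRatio_le w)] with N ⟨_, h1, h2⟩ h3 h4
    rw [← mul_div_assoc, div_le_iff₀ h3] at h4
    rw [← mul_div_assoc, div_le_div_iff₀ h2 (by positivity)]
    nlinarith

/-- The varentropy varies slowly on the scale of the entropy. -/
lemma tendsto_varentropy_div_varentropy (hn : Tendsto n l atTop)
    (hs : Tendsto (fun N => entropy w (s N) * k N / Real.log (n N)) l (𝓝 1))
    (hs' : Tendsto (fun N => entropy w (s' N) * k N / Real.log (n N)) l (𝓝 1)) :
    Tendsto (fun N => varentropy w (s N) / varentropy w (s' N)) l (𝓝 1) := by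
  rw [tendsto_iff_ultrafilter]
  intro g hg
  replace hn := hn.mono_left hg
  replace hs := hs.mono_left hg
  replace hs' := hs'.mono_left hg
  have hpos := eventually_pos_of_tendsto hn hs
  have hpos' := eventually_pos_of_tendsto hn hs'
  have hratio : Tendsto (fun N => entropy w (s' N) / entropy w (s N)) g (𝓝 1) := by
    have := hs'.div hs one_ne_zero
    rw [div_one] at this
    refine this.congr' ?_
    filter_upwards [hpos, (tendsto_log_natCast hn).eventually_gt_atTop 0] with N ⟨_, h1, h2⟩ h3
    simp only [Pi.div_apply]
    field_simp
  have hEs' : ∀ᶠ N in (g : Filter ℕ),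
      entropy w (s' N) / entropy w (s N) * entropy w (s N) = entropy w (s' N) := by
    filter_upwards [hpos] with N ⟨_, h1, _⟩
    field_simp
  rcases tendsto_trichotomy g (hpos.mono fun N h => h.1) with h | ⟨c, hc, h⟩ | h
  · have h' : Tendsto s' g atTop := by
      refine tendsto_atTop_of_tendsto_entropy (w := w) (Tendsto.congr' hEs' ?_)
      exact hratio.pos_mul_atTop one_pos ((tendsto_entropy_atTop w).comp h)
    have := ((tendsto_varentropy_atTop w).comp h).div ((tendsto_varentropy_atTop w).comp h')
      (by norm_num)
    rw [div_self (by norm_num)] at this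
    exact this
  · have hE : Tendsto (fun N => entropy w (s N)) g (𝓝 (entropy w c)) :=
      ((continuous_entropy w).tendsto c).comp h
    have h' : Tendsto s' g (𝓝 c) := by
      refine tendsto_of_tendsto_entropy (w := w) (Tendsto.congr' hEs' ?_)
      simpa using hratio.mul hE
    have hV := ((continuousOn_varentropy w).continuousAt (Ioi_mem_nhds hc)).tendsto
    have := (hV.comp h).div (hV.comp h') (varentropy_pos w hc).ne'
    rw [div_self (varentropy_pos w hc).ne'] at this
    exact this
  · have hE : Tendsto (fun N => entropy w (s N)) g (𝓝 (entropy w 0)) := by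
      rw [entropy_zero]
      exact (tendsto_entropy_nhdsGT_zero w).comp h
    have h' : Tendsto s' g (𝓝[>] 0) := by
      refine tendsto_nhdsWithin_iff.2 ⟨tendsto_of_tendsto_entropy (w := w)
        (Tendsto.congr' hEs' ?_), hpos'.mono fun N h => h.1⟩
      simpa using hratio.mul hE
    have hL := tendsto_neg_log_entropy (w := w) h
    have hlog : Tendsto (fun N => Real.log (entropy w (s' N)) / Real.log (entropy w (s N))) g
        (𝓝 1) := by
      have h1 : Tendsto (fun N => Real.log (entropy w (s' N) / entropy w (s N))) g (𝓝 0) := by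
        simpa using hratio.log one_ne_zero
      have h2 := (h1.div_atTop hL).const_sub 1
      rw [sub_zero] at h2
      refine h2.congr' ?_
      filter_upwards [hpos, hpos', hL.eventually_gt_atTop 0] with N ⟨_, a1, _⟩ ⟨_, a2, _⟩ a3
      rw [Real.log_div a2.ne' a1.ne']
      have : Real.log (entropy w (s N)) ≠ 0 := by linarith
      field_simp
      ring
    have := (((tendsto_varentropy_div_entropy w).comp h).div
      ((tendsto_varentropy_div_entropy w).comp h') one_ne_zero).div (hratio.mul hlog) (by norm_num)
    norm_num at this
    refine this.congr' ?_
    filter_upwards [hpos, hpos', hL.eventually_gt_atTop 0,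
      (tendsto_neg_log_entropy (w := w) h').eventually_gt_atTop 0]
      with N ⟨_, a1, _⟩ ⟨a4, a2, _⟩ a3 a5
    have e1 : Real.log (entropy w (s N)) ≠ 0 := by linarith
    have e2 : Real.log (entropy w (s' N)) ≠ 0 := by linarith
    have := (varentropy_pos w a4).ne'
    simp only [Pi.div_apply, Function.comp_apply]
    field_simp

end Scales

/-! ### The information content of the walk -/

lemma ae_pmf_ne_zero (w : WalkKind) (s : ℝ≥0) : ∀ᵐ x ∂(unitRateLaw w s), pmf w s x ≠ 0 := by
  rw [ae_iff_of_countable]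
  intro x hx
  exact (ENNReal.toReal_pos hx (measure_ne_top _ _)).ne'

/-- As the coordinates of the walk are independent, its information content is the sum of those of
the coordinates. -/
lemma walkQ_ae_eq (w : WalkKind) (k : ℕ) (t : ℝ≥0) :
    walkQ w k t =ᵐ[walkLaw w k t] fun x => ∑ i, unitQ w (t / k) (x i) := by
  have h : ∀ᵐ x ∂(walkLaw w k t), ∀ i, pmf w (t / k) (x i) ≠ 0 :=
    ae_all_iff.2 fun i => (Measure.quasiMeasurePreserving_eval
      (fun _ : Fin k => unitRateLaw w (t / k)) i).ae (ae_pmf_ne_zero w (t / k))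
  filter_upwards [h] with x hx
  have hp : (walkLaw w k t).real {x} = ∏ i, pmf w (t / k) (x i) := by
    rw [measureReal_def, walkLaw, Measure.pi_singleton, ENNReal.toReal_prod]
    rfl
  rw [walkQ, hp, Real.log_prod fun i _ => hx i, ← Finset.sum_neg_distrib]
  rfl

lemma varQ_eq (w : WalkKind) (k : ℕ) (t : ℝ≥0) : varQ w k t = varQ₁ w k t * k := by
  rw [varQ, variance_congr (walkQ_ae_eq w k t), walkLaw]
  have h := variance_sum_pi (μ := fun _ : Fin k => coordLaw w k t)
    (X := fun _ => unitQ w (t / k)) fun _ => memLp_two_unitQ w (t / k)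
  have e : (∑ i : Fin k, fun x : Fin k → ℤ => unitQ w (t / k) (x i)) =
      fun x => ∑ i, unitQ w (t / k) (x i) := by
    ext x; simp
  rw [e] at h
  rw [h, Finset.sum_const, Finset.card_univ, Fintype.card_fin, nsmul_eq_mul, mul_comm]
  rfl

/-- The information content of a coordinate, centred and scaled to unit variance. -/
noncomputable def stdUnitQ (w : WalkKind) (s : ℝ≥0) (x : ℤ) : ℝ :=
  (unitQ w s x - entropy w s) / √(varentropy w s)

lemma probQLe_eq (w : WalkKind) {k : ℕ} (hk : 0 < k) {t : ℝ≥0} (ht : 0 < t / k) (c : ℝ) :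
    probQLe w k t c = (Measure.pi fun _ : Fin k => unitRateLaw w (t / k)).real
      {x | (√k)⁻¹ * ∑ i, stdUnitQ w (t / k) (x i) ≤
        (c - entropy w (t / k) * k) / √(varentropy w (t / k) * k)} := by
  have hV := varentropy_pos w ht
  have hk' : (0 : ℝ) < k := Nat.cast_pos.2 hk
  refine measureReal_congr ?_
  filter_upwards [walkQ_ae_eq w k t] with x hx
  refine propext ?_
  change walkQ w k t x ≤ c ↔ _ ≤ _
  have e : (√k)⁻¹ * ∑ i, stdUnitQ w (t / k) (x i) =
      (∑ i, unitQ w (t / k) (x i) - entropy w (t / k) * k) / √(varentropy w (t / k) * k) := by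
    simp only [stdUnitQ]
    rw [← Finset.sum_div, Finset.sum_sub_distrib, Finset.sum_const, Finset.card_univ,
      Fintype.card_fin, nsmul_eq_mul, Real.sqrt_mul hV.le]
    field_simp
  rw [hx, e, div_le_div_iff_of_pos_right (by positivity), sub_le_sub_iff_right]

lemma integral_stdUnitQ (w : WalkKind) (s : ℝ≥0) : ∫ x, stdUnitQ w s x ∂(unitRateLaw w s) = 0 := by
  simp only [stdUnitQ]
  rw [integral_div, integral_sub (integrable_unitQ w s) (integrable_const _)]
  simp [entropy]

lemma integral_stdUnitQ_sq (w : WalkKind) {s : ℝ≥0} (hs : 0 < s) :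
    ∫ x, stdUnitQ w s x ^ 2 ∂(unitRateLaw w s) = 1 := by
  have hV := varentropy_pos w hs
  have h : varentropy w s = ∫ x, (unitQ w s x - entropy w s) ^ 2 ∂(unitRateLaw w s) :=
    variance_eq_integral (by fun_prop)
  simp only [stdUnitQ, div_pow, Real.sq_sqrt hV.le]
  rw [integral_div, ← h, div_self hV.ne']

lemma integral_abs_stdUnitQ_pow_three_div (w : WalkKind) (s : ℝ≥0) (k : ℕ) :
    (∫ x, |stdUnitQ w s x| ^ 3 ∂(unitRateLaw w s)) / √k = √(lyapunovRatio w s / k) := by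
  have hV := varentropy_nonneg w s
  have h3 := thirdMoment_nonneg w s
  have : ∀ x, |stdUnitQ w s x| ^ 3 = |unitQ w s x - entropy w s| ^ 3 / √(varentropy w s) ^ 3 :=
    fun x => by rw [stdUnitQ, abs_div, abs_of_nonneg (Real.sqrt_nonneg _), div_pow]
  simp_rw [this]
  rw [integral_div, lyapunovRatio, Real.sqrt_div (by positivity), Real.sqrt_div (by positivity),
    Real.sqrt_sq h3]
  congr 2
  rw [eq_comm, Real.sqrt_eq_iff_eq_sq (by positivity) (by positivity), ← pow_mul, mul_comm 3 2,
    pow_mul, Real.sq_sqrt hV]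

/-- A central limit theorem for the information content of the walk. -/
lemma tendsto_probQLe {w : WalkKind} {k : ℕ → ℕ} (hk : Tendsto k atTop atTop) {t : ℕ → ℝ≥0}
    (ht : ∀ᶠ N in atTop, 0 < t N / k N)
    (hR : Tendsto (fun N => lyapunovRatio w (t N / k N) / k N) atTop (𝓝 0)) {c : ℕ → ℝ} {α : ℝ}
    (hc : Tendsto (fun N => (c N - entropy w (t N / k N) * k N) /
      √(varentropy w (t N / k N) * k N)) atTop (𝓝 (-α))) :
    Tendsto (fun N => probQLe w (k N) (t N) (c N)) atTop (𝓝 (gaussianTail α)) := by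
  have h := tendsto_pi_real_sum_le hk (μ := fun N => unitRateLaw w (t N / k N))
    (Y := fun N => stdUnitQ w (t N / k N)) (fun N => Measurable.of_discrete)
    (Eventually.of_forall fun N => ?_) (Eventually.of_forall fun N => integral_stdUnitQ w _)
    (ht.mono fun N hN => integral_stdUnitQ_sq w hN) (Eventually.of_forall fun N => ?_) ?_ hc
  · refine h.congr' ?_
    filter_upwards [ht, hk.eventually_gt_atTop 0] with N h1 h2
    exact (probQLe_eq w h2 h1 _).symm
  · have := ((memLp_two_unitQ w (t N / k N)).sub (memLp_const (entropy w (t N / k N)))).mul_const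
      (√(varentropy w (t N / k N)))⁻¹
    exact this.ae_eq (ae_of_all _ fun x => (div_eq_mul_inv _ _).symm)
  · refine ((integrable_abs_sub_pow_three w (t N / k N) (entropy w (t N / k N))).div_const
      (√(varentropy w (t N / k N)) ^ 3)).congr (ae_of_all _ fun x => ?_)
    simp only [stdUnitQ]
    rw [abs_div, abs_of_nonneg (Real.sqrt_nonneg _), div_pow]
  · simp_rw [integral_abs_stdUnitQ_pow_three_div]
    simpa using hR.sqrt

/-! ### Cutoff times -/

lemma tendsto_entropy_div_of_isEntropicTime {w : WalkKind} {k n : ℕ → ℕ}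
    (hn : Tendsto n atTop atTop) (hk : Tendsto k atTop atTop) {t₀ : ℕ → ℝ≥0}
    (h₀ : ∀ᶠ N in atTop, IsEntropicTime w (k N) (n N) (t₀ N)) :
    Tendsto (fun N => entropy w (t₀ N / k N) * k N / Real.log (n N)) atTop (𝓝 1) := by
  refine tendsto_const_nhds.congr' ?_
  filter_upwards [h₀, hk.eventually_gt_atTop 0, (tendsto_log_natCast hn).eventually_gt_atTop 0]
    with N h1 h2 h3
  have h1' : entropy w (t₀ N / k N) = Real.log (n N) / k N := h1
  have h2' : (0 : ℝ) < k N := Nat.cast_pos.2 h2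
  rw [h1']
  field_simp

/-- The fluctuation term in the definition of the cutoff time is negligible against `log n`. -/
lemma tendsto_add_mul_sqrt_div_log {w : WalkKind} {k n : ℕ → ℕ}
    (hn : Tendsto n atTop atTop) (hk : Tendsto k atTop atTop)
    (hkn : Tendsto (fun N => Real.log (k N) / Real.log (n N)) atTop (𝓝 0)) (α : ℝ)
    {t₀ : ℕ → ℝ≥0} (h₀ : ∀ᶠ N in atTop, IsEntropicTime w (k N) (n N) (t₀ N)) :
    Tendsto (fun N => (Real.log (n N) + α * √(varQ₁ w (k N) (t₀ N) * k N)) / Real.log (n N))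
      atTop (𝓝 1) := by
  have hs := tendsto_entropy_div_of_isEntropicTime hn hk h₀
  have h := ((tendsto_varentropy_div_sq hn hkn hs).sqrt.const_mul α).const_add 1
  rw [Real.sqrt_zero, mul_zero, add_zero] at h
  refine h.congr' ?_
  filter_upwards [h₀, hk.eventually_gt_atTop 0, (tendsto_log_natCast hn).eventually_gt_atTop 0]
    with N h1 h2 h3
  have h2' : (0 : ℝ) < k N := Nat.cast_pos.2 h2
  have h1' : entropy w (t₀ N / k N) * k N = Real.log (n N) := by
    rw [show entropy w (t₀ N / k N) = Real.log (n N) / k N from h1]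
    field_simp
  rw [h1', Real.sqrt_div' _ (sq_nonneg _), Real.sqrt_sq h3.le]
  change _ = (_ + α * √(varentropy w (t₀ N / k N) * k N)) / _
  field_simp

lemma tendsto_entropy_div_of_isCutoffTime {w : WalkKind} {k n : ℕ → ℕ}
    (hn : Tendsto n atTop atTop) (hk : Tendsto k atTop atTop)
    (hkn : Tendsto (fun N => Real.log (k N) / Real.log (n N)) atTop (𝓝 0)) {α : ℝ}
    {t₀ t : ℕ → ℝ≥0} (h₀ : ∀ᶠ N in atTop, IsEntropicTime w (k N) (n N) (t₀ N))
    (h : ∀ᶠ N in atTop, IsCutoffTime w (k N) (n N) (t₀ N) α (t N)) :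
    Tendsto (fun N => entropy w (t N / k N) * k N / Real.log (n N)) atTop (𝓝 1) := by
  refine (tendsto_add_mul_sqrt_div_log hn hk hkn α h₀).congr' ?_
  filter_upwards [h, hk.eventually_gt_atTop 0] with N h1 h2
  have h2' : (k N : ℝ) ≠ 0 := (Nat.cast_pos.2 h2).ne'
  rw [show entropy w (t N / k N) = _ from h1, div_mul_cancel₀ _ h2']

lemma exists_meanQ₁_eq (w : WalkKind) {k : ℕ} (hk : 0 < k) {h : ℝ} (hh : 0 ≤ h) :
    ∃ t, meanQ₁ w k t = h := by
  obtain ⟨s, hs⟩ := exists_entropy_eq w hh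
  refine ⟨s * k, ?_⟩
  change entropy w (s * k / k) = h
  rw [mul_div_cancel_right₀ _ (Nat.cast_ne_zero.2 hk.ne'), hs]

lemma exists_isEntropicTime (w : WalkKind) {k : ℕ} (hk : 0 < k) (n : ℕ) :
    ∃ t₀, IsEntropicTime w k n t₀ :=
  exists_meanQ₁_eq w hk (div_nonneg (Real.log_natCast_nonneg n) (Nat.cast_nonneg k))

lemma eventually_exists_isCutoffTime (w : WalkKind) {k n : ℕ → ℕ}
    (hn : Tendsto n atTop atTop) (hk : Tendsto k atTop atTop)
    (hkn : Tendsto (fun N => Real.log (k N) / Real.log (n N)) atTop (𝓝 0)) (α : ℝ) :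
    ∀ᶠ N in atTop, ∃ t₀ t : ℝ≥0, IsEntropicTime w (k N) (n N) t₀ ∧
      IsCutoffTime w (k N) (n N) t₀ α t := by
  have hex : ∀ N, ∃ t₀, 0 < k N → IsEntropicTime w (k N) (n N) t₀ := fun N => by
    by_cases hN : 0 < k N
    · exact (exists_isEntropicTime w hN (n N)).imp fun _ h _ => h
    · exact ⟨0, fun h => absurd h hN⟩
  choose t₀ ht₀ using hex
  have h₀ : ∀ᶠ N in atTop, IsEntropicTime w (k N) (n N) (t₀ N) := by
    filter_upwards [hk.eventually_gt_atTop 0] with N hN using ht₀ N hN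
  filter_upwards [h₀, hk.eventually_gt_atTop 0, (tendsto_log_natCast hn).eventually_gt_atTop 0,
    (tendsto_add_mul_sqrt_div_log hn hk hkn α h₀).eventually_const_lt zero_lt_one]
    with N h1 h2 h3 h4
  have h5 := (div_pos_iff_of_pos_right h3).1 h4
  obtain ⟨t, ht⟩ := exists_meanQ₁_eq w h2 (div_nonneg h5.le (Nat.cast_nonneg (k N)))
  exact ⟨t₀ N, t, h1, ht⟩

/-- At the cutoff time, the information content of the walk lies below `log n`, up to an error of
smaller order than the standard deviation, with probability asymptotic to the Gaussian tail. -/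
lemma tendsto_probQLe_of_isCutoffTime {w : WalkKind} {k n : ℕ → ℕ}
    (hn : Tendsto n atTop atTop) (hk : Tendsto k atTop atTop)
    (hkn : Tendsto (fun N => Real.log (k N) / Real.log (n N)) atTop (𝓝 0)) {α : ℝ}
    {t₀ t : ℕ → ℝ≥0} (h₀ : ∀ᶠ N in atTop, IsEntropicTime w (k N) (n N) (t₀ N))
    (h : ∀ᶠ N in atTop, IsCutoffTime w (k N) (n N) (t₀ N) α (t N)) {r : ℕ → ℝ}
    (hr : Tendsto (fun N => r N / √(varQ₁ w (k N) (t₀ N) * k N)) atTop (𝓝 0)) :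
    Tendsto (fun N => probQLe w (k N) (t N) (Real.log (n N) + r N)) atTop
      (𝓝 (gaussianTail α)) := by
  have hs := tendsto_entropy_div_of_isEntropicTime hn hk h₀
  have hs' := tendsto_entropy_div_of_isCutoffTime hn hk hkn h₀ h
  have hpos := eventually_pos_of_tendsto hn hs
  have hpos' := eventually_pos_of_tendsto hn hs'
  refine tendsto_probQLe hk (hpos'.mono fun N h => h.1) (tendsto_lyapunovRatio_div hn hk hkn hs') ?_
  have hl := (tendsto_varentropy_div_varentropy hn hs hs').sqrt.mul (hr.sub_const α)
  rw [Real.sqrt_one, one_mul, zero_sub] at hl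
  refine hl.congr' ?_
  filter_upwards [hpos, hpos', h] with N ⟨h1, _, hk0⟩ ⟨h2, _, _⟩ hN
  have hV := varentropy_pos w h1
  have hV' := varentropy_pos w h2
  have e : entropy w (t N / k N) * k N =
      Real.log (n N) + α * √(varentropy w (t₀ N / k N) * k N) := by
    rw [show entropy w (t N / k N) = _ from hN, div_mul_cancel₀ _ hk0.ne']
    rfl
  rw [e]
  change √(varentropy w (t₀ N / k N) / varentropy w (t N / k N)) *
    (r N / √(varentropy w (t₀ N / k N) * k N) - α) = _
  rw [Real.sqrt_mul hV.le, Real.sqrt_mul hV'.le, Real.sqrt_div hV.le]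
  have := Real.sqrt_pos.2 hV
  have := Real.sqrt_pos.2 hV'
  have := Real.sqrt_pos.2 hk0
  field_simp
  ring

end EntropicTimes

theorem mainTheorem4 (w : EntropicTimes.WalkKind) (k n : ℕ → ℕ)
    (hn : Tendsto n atTop atTop) (hk : Tendsto k atTop atTop)
    (hkn : Tendsto (fun N => Real.log (k N) / Real.log (n N)) atTop (𝓝 0)) (α : ℝ) :
    (∀ᶠ N in atTop, ∃ t₀ t : ℝ≥0, EntropicTimes.IsEntropicTime w (k N) (n N) t₀ ∧
      EntropicTimes.IsCutoffTime w (k N) (n N) t₀ α t) ∧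
    ∀ t₀ t : ℕ → ℝ≥0,
      (∀ᶠ N in atTop, EntropicTimes.IsEntropicTime w (k N) (n N) (t₀ N)) →
      (∀ᶠ N in atTop, EntropicTimes.IsCutoffTime w (k N) (n N) (t₀ N) α (t N)) →
      ∀ ω : ℕ → ℝ, (∀ N, ω N = EntropicTimes.varQ w (k N) (t₀ N) ^ (1 / 4 : ℝ)) →
        (∀ N, ω N = (EntropicTimes.varQ₁ w (k N) (t₀ N) * k N) ^ (1 / 4 : ℝ)) ∧
        Tendsto (fun N => EntropicTimes.probQLe w (k N) (t N) (Real.log (n N) + ω N))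
          atTop (𝓝 (EntropicTimes.gaussianTail α)) ∧
        Tendsto (fun N => EntropicTimes.probQLe w (k N) (t N) (Real.log (n N) - ω N))
          atTop (𝓝 (EntropicTimes.gaussianTail α)) := by
  refine ⟨EntropicTimes.eventually_exists_isCutoffTime w hn hk hkn α, fun t₀ t h₀ h ω hω => ?_⟩
  have hω' : ∀ N, ω N = (EntropicTimes.varQ₁ w (k N) (t₀ N) * k N) ^ (1 / 4 : ℝ) := fun N => by
    rw [hω, EntropicTimes.varQ_eq]
  have hvk : Tendsto (fun N => EntropicTimes.varQ₁ w (k N) (t₀ N) * k N) atTop atTop :=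
    EntropicTimes.tendsto_varentropy_mul hn hk
      (EntropicTimes.tendsto_entropy_div_of_isEntropicTime hn hk h₀)
  -- `ω / √(v k) = (v k) ^ (-1 / 4)`
  have hr : Tendsto (fun N => ω N / √(EntropicTimes.varQ₁ w (k N) (t₀ N) * k N)) atTop (𝓝 0) := by
    refine ((tendsto_rpow_neg_atTop (show (0 : ℝ) < 1 / 4 by norm_num)).comp hvk).congr' ?_
    filter_upwards [hvk.eventually_gt_atTop 0] with N hN
    rw [hω', Real.sqrt_eq_rpow, ← Real.rpow_sub hN, Function.comp_apply]
    norm_num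
  have hr' : Tendsto (fun N => -ω N / √(EntropicTimes.varQ₁ w (k N) (t₀ N) * k N)) atTop
      (𝓝 0) := by
    simpa [neg_div] using hr.neg
  refine ⟨hω', EntropicTimes.tendsto_probQLe_of_isCutoffTime hn hk hkn h₀ h hr, ?_⟩
  simpa only [sub_eq_add_neg] using
    EntropicTimes.tendsto_probQLe_of_isCutoffTime hn hk hkn h₀ h hr'
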